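/- Let $\rho,a_0,\varepsilon_1>0$, let $\ell\in\{1,-1\}$, let $\mathbb 1_\rho$ be the indicator function of the disk $\{|x|\le\rho\}\subset\mathbb R^2$, and for real $\varepsilon$ put $P_\varepsilon=-\Delta-(a_0^2-\varepsilon)\mathbb 1_\rho$ on $\mathbb R^2$, with polar coordinates $(r,\theta)$. A number $\lambda\in\mathbb C\setminus -i(0,\infty)$ is called a resonance of $P_\varepsilon$ if there is a solution $u\in L^2_{\mathrm{loc}}(\mathbb R^2)$, $u\not\equiv0$, of $(P_\varepsilon-\lambda^2)u=0$ which for $r>\rho$ has the form $u(r,\theta)=\sum_{m\in\mathbb Z}c_mH^{(1)}_m(\lambda r)e^{im\theta}$ (with $r^{-|m|}$ in place of $H^{(1)}_m(\lambda r)$ if $\lambda=0$), where $H^{(1)}_m$ is the branch of the Hankel function on the plane cut along $-i[0,\infty)$ that agrees with the principal one on the positive real axis. Let $\gamma$ be Euler's constant and $W_{-1}$ the standard branch with index $-1$ of the Lambert $W$ function (which is real and $\le-1$ on $[-1/e,0)$). Suppose that for $-\varepsilon_1<\varepsilon<0$ there are a real number $E_\varepsilon$ and a nontrivial $\psi_\varepsilon\in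 L^2(\mathbb R^2)$ with $\partial_\theta\psi_\varepsilon=i\ell\psi_\varepsilon$ and $(P_\varepsilon-E_\varepsilon)\psi_\varepsilon=0$, and that $E_\varepsilon\uparrow0$ as $\varepsilon\uparrow0$ (it suffices that $E_\varepsilon\to0$ and $E_\varepsilon<0$ for $\varepsilon<0$ near $0$). Then there is an $\varepsilon_0>0$ such that for $0<|\varepsilon|<\varepsilon_0$ the operator $P_\varepsilon$ has a resonance $\lambda=\lambda_\varepsilon$ satisfying, as $\varepsilon\to0$, $$\lambda_\varepsilon=\frac{2i}{\rho}\exp\left(\frac12-\gamma+\frac12W_{-1}\left(\frac{\varepsilon\rho^2e^{-1+2\gamma}}{4}\right)\right)+o(|\varepsilon|^{3/2}).$$ Moreover, as $\varepsilon\uparrow0$, $$E_\varepsilon=-\frac4{\rho^2}\exp\left(1-2\gamma+W_{-1}\left(\frac{\varepsilon\rho^2e^{-1+2\gamma}}{4}\right)\right)+o(\varepsilon^2)=-\frac{\varepsilon}{W_{-1}(\varepsilon\rho^2e^{-1+2\gamma}/4)}+o(\varepsilon^2).$$ -/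

import Mathlib

open Filter Topology Asymptotics MeasureTheory
open scoped ContDiff

noncomputable section

namespace CircularWell

/-! The plane `ℝ²` is identified with `ℂ` (isometrically, with its Lebesgue measure), so that
`|x| = ‖z‖` and `e^{iθ} = z / ‖z‖`. -/

/-- The logarithm on the plane cut along the negative imaginary axis: `Im (cutLog z)` is the
argument of `z` in `(-π/2, 3π/2)` for `z` off the cut. -/
def cutLog (z : ℂ) : ℂ :=
  Complex.log (-Complex.I * z) + Complex.I * (Real.pi / 2 : ℝ)

/-- The Bessel function `J_n` of integer order `n ≥ 0`,
`J_n(z) = (z/2)^n ∑_k (-z²/4)^k / (k! (n+k)!)`. -/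
def besselJ (n : ℕ) (z : ℂ) : ℂ :=
  (z / 2) ^ n * ∑' k : ℕ, (-z ^ 2 / 4) ^ k / ((k.factorial : ℂ) * ((n + k).factorial : ℂ))

/-- The digamma function at positive integers: `ψ(k + 1) = -γ + (1 + 1/2 + ⋯ + 1/k)`. -/
def digammaSucc (k : ℕ) : ℂ :=
  -(Real.eulerMascheroniConstant : ℂ) + ((harmonic k : ℚ) : ℂ)

/-- The Bessel function of the second kind `Y_n` of integer order `n ≥ 0`, given by its classical
power series
`π Y_n(z) = -(z/2)^{-n} ∑_{k<n} ((n-k-1)!/k!) (z²/4)^k + 2 log(z/2) J_n(z)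
  - (z/2)^n ∑_k (ψ(k+1) + ψ(n+k+1)) (-z²/4)^k / (k! (n+k)!)`,
with the branch of the logarithm cut along the negative imaginary axis. -/
def besselY (n : ℕ) (z : ℂ) : ℂ :=
  (1 / (Real.pi : ℂ)) *
    (-((z / 2) ^ n)⁻¹ * ∑ k ∈ Finset.range n,
        (((n - k - 1).factorial : ℂ) / (k.factorial : ℂ)) * (z ^ 2 / 4) ^ k
      + 2 * cutLog (z / 2) * besselJ n z
      - (z / 2) ^ n * ∑' k : ℕ, (digammaSucc k + digammaSucc (n + k)) *
          ((-z ^ 2 / 4) ^ k / ((k.factorial : ℂ) * ((n + k).factorial : ℂ))))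

/-- The Hankel function `H_ℓ^{(1)} = J_ℓ + i Y_ℓ` of integer order `ℓ`; recall that
`H_{-n}^{(1)} = (-1)^n H_n^{(1)}`. -/
def hankel1 (l : ℤ) (z : ℂ) : ℂ :=
  (if 0 ≤ l then 1 else (-1) ^ l.natAbs) *
    (besselJ l.natAbs z + Complex.I * besselY l.natAbs z)

/-- The branch `W_{-1}` of the Lambert function: for `x ≠ 0`, it is the solution `w` of
`w e^w = x` with `w + log w = log x - 2πi` (principal logarithms), except for `x ∈ [-1/e, 0)`,
where it is the real solution `w ≤ -1`. -/
def IsLambertWm1 (x w : ℂ) : Prop :=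
  w * Complex.exp w = x ∧
    (w + Complex.log w = Complex.log x - 2 * (Real.pi : ℂ) * Complex.I ∨ (w.im = 0 ∧ w.re ≤ -1))

/-- The value `W_{-1}(x)`, `x ≠ 0`. -/
def lambertWm1 (x : ℂ) : ℂ :=
  Classical.epsilon (IsLambertWm1 x)

/-- Smooth compactly supported test functions on the plane. -/
def IsTest (φ : ℂ → ℂ) : Prop :=
  ContDiff ℝ ∞ φ ∧ HasCompactSupport φ

/-- `u ∈ L²_loc(ℝ²)` solves `(-Δ + V - E) u = 0` in the sense of distributions. -/
def IsSolution (V : ℂ → ℝ) (E : ℂ) (u : ℂ → ℂ) : Prop :=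
  (∀ R : ℝ, MemLp u 2 (volume.restrict (Metric.closedBall (0 : ℂ) R))) ∧
    ∀ φ : ℂ → ℂ, IsTest φ →
      ∫ z, u z * (-(Laplacian.laplacian φ z) + ((V z : ℂ) - E) * φ z) = 0

/-- `∂_θ u = i ℓ u` in the sense of distributions, where `∂_θ φ (z)` is the derivative of `φ` at
`z` in the direction `i z`. -/
def IsMode (l : ℤ) (u : ℂ → ℂ) : Prop :=
  ∀ φ : ℂ → ℂ, IsTest φ →
    ∫ z, u z * fderiv ℝ φ z (Complex.I * z) = -(Complex.I * (l : ℂ)) * ∫ z, u z * φ z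

/-- `ψ ∈ L²(ℝ²)` is a nontrivial solution of `(-Δ + V - E) ψ = 0`. -/
def IsEigenfunction (V : ℂ → ℝ) (E : ℂ) (ψ : ℂ → ℂ) : Prop :=
  MemLp ψ 2 volume ∧ ¬ (ψ =ᵐ[volume] 0) ∧ IsSolution V E ψ

/-- The radial part of the outgoing wave of angular momentum `ℓ` at frequency `lam`. -/
def outgoingWave (lam : ℂ) (l : ℤ) (r : ℝ) : ℂ :=
  if lam = 0 then ((r : ℂ) ^ l.natAbs)⁻¹ else hankel1 l (lam * r)

/-- `u(r, θ) = ∑_ℓ c_ℓ H_ℓ^{(1)}(lam r) e^{iℓθ}` for `r > ρ`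
(for `lam = 0`: `u(r, θ) = ∑_ℓ c_ℓ r^{-|ℓ|} e^{iℓθ}`). -/
def IsOutgoing (ρ : ℝ) (lam : ℂ) (u : ℂ → ℂ) : Prop :=
  ∃ c : ℤ → ℂ, ∀ z : ℂ, ρ < ‖z‖ →
    HasSum (fun l : ℤ => c l * outgoingWave lam l ‖z‖ * (z / (‖z‖ : ℂ)) ^ l) (u z)

/-- `lam ∈ ℂ \ -i(0,∞)` is a resonance of `-Δ + V`, where `V` vanishes for `|x| > ρ`: there is a
nontrivial outgoing solution of `(-Δ + V - lam²) u = 0`. -/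
def IsResonance (ρ : ℝ) (V : ℂ → ℝ) (lam : ℂ) : Prop :=
  ¬ (lam.re = 0 ∧ lam.im < 0) ∧ (∀ z : ℂ, ρ < ‖z‖ → V z = 0) ∧
    ∃ u : ℂ → ℂ, ¬ (u =ᵐ[volume] 0) ∧ IsSolution V (lam ^ 2) u ∧ IsOutgoing ρ lam u

/-- The circular well `-A 1_{|x| ≤ ρ}`, of depth `A = a²`. -/
def well (ρ A : ℝ) (z : ℂ) : ℝ :=
  if ‖z‖ ≤ ρ then -A else 0

/-- `W_{-1}(ε ρ² e^{-1+2γ} / 4)`. -/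
def wTerm (ρ ε : ℝ) : ℂ :=
  lambertWm1 ((ε * ρ ^ 2 * Real.exp (-1 + 2 * Real.eulerMascheroniConstant) / 4 : ℝ) : ℂ)

end CircularWell

end

/-! Separation of variables in `s = |z|²`. For `u = (x ± i y) q(s)` one has `Δu = (x ± i y)(8 q' + 4
s q'')`, so `Y = s q` solves `4 s Y'' = (V - E) Y`. With `E = λ² = -4τ²`, i.e. `λ = 2iτ`, this is
`Y'' = (b / s) Y` with `b = τ² - A/4` in the disk, `A = a₀² - ε`, and `Y'' = (τ² / s) Y` outside.
The regular inner solution is `s bes1(b s)`, with derivative `bes0(b s)`; the outgoing outer one is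
`outSol`, a multiple of `√s H₁(λ√s)`. Continuity of `Y` and `Y'` at `s = ρ²` is the matching
condition (`isResonance_of_matching`).

Put `β = -a₀²ρ²/4`, `e = ρ²ε/4`, `X = τ²ρ²`, `Λ = log X`. For small `X` the outer solution is `1 +
O(X Λ)`, and `X` times its derivative in `X` is `X (Λ + 2γ)` up to `O(X² Λ)`. Letting `E → 0` in the
matching condition of the given eigenfunctions yields `bes0 β = 0`, that is `J₀(a₀ρ) = 0`
(`bes0_eq_zero_of_matching`); moreover `bes1 β ≠ 0`. Expanding around `β` turns the matching
condition into `e - X w = O((|e| + |X w|)²)` with `w = Λ + 2γ - 1`. Since `X = exp(1 - 2γ) exp w`,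
the leading part is the Lambert equation `exp(1 - 2γ) w exp w = e`, solved by `W = wTerm ρ ε`.

Resonances: in the coordinate `w = W + d` the mismatch is entire in `d` and, after normalisation,
`O(e)`-close to `(1 + d/W) exp d - 1`. A quantitative open mapping theorem gives a zero with `d =
O(ε)` (`exists_mismatch_zero`). Then `λ = (2i/ρ) exp((1 - 2γ + W + d)/2)`, and `exp(W/2) =
o(|ε|^{1/2})` because `W exp W` is a multiple of `ε` and `|W| → ∞`; hence the error `o(|ε|^{3/2})`.
The bounds on `Im W` keep `λ` off the cut.

Eigenvalues: here every eigenfunction has to be controlled. Testing the weak equation against `(x ∓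
i y) M(s)` gives a Volterra equation for the angular component, which thus has a classical
representative, regular at the origin. The Wronskian with `s bes1(b s)` vanishes in the disk;
outside, square integrability forces proportionality to `decSol`, an integral representation of `2√x
K₁(2√x)`. A mode whose angular component vanishes is zero, so matching holds for the given `E`. The
constant `γ` enters through `Γ'(1) = -γ` (`decSol_asymptotics`). The same expansion with real
quantities, and the expansion property of `t ↦ t exp t` on `(-∞, -2]`, then determine `E` up to
`o(ε²)`. -/

noncomputable section

namespace CircularWell

/-! ### Entire power series -/

/-- Coefficients of an entire series of exponential type. -/
def EntireCoeff (a : ℕ → ℂ) : Prop :=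
  ∃ C : ℝ, ∀ k, ‖a k‖ ≤ C / (k.factorial : ℝ)

/-- The coefficients of the derivative of a power series. -/
def derivCoeff (a : ℕ → ℂ) (k : ℕ) : ℂ := (k + 1) * a (k + 1)

/-- The sum of a power series. -/
def powSum (a : ℕ → ℂ) (x : ℂ) : ℂ := ∑' k, a k * x ^ k

lemma EntireCoeff.summable {a : ℕ → ℂ} (ha : EntireCoeff a) (x : ℂ) :
    Summable fun k => a k * x ^ k := by
  obtain ⟨C, hC⟩ := ha
  refine Summable.of_norm_bounded ((Real.summable_pow_div_factorial ‖x‖).mul_left C) fun k => ?_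
  rw [norm_mul, norm_pow]
  calc ‖a k‖ * ‖x‖ ^ k ≤ C / (k.factorial : ℝ) * ‖x‖ ^ k := by gcongr; exact hC k
    _ = _ := by ring

lemma EntireCoeff.derivCoeff {a : ℕ → ℂ} (ha : EntireCoeff a) : EntireCoeff (derivCoeff a) := by
  obtain ⟨C, hC⟩ := ha
  refine ⟨C, fun k => ?_⟩
  have h1 : ‖((k : ℂ) + 1)‖ = (k : ℝ) + 1 := by
    rw [← Nat.cast_add_one, Complex.norm_natCast]; push_cast; ring
  rw [CircularWell.derivCoeff, norm_mul, h1]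
  have h := hC (k + 1)
  rw [Nat.factorial_succ, Nat.cast_mul, le_div_iff₀ (by positivity)] at h
  rw [le_div_iff₀ (by positivity)]
  push_cast at h
  linarith

/-- Termwise differentiation: on the ball of radius `‖x‖ + 1` the differentiated terms are dominated
by a shifted exponential series. -/
lemma EntireCoeff.hasDerivAt {a : ℕ → ℂ} (ha : EntireCoeff a) (x : ℂ) :
    HasDerivAt (powSum a) (powSum (CircularWell.derivCoeff a) x) x := by
  have hb := ha.derivCoeff
  obtain ⟨C, hC⟩ := hb
  set R := ‖x‖ + 1
  -- At `k = 0` truncated subtraction makes this majorant `C`, while the differentiated term is `0`;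
  -- only `C ≥ 0` is needed there.
  let u : ℕ → ℝ := fun k => C * (R ^ (k - 1) / ((k - 1).factorial : ℝ))
  have hu : Summable u := by
    rw [← summable_nat_add_iff 1]
    simpa [u] using (Real.summable_pow_div_factorial R).mul_left C
  have hC0 : 0 ≤ C := by
    have := (norm_nonneg _).trans (hC 0)
    simpa using this
  have key := hasDerivAt_tsum_of_isPreconnected (𝕜 := ℂ) (g := fun k y => a k * y ^ k)
    (g' := fun k y => a k * (k * y ^ (k - 1))) (t := Metric.ball 0 R) (y₀ := 0) (y := x) hu
    Metric.isOpen_ball (convex_ball (0 : ℂ) R).isPreconnected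
    (fun k y _ => by simpa using (hasDerivAt_pow k y).const_mul (a k))
    (fun k y hy => ?_) (by simp [R]; positivity) (ha.summable 0) (by simp [R])
  · refine HasDerivAt.congr_deriv (f := powSum a) key ?_
    have hs : Summable fun k => a k * (k * x ^ (k - 1)) := by
      rw [← summable_nat_add_iff 1]
      refine (ha.derivCoeff.summable x).congr fun k => ?_
      simp [CircularWell.derivCoeff]; ring
    rw [hs.tsum_eq_zero_add]
    simp only [powSum, CircularWell.derivCoeff, Nat.cast_zero, zero_mul, mul_zero, zero_add,
      Nat.add_sub_cancel]
    push_cast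
    exact tsum_congr fun k => by ring
  · rcases k with _ | k
    · simpa [u] using hC0
    · have h1 := hC k
      have hy' : ‖y‖ ≤ R := by simpa using (Metric.mem_ball.1 hy).le
      simp only [u, Nat.add_sub_cancel]
      calc ‖a (k + 1) * ((k + 1 : ℕ) * y ^ k)‖ = ‖CircularWell.derivCoeff a k‖ * ‖y‖ ^ k := by
            rw [CircularWell.derivCoeff, ← norm_pow, ← norm_mul]; push_cast; congr 1; ring
        _ ≤ C / (k.factorial : ℝ) * R ^ k := by gcongr
        _ = _ := by ring

lemma powSum_zero (a : ℕ → ℂ) : powSum a 0 = a 0 := by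
  rw [powSum, tsum_eq_single 0]
  · simp
  · intro k hk; simp [hk]

lemma EntireCoeff.continuous {a : ℕ → ℂ} (ha : EntireCoeff a) : Continuous (powSum a) :=
  continuous_iff_continuousAt.2 fun x => (ha.hasDerivAt x).continuousAt

lemma EntireCoeff.mul_powSum_derivCoeff {a : ℕ → ℂ} (ha : EntireCoeff a) (x : ℂ) :
    HasSum (fun k => k * a k * x ^ k) (x * powSum (CircularWell.derivCoeff a) x) := by
  have h := ((ha.derivCoeff.summable x).hasSum).mul_left x
  rw [← hasSum_nat_add_iff' 1]
  simp only [Finset.range_one, Finset.sum_singleton, Nat.cast_zero, zero_mul, sub_zero]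
  refine h.congr_fun ?_
  intro k
  simp [CircularWell.derivCoeff]; ring

/-- The coefficients of `I₀(2√x)`. -/
def zeroCoeff (k : ℕ) : ℂ := 1 / ((k.factorial : ℂ) * (k.factorial : ℂ))

/-- `I₀(2√x)`, that is `J₀(z)` for `x = -z²/4`. -/
def bes0 : ℂ → ℂ := powSum zeroCoeff

/-- `I₁(2√x)/√x`, that is `(2/z) J₁(z)` for `x = -z²/4`. -/
def bes1 : ℂ → ℂ := powSum (derivCoeff zeroCoeff)

/-- The coefficients of the regular part of the second solution of `x y'' = y`. -/
def regCoeff : ℕ → ℂ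
  | 0 => 0
  | k + 1 => (digammaSucc k + digammaSucc (1 + k)) /
      ((k.factorial : ℂ) * ((1 + k).factorial : ℂ))

/-- The regular part of the second solution of `x y'' = y`. -/
def regPart : ℂ → ℂ := powSum regCoeff

/-- The derivative of the regular part of the second solution of `x y'' = y`. -/
def regPart' : ℂ → ℂ := powSum (derivCoeff regCoeff)

/-- The second derivative of the regular part of the second solution of `x y'' = y`. -/
def regPart'' : ℂ → ℂ := powSum (derivCoeff (derivCoeff regCoeff))

/-- The derivative of `bes1`. -/
def bes1' : ℂ → ℂ := powSum (derivCoeff (derivCoeff zeroCoeff))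

/-! ### Values at the origin and differential equations of the Bessel-type series. -/

lemma entireCoeff_zeroCoeff : EntireCoeff zeroCoeff := by
  refine ⟨1, fun k => ?_⟩
  have h1 : (1 : ℝ) ≤ k.factorial := by exact_mod_cast k.factorial_pos
  rw [zeroCoeff, norm_div, norm_mul, Complex.norm_natCast, norm_one]
  gcongr
  nlinarith

lemma norm_digammaSucc_le (k : ℕ) : ‖digammaSucc k‖ ≤ 1 + k := by
  have h1 : (harmonic k : ℚ) ≤ k := by
    induction k with
    | zero => simp
    | succ k ih =>
      rw [harmonic_succ]; push_cast
      have : ((k : ℚ) + 1)⁻¹ ≤ 1 := inv_le_one_of_one_le₀ (by linarith [k.cast_nonneg (α := ℚ)])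
      linarith
  have h0 : (0 : ℚ) ≤ harmonic k := by unfold harmonic; positivity
  have h2 : ‖((harmonic k : ℚ) : ℂ)‖ ≤ k := by
    rw [Complex.norm_ratCast, abs_of_nonneg (by exact_mod_cast h0)]
    exact_mod_cast h1
  have h3 : ‖(Real.eulerMascheroniConstant : ℂ)‖ ≤ 1 := by
    rw [Complex.norm_real, Real.norm_eq_abs, abs_of_pos (by
      linarith [Real.one_half_lt_eulerMascheroniConstant])]
    linarith [Real.eulerMascheroniConstant_lt_two_thirds]
  rw [digammaSucc]
  refine (norm_add_le _ _).trans ?_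
  rw [norm_neg]
  exact add_le_add h3 h2

lemma entireCoeff_regCoeff : EntireCoeff regCoeff := by
  refine ⟨5, fun k => ?_⟩
  rcases k with _ | k
  · simp [regCoeff]
  · have h1 : (1 : ℝ) ≤ k.factorial := by exact_mod_cast k.factorial_pos
    have h2 : (k : ℝ) ≤ k.factorial := by exact_mod_cast k.self_le_factorial
    have h3 := norm_digammaSucc_le k
    have h4 := norm_digammaSucc_le (1 + k)
    push_cast at h4
    have h5 : ‖digammaSucc k + digammaSucc (1 + k)‖ ≤ 5 * k.factorial :=
      (norm_add_le _ _).trans (by linarith)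
    rw [regCoeff, norm_div, norm_mul, Complex.norm_natCast, Complex.norm_natCast, add_comm 1 k]
    rw [add_comm 1 k] at h5
    rw [div_le_div_iff₀ (by positivity) (by positivity)]
    nlinarith [show (0 : ℝ) < (k + 1).factorial by positivity]

lemma hasDerivAt_bes0 (x : ℂ) : HasDerivAt bes0 (bes1 x) x := entireCoeff_zeroCoeff.hasDerivAt x

lemma hasDerivAt_bes1 (x : ℂ) : HasDerivAt bes1 (bes1' x) x :=
  entireCoeff_zeroCoeff.derivCoeff.hasDerivAt x

lemma hasDerivAt_regPart (x : ℂ) : HasDerivAt regPart (regPart' x) x :=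
  entireCoeff_regCoeff.hasDerivAt x

lemma hasDerivAt_regPart' (x : ℂ) : HasDerivAt regPart' (regPart'' x) x :=
  entireCoeff_regCoeff.derivCoeff.hasDerivAt x

lemma bes0_zero : bes0 0 = 1 := by rw [bes0, powSum_zero]; simp [zeroCoeff]

lemma bes1_zero : bes1 0 = 1 := by rw [bes1, powSum_zero]; simp [zeroCoeff, derivCoeff]

lemma regPart_zero : regPart 0 = 0 := by rw [regPart, powSum_zero]; simp [regCoeff]

lemma regPart'_zero : regPart' 0 = 1 - 2 * Real.eulerMascheroniConstant := by
  rw [regPart', powSum_zero]; simp [regCoeff, derivCoeff, digammaSucc]; ring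

lemma derivCoeff_zeroCoeff (k : ℕ) :
    derivCoeff zeroCoeff k = 1 / ((k.factorial : ℂ) * ((1 + k).factorial : ℂ)) := by
  have h1 : (k.factorial : ℂ) ≠ 0 := by exact_mod_cast k.factorial_ne_zero
  have h2 : (k : ℂ) + 1 ≠ 0 := by exact_mod_cast k.succ_ne_zero
  rw [derivCoeff, zeroCoeff, add_comm 1 k, Nat.factorial_succ]
  push_cast
  field_simp

/-- By comparison of coefficients. Equivalently `(x bes1)' = bes0`; since `bes0' = bes1`, the
function `x bes1` is the regular solution of `x y'' = y`. -/
lemma mul_bes1' (x : ℂ) : x * bes1' x = bes0 x - bes1 x := by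
  have h1 := entireCoeff_zeroCoeff.derivCoeff.mul_powSum_derivCoeff x
  have h2 := ((entireCoeff_zeroCoeff.summable x).hasSum).sub
    (entireCoeff_zeroCoeff.derivCoeff.summable x).hasSum
  refine h1.unique (h2.congr_fun fun k => ?_)
  have h3 : (k.factorial : ℂ) ≠ 0 := by exact_mod_cast k.factorial_ne_zero
  have h4 : (k : ℂ) + 1 ≠ 0 := by exact_mod_cast k.succ_ne_zero
  rw [derivCoeff_zeroCoeff, zeroCoeff, add_comm 1 k, Nat.factorial_succ]
  push_cast
  field_simp
  ring

lemma digammaSucc_succ (k : ℕ) : digammaSucc (k + 1) = digammaSucc k + 1 / (k + 1) := by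
  rw [digammaSucc, digammaSucc, harmonic_succ]; push_cast; ring

/-- This is exactly the equation that makes `1 + x bes1 x log x - regPart x` a solution of `x y'' =
y`. The coefficients match through the recurrence of the digamma function; the constant term
accounts for the `-1`. -/
lemma mul_regPart'' (x : ℂ) :
    x * regPart'' x = regPart x + 2 * bes0 x - bes1 x - 1 := by
  have h1 := entireCoeff_regCoeff.derivCoeff.mul_powSum_derivCoeff x
  have hz := (entireCoeff_zeroCoeff.summable x).hasSum
  have h2 := (((entireCoeff_regCoeff.summable x).hasSum).add (hz.mul_left 2)).sub
    (entireCoeff_zeroCoeff.derivCoeff.summable x).hasSum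
  rw [← hasSum_nat_add_iff' 1] at h1 h2
  simp only [Finset.range_one, Finset.sum_singleton, Nat.cast_zero, zero_mul, sub_zero,
    pow_zero, mul_one] at h1 h2
  have h3 : (regCoeff 0 + 2 * zeroCoeff 0 - derivCoeff zeroCoeff 0) = 1 := by
    simp [regCoeff, zeroCoeff, derivCoeff]; norm_num
  rw [h3] at h2
  refine h1.unique (h2.congr_fun fun k => ?_)
  have h4 : (k.factorial : ℂ) ≠ 0 := by exact_mod_cast k.factorial_ne_zero
  have h5 : (k : ℂ) + 1 ≠ 0 := by exact_mod_cast k.succ_ne_zero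
  have h6 : (k : ℂ) + 1 + 1 ≠ 0 := by exact_mod_cast (k + 1).succ_ne_zero
  rw [derivCoeff_zeroCoeff, zeroCoeff, derivCoeff, regCoeff, regCoeff, add_comm 1 k,
    add_comm 1 (k + 1), Nat.factorial_succ (k + 1), Nat.factorial_succ k,
    digammaSucc_succ (k + 1), digammaSucc_succ k]
  push_cast
  field_simp
  ring

/-! ### The outgoing solution -/

/-- The outgoing solution of `y'' = (τ² / s) y`, a multiple of `√s H₁(2 i τ √s)`. -/
def outSol (τ : ℂ) (s : ℝ) : ℂ :=
  1 + τ ^ 2 * s * bes1 (τ ^ 2 * s) * (2 * Complex.log τ + Real.log s) - regPart (τ ^ 2 * s)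

/-- The derivative of the outgoing solution. -/
def outSol' (τ : ℂ) (s : ℝ) : ℂ :=
  τ ^ 2 * (bes0 (τ ^ 2 * s) * (2 * Complex.log τ + Real.log s) + bes1 (τ ^ 2 * s)
    - regPart' (τ ^ 2 * s))

lemma hasDerivAt_comp_mul_ofReal {F : ℂ → ℂ} {F' a : ℂ} {s : ℝ}
    (h : HasDerivAt F F' (a * s)) : HasDerivAt (fun t : ℝ => F (a * t)) (a * F') s := by
  have h1 : HasDerivAt (fun t : ℝ => a * (t : ℂ)) a s := by
    simpa using (Complex.ofRealCLM.hasDerivAt (x := s)).const_mul a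
  exact (h.comp s h1).congr_deriv (mul_comm _ _)

lemma hasDerivAt_ofReal (s : ℝ) : HasDerivAt (fun t : ℝ => (t : ℂ)) 1 s := by
  exact Complex.ofRealCLM.hasDerivAt (x := s)

lemma hasDerivAt_ofReal_log {s : ℝ} (hs : 0 < s) :
    HasDerivAt (fun t : ℝ => (Real.log t : ℂ)) (1 / s) s := by
  simpa using (Real.hasDerivAt_log hs.ne').ofReal_comp

lemma hasDerivAt_outSol (τ : ℂ) {s : ℝ} (hs : 0 < s) :
    HasDerivAt (outSol τ) (outSol' τ s) s := by
  have hs' : (s : ℂ) ≠ 0 := by exact_mod_cast hs.ne'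
  have h1 := hasDerivAt_comp_mul_ofReal (hasDerivAt_bes1 (τ ^ 2 * s))
  have h2 := hasDerivAt_comp_mul_ofReal (hasDerivAt_regPart (τ ^ 2 * s))
  have h3 := ((((hasDerivAt_ofReal s).const_mul (τ ^ 2)).mul h1).mul
    ((hasDerivAt_ofReal_log hs).const_add (2 * Complex.log τ))).const_add 1 |>.sub h2
  refine (h3.congr_deriv ?_).congr_of_eventuallyEq (.of_forall fun t => rfl)
  have h4 := mul_bes1' (τ ^ 2 * s)
  simp only [outSol', Pi.mul_apply]
  field_simp
  linear_combination (2 * Complex.log τ + Real.log s) * τ ^ 2 * h4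

lemma hasDerivAt_outSol' (τ : ℂ) {s : ℝ} (hs : 0 < s) :
    HasDerivAt (outSol' τ) (τ ^ 2 / s * outSol τ s) s := by
  have hs' : (s : ℂ) ≠ 0 := by exact_mod_cast hs.ne'
  have h0 := hasDerivAt_comp_mul_ofReal (hasDerivAt_bes0 (τ ^ 2 * s))
  have h1 := hasDerivAt_comp_mul_ofReal (hasDerivAt_bes1 (τ ^ 2 * s))
  have h2 := hasDerivAt_comp_mul_ofReal (hasDerivAt_regPart' (τ ^ 2 * s))
  have h3 := (((h0.mul ((hasDerivAt_ofReal_log hs).const_add (2 * Complex.log τ))).add h1).sub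
    h2).const_mul (τ ^ 2)
  refine (h3.congr_deriv ?_).congr_of_eventuallyEq (.of_forall fun t => rfl)
  have h4 := mul_bes1' (τ ^ 2 * s)
  have h5 := mul_regPart'' (τ ^ 2 * s)
  simp only [outSol]
  field_simp
  linear_combination τ ^ 2 * (h4 - h5)

lemma besselJ_one (z : ℂ) : besselJ 1 z = z / 2 * bes1 (-z ^ 2 / 4) := by
  rw [besselJ, bes1, powSum, pow_one]
  congr 1
  exact tsum_congr fun k => by rw [derivCoeff_zeroCoeff]; ring

lemma besselY_one {z : ℂ} (hz : z ≠ 0) :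
    besselY 1 z = 1 / Real.pi * (-(2 / z) + 2 * cutLog (z / 2) * besselJ 1 z
      + 2 / z * regPart (-z ^ 2 / 4)) := by
  have h1 : regPart (-z ^ 2 / 4) = (-z ^ 2 / 4) * ∑' k : ℕ, (digammaSucc k + digammaSucc (1 + k)) *
          ((-z ^ 2 / 4) ^ k / ((k.factorial : ℂ) * ((1 + k).factorial : ℂ))) := by
    rw [regPart, powSum, (entireCoeff_regCoeff.summable _).tsum_eq_zero_add, ← tsum_mul_left]
    simp only [regCoeff, zero_mul, zero_add]
    exact tsum_congr fun k => by ring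
  rw [besselY, h1]
  simp
  field_simp
  ring

/-- With `z = 2iτr` one has `-z²/4 = τ²r²`, and rotating the cut gives `cutLog (z/2) = log τ + log r
+ iπ/2`. The term `iπ/2` contributes `-J₁` to `i Y₁` and cancels the `J₁` in `J₁ + i Y₁`, so that
only the logarithmic solution remains. -/
lemma hankel1_one {τ : ℂ} (hτ : τ ≠ 0) {r : ℝ} (hr : 0 < r) :
    hankel1 1 (2 * Complex.I * τ * r) = -outSol τ (r ^ 2) / (Real.pi * τ * r) := by
  have hr' : (r : ℂ) ≠ 0 := by exact_mod_cast hr.ne'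
  have hpi : (Real.pi : ℂ) ≠ 0 := by exact_mod_cast Real.pi_ne_zero
  have hz : 2 * Complex.I * τ * r ≠ 0 := by simp [hτ, hr']
  have hI := Complex.I_sq
  have h1 : -(2 * Complex.I * τ * r) ^ 2 / 4 = τ ^ 2 * (r ^ 2 : ℝ) := by
    push_cast
    linear_combination (-τ ^ 2 * r ^ 2) * hI
  have h2 : cutLog (2 * Complex.I * τ * r / 2)
      = Complex.log τ + Real.log r + Complex.I * (Real.pi / 2 : ℝ) := by
    rw [cutLog, show -Complex.I * (2 * Complex.I * τ * r / 2) = (r : ℂ) * τ by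
      linear_combination (-τ * r) * hI, Complex.log_ofReal_mul hr hτ]
    ring
  have h3 : Real.log (r ^ 2) = 2 * Real.log r := by rw [Real.log_pow]; push_cast; ring
  rw [hankel1, if_pos (by norm_num), show (1 : ℤ).natAbs = 1 from rfl, besselY_one hz, besselJ_one,
    h1, h2, outSol, h3]
  push_cast
  generalize bes1 (τ ^ 2 * r ^ 2) = B
  generalize regPart (τ ^ 2 * r ^ 2) = Q
  field_simp
  linear_combination (τ^2*r^2*B*(2 * (Complex.log τ + Real.log r) + Complex.I * Real.pi)) * hI

lemma hankel1_neg_one (z : ℂ) : hankel1 (-1) z = -hankel1 1 z := by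
  simp [hankel1]

/-! ### Integration by parts along lines -/

/-- Locally bounded measurable functions. -/
def LocBdd {X : Type*} [MeasurableSpace X] [Norm X] (F : X → ℂ) : Prop :=
  Measurable F ∧ ∀ R : ℝ, ∃ C : ℝ, ∀ x : X, ‖x‖ ≤ R → ‖F x‖ ≤ C

lemma Continuous.locBdd {X : Type*} [NormedAddCommGroup X] [ProperSpace X] [MeasurableSpace X]
    [BorelSpace X] {F : X → ℂ} (hF : Continuous F) : LocBdd F := by
  refine ⟨hF.measurable, fun R => ?_⟩
  obtain ⟨C, hC⟩ := (isCompact_closedBall (0 : X) R).exists_bound_of_continuousOn hF.continuousOn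
  exact ⟨C, fun x hx => hC x (by simpa using hx)⟩

lemma LocBdd.mul {X : Type*} [MeasurableSpace X] [Norm X] {F G : X → ℂ} (hF : LocBdd F)
    (hG : LocBdd G) : LocBdd (fun x => F x * G x) := by
  refine ⟨hF.1.mul hG.1, fun R => ?_⟩
  obtain ⟨C, hC⟩ := hF.2 R
  obtain ⟨D, hD⟩ := hG.2 R
  refine ⟨C * D, fun x hx => ?_⟩
  rw [norm_mul]
  have := hC x hx
  exact mul_le_mul this (hD x hx) (norm_nonneg _) ((norm_nonneg _).trans this)

lemma LocBdd.add {X : Type*} [MeasurableSpace X] [Norm X] {F G : X → ℂ} (hF : LocBdd F)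
    (hG : LocBdd G) : LocBdd (fun x => F x + G x) := by
  refine ⟨hF.1.add hG.1, fun R => ?_⟩
  obtain ⟨C, hC⟩ := hF.2 R
  obtain ⟨D, hD⟩ := hG.2 R
  exact ⟨C + D, fun x hx => (norm_add_le _ _).trans (add_le_add (hC x hx) (hD x hx))⟩

lemma LocBdd.intervalIntegrable {F : ℝ → ℂ} (hF : LocBdd F) (a b : ℝ) :
    IntervalIntegrable F volume a b := by
  obtain ⟨C, hC⟩ := hF.2 (max |a| |b|)
  rw [intervalIntegrable_iff]
  refine Measure.integrableOn_of_bounded (M := C) (by simp) hF.1.aestronglyMeasurable ?_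
  refine (ae_restrict_iff' measurableSet_uIoc).2 (.of_forall fun x hx => hC x ?_)
  have h := Set.uIoc_subset_uIcc hx
  rw [Real.norm_eq_abs]
  rcases Set.mem_uIcc.1 h with h | h
  · exact abs_le_max_abs_abs h.1 h.2
  · rw [max_comm]; exact abs_le_max_abs_abs h.1 h.2

lemma LocBdd.integrable_mul {F φ : ℂ → ℂ} (hF : LocBdd F) (hφ : Continuous φ)
    (hc : HasCompactSupport φ) : Integrable (fun z => F z * φ z) := by
  obtain ⟨R, hR⟩ := hc.isCompact.isBounded.subset_closedBall (0 : ℂ)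
  obtain ⟨C, hC⟩ := hF.2 R
  -- `F` is bounded only locally, so it is truncated to a ball containing the support of `φ`.
  have h1 : (fun z => F z * φ z) = fun z => (Metric.closedBall (0 : ℂ) R).indicator F z * φ z := by
    ext z
    by_cases hz : z ∈ Metric.closedBall (0 : ℂ) R
    · rw [Set.indicator_of_mem hz]
    · rw [image_eq_zero_of_notMem_tsupport fun h => hz (hR h)]; simp
  rw [h1]
  refine (hφ.integrable_of_hasCompactSupport hc).bdd_mul (c := max C 0)
    (hF.1.indicator measurableSet_closedBall).aestronglyMeasurable (.of_forall fun z => ?_)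
  by_cases hz : z ∈ Metric.closedBall (0 : ℂ) R
  · rw [Set.indicator_of_mem hz]; exact (hC z (by simpa using hz)).trans (le_max_left _ _)
  · rw [Set.indicator_of_notMem hz]; simp

/-- Apply the fundamental theorem of calculus to `F φ' - F' φ`, which is continuous and
differentiable off a countable set. The exceptional set accommodates the jump of the second
derivative of `F` at the edge of the well. -/
lemma integral_mul_deriv_deriv {F F1 F2 φ φ1 φ2 : ℝ → ℂ} {s : Set ℝ} (hs : s.Countable)
    (hF : ∀ x, HasDerivAt F (F1 x) x) (hF1c : Continuous F1)
    (hF1 : ∀ x, x ∉ s → HasDerivAt F1 (F2 x) x) (hF2 : LocBdd F2)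
    (hφ : ∀ x, HasDerivAt φ (φ1 x) x) (hφ1 : ∀ x, HasDerivAt φ1 (φ2 x) x)
    (hφ2 : Continuous φ2) (hc : HasCompactSupport φ) :
    ∫ x, F x * φ2 x = ∫ x, F2 x * φ x := by
  have hFc : Continuous F := continuous_iff_continuousAt.2 fun x => (hF x).continuousAt
  have hφc : Continuous φ := continuous_iff_continuousAt.2 fun x => (hφ x).continuousAt
  have hφ1c : Continuous φ1 := continuous_iff_continuousAt.2 fun x => (hφ1 x).continuousAt
  obtain ⟨R, hR⟩ := hc.isCompact.isBounded.subset_ball_lt 0 (0 : ℝ)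
  have hout : ∀ x, x ∉ Set.Ioo (-R) R → φ x = 0 ∧ φ1 x = 0 ∧ φ2 x = 0 := by
    intro x hx
    have hx' : x ∉ tsupport φ := fun h => hx (by
      have := hR.2 h; rw [Real.ball_eq_Ioo] at this; simpa using this)
    have e0 : φ =ᶠ[𝓝 x] 0 := notMem_tsupport_iff_eventuallyEq.1 hx'
    have e1 : φ1 =ᶠ[𝓝 x] 0 := by
      filter_upwards [e0.eventuallyEq_nhds] with y hy
      exact (hφ y).unique ((hasDerivAt_const y (0 : ℂ)).congr_of_eventuallyEq hy)
    have e2 : φ2 x = 0 := (hφ1 x).unique ((hasDerivAt_const x (0 : ℂ)).congr_of_eventuallyEq e1)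
    exact ⟨e0.self_of_nhds, e1.self_of_nhds, e2⟩
  have hset : ∀ G : ℝ → ℂ, (∀ x, x ∉ Set.Ioo (-R) R → G x = 0) →
      ∫ x, G x = ∫ x in (-R)..R, G x := by
    intro G hG
    rw [intervalIntegral.integral_of_le (by linarith [hR.1]), setIntegral_eq_integral_of_forall_compl_eq_zero]
    exact fun x hx => hG x fun h => hx ⟨h.1, h.2.le⟩
  rw [hset _ fun x hx => by rw [(hout x hx).2.2, mul_zero],
    hset _ fun x hx => by rw [(hout x hx).1, mul_zero], ← sub_eq_zero,
    ← intervalIntegral.integral_sub]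
  · have key := MeasureTheory.integral_eq_of_hasDerivAt_off_countable
      (fun x => F x * φ1 x - F1 x * φ x) (fun x => F x * φ2 x - F2 x * φ x) (a := -R) (b := R) hs
      (by fun_prop) (fun x hx => ?_) ?_
    · rw [key, (hout R (by simp)).1, (hout R (by simp)).2.1, (hout (-R) (by simp)).1,
        (hout (-R) (by simp)).2.1]
      simp
    · exact (((hF x).mul (hφ1 x)).sub ((hF1 x hx.2).mul (hφ x))).congr_deriv (by ring)
    · exact ((hFc.mul hφ2).intervalIntegrable _ _).sub
        ((hF2.mul (Continuous.locBdd hφc)).intervalIntegrable _ _)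
  · exact (hFc.mul hφ2).intervalIntegrable _ _
  · exact (hF2.mul (Continuous.locBdd hφc)).intervalIntegrable _ _

/-! ### Iterated integrals, test functions and their restrictions to lines. -/

lemma integral_complex_eq_integral_re {F : ℂ → ℂ} (hF : Integrable F) :
    ∫ z, F z = ∫ y : ℝ, ∫ x : ℝ, F ⟨x, y⟩ := by
  have h := Complex.volume_preserving_equiv_real_prod.symm
  rw [← h.integral_comp' (g := F), Measure.volume_eq_prod, integral_prod_symm]
  · rfl
  · exact (h.integrable_comp_emb Complex.measurableEquivRealProd.symm.measurableEmbedding).2 hF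

lemma integral_complex_eq_integral_im {F : ℂ → ℂ} (hF : Integrable F) :
    ∫ z, F z = ∫ x : ℝ, ∫ y : ℝ, F ⟨x, y⟩ := by
  have h := Complex.volume_preserving_equiv_real_prod.symm
  rw [← h.integral_comp' (g := F), Measure.volume_eq_prod, integral_prod]
  · rfl
  · exact (h.integrable_comp_emb Complex.measurableEquivRealProd.symm.measurableEmbedding).2 hF

lemma hasDerivAt_mk_re (x y : ℝ) : HasDerivAt (fun t : ℝ => (⟨t, y⟩ : ℂ)) 1 x := by
  simp only [Complex.mk_eq_add_mul_I]
  exact (hasDerivAt_ofReal x).add_const _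

lemma hasDerivAt_mk_im (x y : ℝ) : HasDerivAt (fun t : ℝ => (⟨x, t⟩ : ℂ)) Complex.I y := by
  simp only [Complex.mk_eq_add_mul_I]
  simpa using ((hasDerivAt_ofReal y).mul_const Complex.I).const_add (x : ℂ)

lemma IsTest.differentiable {φ : ℂ → ℂ} (hφ : IsTest φ) : Differentiable ℝ φ :=
  hφ.1.differentiable (by simp)

lemma IsTest.contDiff_fderiv_apply {φ : ℂ → ℂ} (hφ : IsTest φ) (v : ℂ) :
    ContDiff ℝ ∞ (fun z => fderiv ℝ φ z v) :=
  (hφ.1.fderiv_right (by simp)).clm_apply contDiff_const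

lemma IsTest.fderiv_apply {φ : ℂ → ℂ} (hφ : IsTest φ) (v : ℂ) :
    IsTest (fun z => fderiv ℝ φ z v) :=
  ⟨hφ.contDiff_fderiv_apply v, hφ.2.fderiv_apply (𝕜 := ℝ) v⟩

lemma IsTest.laplacian_eq {φ : ℂ → ℂ} (hφ : IsTest φ) (z : ℂ) :
    Laplacian.laplacian φ z = fderiv ℝ (fun w => fderiv ℝ φ w 1) z 1 +
      fderiv ℝ (fun w => fderiv ℝ φ w Complex.I) z Complex.I := by
  have h : DifferentiableAt ℝ (fderiv ℝ φ) z :=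
    (hφ.1.fderiv_right (m := ∞) (by simp)).differentiable (by simp) z
  rw [InnerProductSpace.laplacian_eq_iteratedFDeriv_complexPlane]
  simp only [iteratedFDeriv_two_apply]
  rw [fderiv_clm_apply h (by fun_prop), fderiv_clm_apply h (by fun_prop)]
  simp

lemma IsTest.hasCompactSupport_line {φ : ℂ → ℂ} (hφ : IsTest φ) {L : ℝ → ℂ}
    (hL : Topology.IsClosedEmbedding L) : HasCompactSupport (fun t => φ (L t)) :=
  hφ.2.comp_isClosedEmbedding hL

lemma isClosedEmbedding_mk_re (y : ℝ) : Topology.IsClosedEmbedding (fun t : ℝ => (⟨t, y⟩ : ℂ)) := by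
  have : Isometry (fun t : ℝ => (⟨t, y⟩ : ℂ)) := by
    refine Isometry.of_dist_eq fun a b => ?_
    simp [Complex.dist_of_im_eq, Real.dist_eq]
  exact this.isClosedEmbedding

lemma isClosedEmbedding_mk_im (x : ℝ) : Topology.IsClosedEmbedding (fun t : ℝ => (⟨x, t⟩ : ℂ)) := by
  have : Isometry (fun t : ℝ => (⟨x, t⟩ : ℂ)) := by
    refine Isometry.of_dist_eq fun a b => ?_
    simp [Complex.dist_of_re_eq, Real.dist_eq]
  exact this.isClosedEmbedding

/-- The function `(x + σ i y) q(x² + y²)` of `z = x + i y`; for `σ = ±1` it has angular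
momentum `±1`. -/
def modeFun (σ : ℂ) (q : ℝ → ℂ) (z : ℂ) : ℂ :=
  (z.re + σ * z.im * Complex.I) * q (z.re ^ 2 + z.im ^ 2)

/-- The derivative of `(c + e t) q(t² + k)`. -/
def lineDeriv1 (c e : ℂ) (k : ℝ) (q q1 : ℝ → ℂ) (t : ℝ) : ℂ :=
  e * q (t ^ 2 + k) + (c + e * t) * (2 * t) * q1 (t ^ 2 + k)

/-- The second derivative of `(c + e t) q(t² + k)`. -/
def lineDeriv2 (c e : ℂ) (k : ℝ) (q1 q2 : ℝ → ℂ) (t : ℝ) : ℂ :=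
  (4 * e * t + 2 * (c + e * t)) * q1 (t ^ 2 + k) + 4 * t ^ 2 * (c + e * t) * q2 (t ^ 2 + k)

lemma hasDerivAt_line (c e : ℂ) (k : ℝ) {q q1 : ℝ → ℂ} {t : ℝ}
    (hq : HasDerivAt q (q1 (t ^ 2 + k)) (t ^ 2 + k)) :
    HasDerivAt (fun t : ℝ => (c + e * t) * q (t ^ 2 + k)) (lineDeriv1 c e k q q1 t) t := by
  have h1 : HasDerivAt (fun t : ℝ => t ^ 2 + k) (2 * t) t := by
    simpa using (hasDerivAt_pow 2 t).add_const k
  have h2 := HasDerivAt.scomp t hq h1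
  have h3 := (((hasDerivAt_ofReal t).const_mul e).const_add c).mul h2
  refine (h3.congr_deriv ?_)
  simp [lineDeriv1]
  ring

lemma hasDerivAt_lineDeriv1 (c e : ℂ) (k : ℝ) {q q1 q2 : ℝ → ℂ} {t : ℝ}
    (hq : HasDerivAt q (q1 (t ^ 2 + k)) (t ^ 2 + k))
    (hq1 : HasDerivAt q1 (q2 (t ^ 2 + k)) (t ^ 2 + k)) :
    HasDerivAt (lineDeriv1 c e k q q1) (lineDeriv2 c e k q1 q2 t) t := by
  have h1 : HasDerivAt (fun t : ℝ => t ^ 2 + k) (2 * t) t := by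
    simpa using (hasDerivAt_pow 2 t).add_const k
  have h2 := HasDerivAt.scomp t hq h1
  have h3 := HasDerivAt.scomp t hq1 h1
  have h4 := (h2.const_mul e).add (((((hasDerivAt_ofReal t).const_mul e).const_add c).mul
    ((hasDerivAt_ofReal t).const_mul 2)).mul h3)
  refine (h4.congr_deriv ?_)
  simp [lineDeriv2]
  ring

lemma LocBdd.comp_sq_add {q : ℝ → ℂ} (hq : LocBdd q) (k : ℝ) : LocBdd (fun t => q (t ^ 2 + k)) := by
  refine ⟨hq.1.comp (by fun_prop), fun R => ?_⟩
  obtain ⟨C, hC⟩ := hq.2 (R ^ 2 + |k|)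
  refine ⟨C, fun t ht => hC _ ?_⟩
  rw [Real.norm_eq_abs] at *
  have : t ^ 2 ≤ R ^ 2 := by rw [← sq_abs]; gcongr
  exact (abs_add_le _ _).trans (by rw [abs_of_nonneg (sq_nonneg t)]; gcongr)

lemma LocBdd.lineDeriv2 {q1 q2 : ℝ → ℂ} (hq1 : LocBdd q1) (hq2 : LocBdd q2) (c e : ℂ) (k : ℝ) :
    LocBdd (lineDeriv2 c e k q1 q2) :=
  ((Continuous.locBdd (by fun_prop)).mul (hq1.comp_sq_add k)).add
    ((Continuous.locBdd (by fun_prop)).mul (hq2.comp_sq_add k))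

lemma LocBdd.comp_radial {q : ℝ → ℂ} (hq : LocBdd q) :
    LocBdd (fun z : ℂ => q (z.re ^ 2 + z.im ^ 2)) := by
  refine ⟨hq.1.comp (by fun_prop), fun R => ?_⟩
  obtain ⟨C, hC⟩ := hq.2 (R ^ 2)
  refine ⟨C, fun z hz => hC _ ?_⟩
  have h : z.re ^ 2 + z.im ^ 2 = ‖z‖ ^ 2 := by rw [Complex.sq_norm, Complex.normSq_apply]; ring
  rw [h, Real.norm_eq_abs, abs_of_nonneg (sq_nonneg _)]
  gcongr

/-- A horizontal or vertical line meets the circle `|z|² = S` in at most two points. -/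
lemma countable_line (k S : ℝ) : {t : ℝ | t ^ 2 + k = S}.Countable := by
  refine Set.Finite.countable (Set.Finite.subset (s := {√(S - k), -√(S - k)}) (by simp) ?_)
  intro t ht
  have ht' : t ^ 2 = S - k := by rw [← ht.out]; ring
  have h0 : √(S - k) ^ 2 = S - k := Real.sq_sqrt (by rw [← ht']; positivity)
  rcases sq_eq_sq_iff_eq_or_eq_neg.1 (ht'.trans h0.symm) with h | h
  · exact Or.inl h
  · exact Or.inr h

/-- Green's identity for a function `(x + σ i y) q(x² + y²)` with `q'` absolutely continuous. -/
lemma integral_modeFun_mul_laplacian (σ : ℂ) {S : ℝ} {q q1 q2 : ℝ → ℂ}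
    (hq : ∀ s, HasDerivAt q (q1 s) s) (hq1c : Continuous q1)
    (hq1 : ∀ s, s ≠ S → HasDerivAt q1 (q2 s) s) (hq2 : LocBdd q2) {φ : ℂ → ℂ} (hφ : IsTest φ) :
    ∫ z, modeFun σ q z * Laplacian.laplacian φ z =
      ∫ z, modeFun σ (fun s => 8 * q1 s + 4 * s * q2 s) z * φ z := by
  have hqc : Continuous q := continuous_iff_continuousAt.2 fun x => (hq x).continuousAt
  have hl1 := Continuous.locBdd hq1c
  have t1 := (hφ.fderiv_apply 1).fderiv_apply 1
  have tI := (hφ.fderiv_apply Complex.I).fderiv_apply Complex.I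
  have hu : LocBdd (modeFun σ q) :=
    (Continuous.locBdd (by fun_prop)).mul (Continuous.locBdd hqc).comp_radial
  have hr1 := hl1.comp_radial
  have hr2 := hq2.comp_radial
  have hux : LocBdd (fun z : ℂ => lineDeriv2 (σ * z.im * Complex.I) 1 (z.im ^ 2) q1 q2 z.re) :=
    ((Continuous.locBdd (by fun_prop)).mul hr1).add ((Continuous.locBdd (by fun_prop)).mul hr2)
  have huy : LocBdd (fun z : ℂ => lineDeriv2 z.re (σ * Complex.I) (z.re ^ 2) q1 q2 z.im) := by
    have := ((Continuous.locBdd (X := ℂ) (F := fun z => 4 * (σ * Complex.I) * z.im +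
      2 * (z.re + (σ * Complex.I) * z.im)) (by fun_prop)).mul hr1).add
      ((Continuous.locBdd (X := ℂ) (F := fun z => 4 * z.im ^ 2 * (z.re + (σ * Complex.I) * z.im))
        (by fun_prop)).mul hr2)
    refine cast (congrArg LocBdd ?_) this
    ext z
    simp only [lineDeriv2, add_comm (z.re ^ 2)]
  -- The two second derivatives are moved onto the mode function separately: `∂_x²` along horizontal
  -- lines, and below `∂_y²` along vertical ones, each by one-dimensional integration by parts and
  -- Fubini.
  have ex : ∫ z, modeFun σ q z * fderiv ℝ (fun w => fderiv ℝ φ w 1) z 1 =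
      ∫ z, lineDeriv2 (σ * z.im * Complex.I) 1 (z.im ^ 2) q1 q2 z.re * φ z := by
    rw [integral_complex_eq_integral_re (hu.integrable_mul t1.1.continuous t1.2),
      integral_complex_eq_integral_re (hux.integrable_mul hφ.1.continuous hφ.2)]
    congr 1
    ext y
    have := integral_mul_deriv_deriv (countable_line (y ^ 2) S)
      (fun x => hasDerivAt_line (σ * y * Complex.I) 1 (y ^ 2) (hq (x ^ 2 + y ^ 2)))
      (by unfold lineDeriv1; fun_prop)
      (fun x hx => hasDerivAt_lineDeriv1 (σ * y * Complex.I) 1 (y ^ 2) (hq (x ^ 2 + y ^ 2))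
        (hq1 (x ^ 2 + y ^ 2) hx))
      (hl1.lineDeriv2 hq2 _ _ _)
      (fun x => (hφ.differentiable _).hasFDerivAt.comp_hasDerivAt x (hasDerivAt_mk_re x y))
      (fun x => ((hφ.fderiv_apply 1).differentiable _).hasFDerivAt.comp_hasDerivAt x
        (hasDerivAt_mk_re x y))
      (t1.1.continuous.comp (isClosedEmbedding_mk_re y).continuous)
      (hφ.hasCompactSupport_line (isClosedEmbedding_mk_re y))
    refine Eq.trans ?_ this
    congr 1
    ext x
    simp only [modeFun, one_mul, add_comm (x : ℂ)]
  have ey : ∫ z, modeFun σ q z * fderiv ℝ (fun w => fderiv ℝ φ w Complex.I) z Complex.I =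
      ∫ z, lineDeriv2 z.re (σ * Complex.I) (z.re ^ 2) q1 q2 z.im * φ z := by
    rw [integral_complex_eq_integral_im (hu.integrable_mul tI.1.continuous tI.2),
      integral_complex_eq_integral_im (huy.integrable_mul hφ.1.continuous hφ.2)]
    congr 1
    ext x
    have := integral_mul_deriv_deriv (countable_line (x ^ 2) S)
      (fun y => hasDerivAt_line x (σ * Complex.I) (x ^ 2) (hq (y ^ 2 + x ^ 2)))
      (by unfold lineDeriv1; fun_prop)
      (fun y hy => hasDerivAt_lineDeriv1 x (σ * Complex.I) (x ^ 2) (hq (y ^ 2 + x ^ 2))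
        (hq1 (y ^ 2 + x ^ 2) hy))
      (hl1.lineDeriv2 hq2 _ _ _)
      (fun y => (hφ.differentiable _).hasFDerivAt.comp_hasDerivAt y (hasDerivAt_mk_im x y))
      (fun y => ((hφ.fderiv_apply Complex.I).differentiable _).hasFDerivAt.comp_hasDerivAt y
        (hasDerivAt_mk_im x y))
      (tI.1.continuous.comp (isClosedEmbedding_mk_im x).continuous)
      (hφ.hasCompactSupport_line (isClosedEmbedding_mk_im x))
    refine Eq.trans ?_ this
    congr 1
    ext y
    simp only [modeFun, add_comm (x ^ 2)]
    ring
  simp only [hφ.laplacian_eq, mul_add]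
  rw [integral_add (hu.integrable_mul t1.1.continuous t1.2)
    (hu.integrable_mul tI.1.continuous tI.2), ex, ey,
    ← integral_add (hux.integrable_mul hφ.1.continuous hφ.2)
      (huy.integrable_mul hφ.1.continuous hφ.2)]
  congr 1
  ext z
  simp only [lineDeriv2, modeFun, add_comm (z.im ^ 2)]
  push_cast
  ring

/-! ### From the matching condition to a resonance -/

/-- The function equal to `f` on `(-∞, S]` and to `g` on `(S, ∞)`. -/
def glue (S : ℝ) (f g : ℝ → ℂ) (s : ℝ) : ℂ := if s ≤ S then f s else g s

lemma glue_of_le {S s : ℝ} (f g : ℝ → ℂ) (h : s ≤ S) : glue S f g s = f s := if_pos h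

lemma glue_of_lt {S s : ℝ} (f g : ℝ → ℂ) (h : S < s) : glue S f g s = g s := if_neg h.not_ge

lemma glue_eventuallyEq_left {S s : ℝ} (f g : ℝ → ℂ) (h : s < S) : glue S f g =ᶠ[𝓝 s] f := by
  filter_upwards [Iio_mem_nhds h] with t ht using glue_of_le f g (le_of_lt ht)

lemma glue_eventuallyEq_right {S s : ℝ} (f g : ℝ → ℂ) (h : S < s) : glue S f g =ᶠ[𝓝 s] g := by
  filter_upwards [Ioi_mem_nhds h] with t ht using glue_of_lt f g ht

lemma hasDerivAt_glue_of_ne {S s : ℝ} {f g f' g' : ℝ → ℂ} (hs : s ≠ S)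
    (hf : s < S → HasDerivAt f (f' s) s) (hg : S < s → HasDerivAt g (g' s) s) :
    HasDerivAt (glue S f g) (glue S f' g' s) s := by
  rcases lt_or_gt_of_ne hs with h | h
  · rw [glue_of_le _ _ h.le]; exact (hf h).congr_of_eventuallyEq (glue_eventuallyEq_left f g h)
  · rw [glue_of_lt _ _ h]; exact (hg h).congr_of_eventuallyEq (glue_eventuallyEq_right f g h)

lemma hasDerivAt_glue {S s : ℝ} {f g f' g' : ℝ → ℂ}
    (hf : s ≤ S → HasDerivAt f (f' s) s) (hg : S ≤ s → HasDerivAt g (g' s) s)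
    (h0 : f S = g S) (h1 : f' S = g' S) :
    HasDerivAt (glue S f g) (glue S f' g' s) s := by
  rcases eq_or_ne s S with rfl | hs
  · rw [glue_of_le _ _ le_rfl, ← hasDerivWithinAt_univ, ← Set.Iic_union_Ici (a := s)]
    refine ((hf le_rfl).hasDerivWithinAt.congr (fun t ht => glue_of_le f g ht)
      (glue_of_le f g le_rfl)).union ?_
    rw [h1]
    refine (hg le_rfl).hasDerivWithinAt.congr (fun t ht => ?_) (by rw [glue_of_le _ _ le_rfl, h0])
    rcases eq_or_lt_of_le (Set.mem_Ici.1 ht) with rfl | h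
    · rw [glue_of_le _ _ le_rfl, h0]
    · exact glue_of_lt f g h
  · exact hasDerivAt_glue_of_ne hs (fun h => hf h.le) (fun h => hg h.le)

lemma continuous_glue {S : ℝ} {f g : ℝ → ℂ} (hf : Continuous f) (hg : ContinuousOn g (Set.Ici S))
    (h0 : f S = g S) : Continuous (glue S f g) := by
  refine continuous_if_le continuous_id continuous_const hf.continuousOn ?_ ?_
  · exact hg
  · rintro x rfl; exact h0

lemma locBdd_glue {S : ℝ} {f g : ℝ → ℂ} (hf : Continuous f) (hg : ContinuousOn g (Set.Ici S)) :
    LocBdd (glue S f g) := by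
  -- `g` is controlled only on `[S, ∞)`. Extending it by the constant `g S` makes it continuous on
  -- the line, and the glued function becomes continuous plus an indicator times continuous.
  have h : ∀ s, glue S f g s = f s + (Set.Ioi S).indicator
      (fun t => glue S (fun _ => g S) g t - f t) s := by
    intro s
    rcases le_or_gt s S with h | h
    · rw [glue_of_le _ _ h, Set.indicator_of_notMem (by simpa using h), add_zero]
    · rw [glue_of_lt _ _ h, Set.indicator_of_mem (by simpa using h), glue_of_lt _ _ h]; ring
  have hc : Continuous fun t => glue S (fun _ => g S) g t - f t :=
    (continuous_glue continuous_const hg rfl).sub hf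
  have : LocBdd ((Set.Ioi S).indicator fun t => glue S (fun _ => g S) g t - f t) := by
    refine ⟨hc.measurable.indicator measurableSet_Ioi, fun R => ?_⟩
    obtain ⟨C, hC⟩ := (Continuous.locBdd hc).2 R
    exact ⟨C, fun x hx => (norm_indicator_le_norm_self _ _).trans (hC x hx)⟩
  exact (funext h) ▸ (Continuous.locBdd hf).add this

/-- The second derivative of `bes1`. -/
def bes1'' : ℂ → ℂ := powSum (derivCoeff (derivCoeff (derivCoeff zeroCoeff)))

lemma hasDerivAt_bes1' (x : ℂ) : HasDerivAt bes1' (bes1'' x) x :=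
  entireCoeff_zeroCoeff.derivCoeff.derivCoeff.hasDerivAt x

lemma continuous_bes0 : Continuous bes0 := entireCoeff_zeroCoeff.continuous
lemma continuous_bes1 : Continuous bes1 := entireCoeff_zeroCoeff.derivCoeff.continuous
lemma continuous_bes1' : Continuous bes1' :=
  entireCoeff_zeroCoeff.derivCoeff.derivCoeff.continuous
lemma continuous_bes1'' : Continuous bes1'' :=
  entireCoeff_zeroCoeff.derivCoeff.derivCoeff.derivCoeff.continuous

lemma mul_bes1'' (x : ℂ) : x * bes1'' x = bes1 x - 2 * bes1' x := by
  have h1 := (hasDerivAt_id x).mul (hasDerivAt_bes1' x)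
  have h2 := (hasDerivAt_bes0 x).sub (hasDerivAt_bes1 x)
  have h3 : (id * bes1' : ℂ → ℂ) = bes0 - bes1 := funext fun y => mul_bes1' y
  rw [h3] at h1
  have := h1.unique h2
  simp at this
  linear_combination this

/-- The inner part of the radial profile. -/
def innerProfile (α b : ℂ) (s : ℝ) : ℂ := α * bes1 (b * s)

/-- The derivative of the inner part of the radial profile. -/
def innerProfile' (α b : ℂ) (s : ℝ) : ℂ := α * (b * bes1' (b * s))

/-- The second derivative of the inner part of the radial profile. -/
def innerProfile'' (α b : ℂ) (s : ℝ) : ℂ := α * (b * (b * bes1'' (b * s)))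

/-- The outer part of the radial profile. -/
def outerProfile (β τ : ℂ) (s : ℝ) : ℂ := β * (outSol τ s / s)

/-- The derivative of the outer part of the radial profile. -/
def outerProfile' (β τ : ℂ) (s : ℝ) : ℂ := β * (outSol' τ s / s - outSol τ s / s ^ 2)

/-- The second derivative of the outer part of the radial profile. -/
def outerProfile'' (β τ : ℂ) (s : ℝ) : ℂ :=
  β * (τ ^ 2 * outSol τ s / s ^ 2 - 2 * outSol' τ s / s ^ 2 + 2 * outSol τ s / s ^ 3)

lemma hasDerivAt_innerProfile (α b : ℂ) (s : ℝ) :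
    HasDerivAt (innerProfile α b) (innerProfile' α b s) s :=
  (hasDerivAt_comp_mul_ofReal (hasDerivAt_bes1 (b * s))).const_mul α

lemma hasDerivAt_innerProfile' (α b : ℂ) (s : ℝ) :
    HasDerivAt (innerProfile' α b) (innerProfile'' α b s) s :=
  ((hasDerivAt_comp_mul_ofReal (hasDerivAt_bes1' (b * s))).const_mul b).const_mul α

lemma hasDerivAt_outerProfile (β τ : ℂ) {s : ℝ} (hs : 0 < s) :
    HasDerivAt (outerProfile β τ) (outerProfile' β τ s) s := by
  have hs' : (s : ℂ) ≠ 0 := by exact_mod_cast hs.ne'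
  refine (((hasDerivAt_outSol τ hs).div (hasDerivAt_ofReal s) hs').const_mul β).congr_deriv ?_
  rw [outerProfile']
  field_simp

lemma hasDerivAt_outerProfile' (β τ : ℂ) {s : ℝ} (hs : 0 < s) :
    HasDerivAt (outerProfile' β τ) (outerProfile'' β τ s) s := by
  have hs' : (s : ℂ) ≠ 0 := by exact_mod_cast hs.ne'
  refine ((((hasDerivAt_outSol' τ hs).div (hasDerivAt_ofReal s) hs').sub
    ((hasDerivAt_outSol τ hs).div ((hasDerivAt_ofReal s).pow 2)
      (pow_ne_zero 2 hs'))).const_mul β).congr_deriv ?_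
  simp only [outerProfile'', Pi.pow_apply]
  field_simp
  ring

lemma sq_norm_eq (z : ℂ) : ‖z‖ ^ 2 = z.re ^ 2 + z.im ^ 2 := by
  rw [Complex.sq_norm, Complex.normSq_apply]; ring

lemma norm_le_iff {ρ : ℝ} (hρ : 0 < ρ) (z : ℂ) : ‖z‖ ≤ ρ ↔ z.re ^ 2 + z.im ^ 2 ≤ ρ ^ 2 := by
  rw [← sq_norm_eq, sq_le_sq₀ (norm_nonneg _) hρ.le]

/-- The matching condition makes the glued radial profile `C¹` across the edge of the well, so
Green's identity gives a weak solution in the whole plane. Membership of `τ` in the slit plane keeps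
`2iτ` off the cut `-i(0, ∞)`, and `h0` prevents the constructed solution from vanishing. -/
theorem isResonance_of_matching {ρ A : ℝ} (hρ : 0 < ρ) {l : ℤ} (hl : l = 1 ∨ l = -1) {τ : ℂ}
    (hτ : τ ∈ Complex.slitPlane) (h0 : outSol τ (ρ ^ 2) ≠ 0)
    (hm : outSol τ (ρ ^ 2) * bes0 ((τ ^ 2 - A / 4) * (ρ ^ 2 : ℝ)) =
      (ρ ^ 2 : ℝ) * outSol' τ (ρ ^ 2) * bes1 ((τ ^ 2 - A / 4) * (ρ ^ 2 : ℝ))) :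
    IsResonance ρ (well ρ A) (2 * Complex.I * τ) := by
  have hτ0 : τ ≠ 0 := Complex.slitPlane_ne_zero hτ
  have hlam0 : 2 * Complex.I * τ ≠ 0 := by simp [hτ0]
  set S : ℝ := ρ ^ 2 with hS
  have hS0 : 0 < S := by positivity
  have hS' : (S : ℂ) ≠ 0 := by exact_mod_cast hS0.ne'
  set b : ℂ := τ ^ 2 - A / 4 with hb
  -- The amplitudes are chosen crosswise, so that continuity of the profile at `S` is automatic and
  -- continuity of its derivative is precisely `hm`.
  set α : ℂ := outSol τ S
  set β : ℂ := S * bes1 (b * S)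
  set q : ℝ → ℂ := glue S (innerProfile α b) (outerProfile β τ) with hq_def
  set q1 : ℝ → ℂ := glue S (innerProfile' α b) (outerProfile' β τ)
  set q2 : ℝ → ℂ := glue S (innerProfile'' α b) (outerProfile'' β τ)
  have e0 : innerProfile α b S = outerProfile β τ S := by
    simp only [innerProfile, outerProfile, α, β]
    field_simp
  have e1 : innerProfile' α b S = outerProfile' β τ S := by
    have h2 := mul_bes1' (b * S)
    simp only [innerProfile', outerProfile', α, β] at hm ⊢
    field_simp
    linear_combination outSol τ S * h2 + hm
  have hcont : ∀ {F F' : ℝ → ℂ}, (∀ s, 0 < s → HasDerivAt F (F' s) s) →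
      ContinuousOn F (Set.Ici S) := fun hF s hs =>
    (hF s (hS0.trans_le hs)).continuousAt.continuousWithinAt
  have hcoo := hcont fun s hs => hasDerivAt_outerProfile β τ hs
  have hcoo1 := hcont fun s hs => hasDerivAt_outerProfile' β τ hs
  have hcs := hcont fun s hs => hasDerivAt_outSol τ hs
  have hcs' := hcont fun s hs => hasDerivAt_outSol' τ hs
  have hcoo2 : ContinuousOn (outerProfile'' β τ) (Set.Ici S) := by
    unfold outerProfile''
    have hne : ∀ s ∈ Set.Ici S, (s : ℂ) ≠ 0 := fun s hs => by
      exact_mod_cast (hS0.trans_le hs).ne'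
    have hp : ∀ n : ℕ, ContinuousOn (fun s : ℝ => (s : ℂ) ^ n) (Set.Ici S) := fun n => by fun_prop
    exact continuousOn_const.mul ((((continuousOn_const.mul hcs).div (hp 2) fun s hs =>
      pow_ne_zero _ (hne s hs)).sub ((continuousOn_const.mul hcs').div (hp 2) fun s hs =>
      pow_ne_zero _ (hne s hs))).add ((continuousOn_const.mul hcs).div (hp 3) fun s hs =>
      pow_ne_zero _ (hne s hs)))
  have hci : Continuous (innerProfile α b) :=
    continuous_iff_continuousAt.2 fun s => (hasDerivAt_innerProfile α b s).continuousAt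
  have hci1 : Continuous (innerProfile' α b) :=
    continuous_iff_continuousAt.2 fun s => (hasDerivAt_innerProfile' α b s).continuousAt
  have hci2 : Continuous (innerProfile'' α b) := by
    unfold innerProfile''; have := continuous_bes1''; fun_prop
  have hq : ∀ s, HasDerivAt q (q1 s) s := fun s =>
    hasDerivAt_glue (fun _ => hasDerivAt_innerProfile α b s)
      (fun h => hasDerivAt_outerProfile β τ (hS0.trans_le h)) e0 e1
  have hqc : Continuous q := continuous_glue hci hcoo e0
  have hq1 : ∀ s, s ≠ S → HasDerivAt q1 (q2 s) s := fun s hs =>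
    hasDerivAt_glue_of_ne hs (fun _ => hasDerivAt_innerProfile' α b s)
      (fun h => hasDerivAt_outerProfile' β τ (hS0.trans h))
  -- The left side is the radial profile of the Laplacian. Inside, the identity is `mul_bes1''`;
  -- outside, it is the equation of `outSol` rewritten for `outSol / s`.
  have hode : ∀ s, 8 * q1 s + 4 * s * q2 s =
      (((if s ≤ S then -A else 0 : ℝ) : ℂ) + 4 * τ ^ 2) * q s := by
    intro s
    rcases le_or_gt s S with h | h
    · simp only [q, q1, q2, glue_of_le _ _ h, innerProfile, innerProfile', innerProfile'', if_pos h]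
      have h2 := mul_bes1'' (b * s)
      push_cast
      rw [show (-(A : ℂ) + 4 * τ ^ 2) = 4 * b by rw [hb]; ring]
      linear_combination 4 * α * b * h2
    · have hs' : (s : ℂ) ≠ 0 := by exact_mod_cast (hS0.trans h).ne'
      simp only [q, q1, q2, glue_of_lt _ _ h, outerProfile, outerProfile', outerProfile'',
        if_neg h.not_ge]
      push_cast
      field_simp
      ring
  obtain ⟨σ, hσ⟩ : ∃ σ : ℂ, (l = 1 ∧ σ = 1) ∨ (l = -1 ∧ σ = -1) := by
    rcases hl with h | h
    · exact ⟨1, Or.inl ⟨h, rfl⟩⟩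
    · exact ⟨-1, Or.inr ⟨h, rfl⟩⟩
  have hu : Continuous (modeFun σ q) := by unfold modeFun; fun_prop
  have hwell : ∀ z : ℂ, well ρ A z = if z.re ^ 2 + z.im ^ 2 ≤ S then -A else 0 := fun z => by
    simp only [well, norm_le_iff hρ, hS]
  refine ⟨?_, fun z hz => by rw [well, if_neg hz.not_ge], modeFun σ q, ?_, ⟨fun R => ?_, ?_⟩, ?_⟩
  · rintro ⟨h1, h2⟩
    rcases hτ with h | h
    · simp at h1 h2; linarith
    · simp at h1 h2; exact h h1
  · intro h
    have h2 := (Continuous.ae_eq_iff_eq volume hu continuous_const).1 h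
    -- The factor `x + σ i y` vanishes at the origin, so `q 0` is reached as a limit along the
    -- positive axis; its value is `α`.
    have h3 : ∀ t ∈ Set.Ioi (0 : ℝ), q (t ^ 2) = 0 := by
      intro t ht
      have h4 : modeFun σ q (t : ℂ) = 0 := congrFun h2 (t : ℂ)
      simp only [modeFun, Complex.ofReal_re, Complex.ofReal_im] at h4
      simpa [(Set.mem_Ioi.1 ht).ne'] using h4
    have h4 : Set.EqOn (fun t : ℝ => q (t ^ 2)) (fun _ => 0) (closure (Set.Ioi (0 : ℝ))) :=
      Set.EqOn.closure h3 (by fun_prop) continuous_const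
    have h5 := h4 (x := 0) (by simp)
    simp only [q, ne_eq, OfNat.ofNat_ne_zero, not_false_eq_true, zero_pow,
      glue_of_le _ _ hS0.le, innerProfile, Complex.ofReal_zero, mul_zero, bes1_zero, mul_one] at h5
    exact h0 h5
  · have : IsFiniteMeasure (volume.restrict (Metric.closedBall (0 : ℂ) R)) :=
      ⟨by
        rw [Measure.restrict_apply_univ]
        exact (isCompact_closedBall (0 : ℂ) R).measure_lt_top⟩
    obtain ⟨C, hC⟩ := (Continuous.locBdd hu).2 R
    refine MemLp.of_bound hu.aestronglyMeasurable C ?_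
    exact (ae_restrict_iff' measurableSet_closedBall).2
      (.of_forall fun z hz => hC z (by simpa using hz))
  · intro φ hφ
    have key := integral_modeFun_mul_laplacian σ hq (continuous_glue hci1 hcoo1 e1) hq1
      (locBdd_glue hci2 hcoo2) hφ
    have hlap : IsTest (Laplacian.laplacian φ) := by
      rw [funext hφ.laplacian_eq]
      have t1 := (hφ.fderiv_apply 1).fderiv_apply 1
      have tI := (hφ.fderiv_apply Complex.I).fderiv_apply Complex.I
      exact ⟨t1.1.add tI.1, t1.2.add tI.2⟩
    have i1 := (Continuous.locBdd hu).integrable_mul hlap.1.continuous hlap.2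
    have i2 : Integrable fun z => modeFun σ (fun s => 8 * q1 s + 4 * s * q2 s) z * φ z := by
      refine LocBdd.integrable_mul ?_ hφ.1.continuous hφ.2
      exact (Continuous.locBdd (by fun_prop)).mul
        ((((Continuous.locBdd (X := ℝ) (F := fun _ => 8) (by fun_prop)).mul
          (Continuous.locBdd (continuous_glue hci1 hcoo1 e1))).add
          ((Continuous.locBdd (X := ℝ) (F := fun s => 4 * (s : ℂ)) (by fun_prop)).mul
          (locBdd_glue hci2 hcoo2))).comp_radial)
    have h3 := integral_sub i2 i1
    rw [key, sub_self] at h3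
    rw [← h3]
    congr 1
    ext z
    have h4 := hode (z.re ^ 2 + z.im ^ 2)
    have hI := Complex.I_sq
    rw [hwell z]
    simp only [modeFun] at h4 ⊢
    rw [h4]
    linear_combination (-((z.re + σ * z.im * Complex.I) * q (z.re ^ 2 + z.im ^ 2) * φ z) *
      4 * τ ^ 2) * hI
  · have hout : ∀ z : ℂ, ρ < ‖z‖ → ∀ c : ℂ, c * hankel1 l (2 * Complex.I * τ * ‖z‖) *
        (z / (‖z‖ : ℂ)) ^ l = modeFun σ q z → 
        HasSum (fun m : ℤ => (if m = l then c else 0) * outgoingWave (2 * Complex.I * τ) m ‖z‖ *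
          (z / (‖z‖ : ℂ)) ^ m) (modeFun σ q z) := by
      intro z hz c hc
      rw [← hc]
      convert hasSum_single (f := fun m : ℤ => (if m = l then c else 0) *
        outgoingWave (2 * Complex.I * τ) m ‖z‖ * (z / (‖z‖ : ℂ)) ^ m) l ?_ using 1
      · rw [if_pos rfl, outgoingWave, if_neg hlam0]
      · intro m hm; simp [hm]
    have hpi : (Real.pi : ℂ) ≠ 0 := by exact_mod_cast Real.pi_ne_zero
    -- The coefficient inverts the normalisation in `hankel1_one`; the factor `l` absorbs the sign
    -- in `H₋₁ = -H₁`.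
    refine ⟨fun m => if m = l then -(l : ℂ) * β * Real.pi * τ else 0, fun z hz => hout z hz _ ?_⟩
    have hr : 0 < ‖z‖ := hρ.trans hz
    have hr' : (‖z‖ : ℂ) ≠ 0 := by exact_mod_cast hr.ne'
    have hgt : S < ‖z‖ ^ 2 := by rw [hS]; gcongr
    have hz0 : z ≠ 0 := norm_pos_iff.1 hr
    rw [modeFun, ← sq_norm_eq, hq_def, glue_of_lt _ _ hgt, outerProfile]
    rcases hσ with ⟨rfl, rfl⟩ | ⟨rfl, rfl⟩
    · rw [hankel1_one hτ0 hr, zpow_one, one_mul, Complex.re_add_im]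
      push_cast
      field_simp
    · rw [hankel1_neg_one, hankel1_one hτ0 hr, zpow_neg_one]
      have hconj : (z.re : ℂ) + -1 * z.im * Complex.I = ‖z‖ ^ 2 / z := by
        rw [eq_div_iff hz0]
        have h1 : ((‖z‖ : ℂ)) ^ 2 = z.re ^ 2 + z.im ^ 2 := by exact_mod_cast sq_norm_eq z
        rw [h1]
        linear_combination (-(z.im : ℂ) ^ 2) * Complex.I_sq -
          (z.re - z.im * Complex.I) * Complex.re_add_im z
      rw [hconj]
      push_cast
      field_simp

/-! ### The decaying solution of `x y'' = y` -/

/-- The integrand of the decaying solution. -/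
def decKer (x t : ℝ) : ℝ := Real.exp (-t - x / t)

/-- The decaying solution `2 √x K₁(2√x)` of `x y'' = y`. -/
def decSol (x : ℝ) : ℝ := ∫ t in Set.Ioi (0 : ℝ), decKer x t

/-- The derivative `-2 K₀(2√x)` of the decaying solution. -/
def decSol' (x : ℝ) : ℝ := ∫ t in Set.Ioi (0 : ℝ), -(decKer x t / t)

lemma decKer_pos (x t : ℝ) : 0 < decKer x t := Real.exp_pos _

lemma measurable_decKer (x : ℝ) : Measurable (decKer x) := by unfold decKer; fun_prop

lemma decKer_le {x t : ℝ} (hx : 0 ≤ x) (ht : 0 < t) : decKer x t ≤ Real.exp (-t) := by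
  unfold decKer; gcongr; have : 0 ≤ x / t := by positivity
  linarith

/-- From `y exp(-y) ≤ 1` with `y = c/t`. Uniformity over `x ≥ c` is what differentiation under the
integral requires. -/
lemma decKer_div_le {c x t : ℝ} (hc : 0 < c) (hcx : c ≤ x) (ht : 0 < t) :
    decKer x t / t ≤ 1 / c * Real.exp (-t) := by
  have h1 : decKer x t ≤ Real.exp (-t) * Real.exp (-(c / t)) := by
    rw [decKer, ← Real.exp_add]; gcongr
    have : c / t ≤ x / t := by gcongr
    linarith
  have h2 : Real.exp (-(c / t)) * (c / t) ≤ 1 := by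
    rw [Real.exp_neg, inv_mul_le_iff₀ (Real.exp_pos _)]
    linarith [Real.add_one_le_exp (c / t)]
  calc decKer x t / t ≤ Real.exp (-t) * Real.exp (-(c / t)) / t := by gcongr
    _ = 1 / c * Real.exp (-t) * (Real.exp (-(c / t)) * (c / t)) := by field_simp
    _ ≤ 1 / c * Real.exp (-t) * 1 := by gcongr
    _ = _ := mul_one _

lemma decKer_div_sq_le {c x t : ℝ} (hc : 0 < c) (hcx : c ≤ x) (ht : 0 < t) :
    decKer x t / t ^ 2 ≤ 2 / c ^ 2 * Real.exp (-t) := by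
  have h1 : decKer x t ≤ Real.exp (-t) * Real.exp (-(c / t)) := by
    rw [decKer, ← Real.exp_add]; gcongr
    have : c / t ≤ x / t := by gcongr
    linarith
  have h2 : Real.exp (-(c / t)) * (c / t) ^ 2 ≤ 2 := by
    rw [Real.exp_neg, inv_mul_le_iff₀ (Real.exp_pos _)]
    have := Real.quadratic_le_exp_of_nonneg (show 0 ≤ c / t by positivity)
    have h3 : 0 ≤ c / t := by positivity
    linarith
  calc decKer x t / t ^ 2 ≤ Real.exp (-t) * Real.exp (-(c / t)) / t ^ 2 := by gcongr
    _ = 1 / c ^ 2 * Real.exp (-t) * (Real.exp (-(c / t)) * (c / t) ^ 2) := by field_simp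
    _ ≤ 1 / c ^ 2 * Real.exp (-t) * 2 := by gcongr
    _ = _ := by ring

lemma integrableOn_exp_neg : IntegrableOn (fun t : ℝ => Real.exp (-t)) (Set.Ioi 0) := by
  simpa using integrableOn_exp_neg_Ioi 0

lemma integrableOn_of_le_exp {F g : ℝ → ℝ} (hF : Measurable F)
    (hg : IntegrableOn g (Set.Ioi 0)) (h : ∀ t, 0 < t → |F t| ≤ g t) :
    IntegrableOn F (Set.Ioi 0) :=
  Integrable.mono' hg hF.aestronglyMeasurable
    ((ae_restrict_iff' measurableSet_Ioi).2 (.of_forall fun t ht => h t ht))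

lemma integrableOn_decKer {x : ℝ} (hx : 0 ≤ x) : IntegrableOn (decKer x) (Set.Ioi 0) :=
  integrableOn_of_le_exp (measurable_decKer x) integrableOn_exp_neg fun t ht => by
    rw [abs_of_pos (decKer_pos x t)]; exact decKer_le hx ht

lemma integrableOn_decKer_div {x : ℝ} (hx : 0 < x) :
    IntegrableOn (fun t => decKer x t / t) (Set.Ioi 0) :=
  integrableOn_of_le_exp ((measurable_decKer x).div measurable_id)
    (integrableOn_exp_neg.const_mul (1 / x)) fun t ht => by
    rw [abs_of_pos (div_pos (decKer_pos x t) ht)]; exact decKer_div_le hx le_rfl ht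

lemma integrableOn_decKer_div_sq {x : ℝ} (hx : 0 < x) :
    IntegrableOn (fun t => decKer x t / t ^ 2) (Set.Ioi 0) :=
  integrableOn_of_le_exp ((measurable_decKer x).div (measurable_id.pow_const 2))
    (integrableOn_exp_neg.const_mul (2 / x ^ 2)) fun t ht => by
    rw [abs_of_pos (div_pos (decKer_pos x t) (by positivity))]
    exact decKer_div_sq_le hx le_rfl ht

lemma decSol_nonneg (x : ℝ) : 0 ≤ decSol x :=
  integral_nonneg fun t => (decKer_pos x t).le

lemma decSol_le_one {x : ℝ} (hx : 0 ≤ x) : decSol x ≤ 1 := by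
  rw [decSol, ← integral_exp_neg_Ioi_zero]
  exact setIntegral_mono_on (integrableOn_decKer hx) integrableOn_exp_neg measurableSet_Ioi
    fun t ht => decKer_le hx ht

lemma hasDerivAt_decKer_left (x t : ℝ) :
    HasDerivAt (fun y => decKer y t) (-(decKer x t / t)) x := by
  have := (((hasDerivAt_id x).div_const t).const_sub (-t)).exp
  refine this.congr_deriv ?_
  simp [decKer]; ring

lemma hasDerivAt_decKer_right (x : ℝ) {t : ℝ} (ht : t ≠ 0) :
    HasDerivAt (decKer x) ((-1 + x / t ^ 2) * decKer x t) t := by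
  have := ((hasDerivAt_id t).neg.sub ((hasDerivAt_const t x).div (hasDerivAt_id t) ht)).exp
  refine this.congr_deriv ?_
  simp [decKer]; ring

lemma hasDerivAt_decSol {x : ℝ} (hx : 0 < x) : HasDerivAt decSol (decSol' x) x := by
  have hball : ∀ y ∈ Metric.ball x (x / 2), x / 2 ≤ y := fun y hy => by
    rw [Metric.mem_ball, Real.dist_eq, abs_lt] at hy; linarith
  refine (hasDerivAt_integral_of_dominated_loc_of_deriv_le (μ := volume.restrict (Set.Ioi 0))
    (F := fun y t => decKer y t) (F' := fun y t => -(decKer y t / t))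
    (bound := fun t => 1 / (x / 2) * Real.exp (-t)) (Metric.ball_mem_nhds x (half_pos hx))
    (.of_forall fun y => (measurable_decKer y).aestronglyMeasurable)
    (integrableOn_decKer hx.le)
    ((measurable_decKer x).div measurable_id).neg.aestronglyMeasurable
    ((ae_restrict_iff' measurableSet_Ioi).2 (.of_forall fun t ht y hy => ?_))
    (integrableOn_exp_neg.const_mul _)
    (.of_forall fun t y _ => hasDerivAt_decKer_left y t)).2
  rw [norm_neg, Real.norm_eq_abs, abs_of_pos (div_pos (decKer_pos y t) ht)]
  exact decKer_div_le (half_pos hx) (hball y hy) ht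

lemma tendsto_decKer_zero {x : ℝ} (hx : 0 < x) : Tendsto (decKer x) (𝓝[>] 0) (𝓝 0) := by
  refine squeeze_zero' (.of_forall fun t => (decKer_pos x t).le) (g := fun t => 1 / x * t) ?_ ?_
  · filter_upwards [self_mem_nhdsWithin] with t ht
    have h := decKer_div_le hx le_rfl ht
    rw [div_le_iff₀ ht] at h
    refine h.trans ?_
    have h1 : Real.exp (-t) ≤ 1 := Real.exp_le_one_iff.2 (by linarith [Set.mem_Ioi.1 ht])
    have ht' := Set.mem_Ioi.1 ht
    have : 1 / x * Real.exp (-t) ≤ 1 / x * 1 := by gcongr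
    rw [mul_one] at this
    gcongr
  · have : Tendsto (fun t : ℝ => 1 / x * t) (𝓝 0) (𝓝 (1 / x * 0)) := by
      exact (continuous_const.mul continuous_id).tendsto 0
    rw [mul_zero] at this
    exact this.mono_left nhdsWithin_le_nhds

lemma tendsto_decKer_atTop {x : ℝ} (hx : 0 ≤ x) : Tendsto (decKer x) atTop (𝓝 0) := by
  refine squeeze_zero' (.of_forall fun t => (decKer_pos x t).le) ?_
    (Real.tendsto_exp_neg_atTop_nhds_zero)
  filter_upwards [eventually_gt_atTop 0] with t ht using decKer_le hx ht

/-- The integral over `(0, ∞)` of the `t`-derivative `(-1 + x/t²) decKer x t` vanishes, as the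
kernel tends to `0` at both ends. Since the left side is the second derivative of `decSol`, this is
the equation `x y'' = y`. -/
lemma integral_decKer_div_sq {x : ℝ} (hx : 0 < x) :
    ∫ t in Set.Ioi (0 : ℝ), decKer x t / t ^ 2 = decSol x / x := by
  have hi : IntegrableOn (fun t => (-1 + x / t ^ 2) * decKer x t) (Set.Ioi 0) := by
    refine (((integrableOn_decKer_div_sq hx).const_mul x).sub
      (integrableOn_decKer hx.le)).congr (.of_forall fun t => ?_)
    simp only [Pi.sub_apply]; ring
  have h := integral_Ioi_mul_deriv_eq_deriv_mul (a := (0 : ℝ)) (u := fun _ : ℝ => (1 : ℝ))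
    (u' := fun _ => 0) (v := decKer x) (v' := fun t => (-1 + x / t ^ 2) * decKer x t)
    (a' := 0) (b' := 0)
    (fun t _ => hasDerivAt_const t 1)
    (fun t ht => hasDerivAt_decKer_right x (ne_of_gt ht))
    (by refine hi.congr (.of_forall fun t => ?_); simp)
    (by simp [Pi.mul_def])
    (by simpa [Pi.mul_def] using tendsto_decKer_zero hx)
    (by simpa [Pi.mul_def] using tendsto_decKer_atTop hx.le)
  simp only [one_mul, zero_mul, integral_zero, sub_zero] at h
  have h2 : ∫ t in Set.Ioi (0 : ℝ), (-1 + x / t ^ 2) * decKer x t =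
      x * (∫ t in Set.Ioi (0 : ℝ), decKer x t / t ^ 2) - decSol x := by
    rw [decSol, ← integral_const_mul, ← integral_sub ((integrableOn_decKer_div_sq hx).const_mul x)
      (integrableOn_decKer hx.le)]
    congr 1; ext t; ring
  rw [h2] at h
  rw [eq_div_iff hx.ne']
  linarith

lemma hasDerivAt_decSol' {x : ℝ} (hx : 0 < x) : HasDerivAt decSol' (decSol x / x) x := by
  have hball : ∀ y ∈ Metric.ball x (x / 2), x / 2 ≤ y := fun y hy => by
    rw [Metric.mem_ball, Real.dist_eq, abs_lt] at hy; linarith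
  rw [← integral_decKer_div_sq hx]
  refine (hasDerivAt_integral_of_dominated_loc_of_deriv_le (μ := volume.restrict (Set.Ioi 0))
    (F := fun y t => -(decKer y t / t)) (F' := fun y t => decKer y t / t ^ 2)
    (bound := fun t => 2 / (x / 2) ^ 2 * Real.exp (-t)) (Metric.ball_mem_nhds x (half_pos hx))
    (.of_forall fun y => ((measurable_decKer y).div measurable_id).neg.aestronglyMeasurable)
    (integrableOn_decKer_div hx).neg
    ((measurable_decKer x).div (measurable_id.pow_const 2)).aestronglyMeasurable
    ((ae_restrict_iff' measurableSet_Ioi).2 (.of_forall fun t ht y hy => ?_))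
    (integrableOn_exp_neg.const_mul _)
    (.of_forall fun t y _ => ?_)).2
  · have ht' := Set.mem_Ioi.1 ht
    rw [Real.norm_eq_abs, abs_of_pos (div_pos (decKer_pos y t) (by positivity))]
    exact decKer_div_sq_le (half_pos hx) (hball y hy) ht
  · refine ((hasDerivAt_decKer_left y t).div_const t).neg.congr_deriv ?_
    ring

/-! ### The behaviour of the decaying solution at the origin -/

/-- A dominating function for `log t · e^{-t}`. -/
def logDom (t : ℝ) : ℝ := (t + 2 * t ^ (-(1 / 2) : ℝ)) * Real.exp (-t)

/-- Use `log u ≤ u - 1` at `u = t` for large `t` and at `u = t^{-1/2}` for small `t`; the resulting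
singularity is integrable. -/
lemma abs_log_le {t : ℝ} (ht : 0 < t) : |Real.log t| ≤ t + 2 * t ^ (-(1 / 2) : ℝ) := by
  have h0 : 0 < t ^ (-(1 / 2) : ℝ) := Real.rpow_pos_of_pos ht _
  have h1 := Real.log_le_sub_one_of_pos ht
  have h2 := Real.log_le_sub_one_of_pos h0
  rw [Real.log_rpow ht] at h2
  rw [abs_le]
  constructor <;> linarith

lemma integrableOn_exp_mul_rpow {s : ℝ} (hs : -1 < s) :
    IntegrableOn (fun t : ℝ => Real.exp (-t) * t ^ s) (Set.Ioi 0) := by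
  simpa using Real.GammaIntegral_convergent (s := s + 1) (by linarith)

lemma integrableOn_logDom : IntegrableOn logDom (Set.Ioi 0) := by
  have h1 := integrableOn_exp_mul_rpow (s := 1) (by norm_num)
  have h2 := integrableOn_exp_mul_rpow (s := -(1 / 2)) (by norm_num)
  refine (h1.add (h2.const_mul 2)).congr (.of_forall fun t => ?_)
  simp only [Pi.add_apply, logDom, Real.rpow_one]; ring

lemma abs_log_mul_decKer_le {x t : ℝ} (hx : 0 ≤ x) (ht : 0 < t) :
    |Real.log t * decKer x t| ≤ logDom t := by
  rw [abs_mul, abs_of_pos (decKer_pos x t), logDom]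
  exact mul_le_mul (abs_log_le ht) (decKer_le hx ht) (decKer_pos x t).le
    (by have := Real.rpow_pos_of_pos ht (-(1 / 2)); positivity)

lemma measurable_log_mul_decKer (x : ℝ) : Measurable fun t => Real.log t * decKer x t :=
  Real.measurable_log.mul (measurable_decKer x)

/-- The logarithmic moment of the integrand. -/
def logMoment (x : ℝ) : ℝ := ∫ t in Set.Ioi (0 : ℝ), Real.log t * decKer x t

lemma integrableOn_log_mul_decKer {x : ℝ} (hx : 0 ≤ x) :
    IntegrableOn (fun t => Real.log t * decKer x t) (Set.Ioi 0) :=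
  integrableOn_of_le_exp (measurable_log_mul_decKer x) integrableOn_logDom fun _ ht =>
    abs_log_mul_decKer_le hx ht

lemma integrableOn_log_mul_decKer_div_sq {x : ℝ} (hx : 0 < x) :
    IntegrableOn (fun t => Real.log t * (decKer x t / t ^ 2)) (Set.Ioi 0) :=
  integrableOn_of_le_exp (Real.measurable_log.mul
    ((measurable_decKer x).div (measurable_id.pow_const 2)))
    (integrableOn_logDom.const_mul (2 / x ^ 2)) fun t ht => by
    rw [abs_mul, abs_of_pos (div_pos (decKer_pos x t) (by positivity)), logDom]
    calc |Real.log t| * (decKer x t / t ^ 2)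
        ≤ (t + 2 * t ^ (-(1 / 2) : ℝ)) * (2 / x ^ 2 * Real.exp (-t)) :=
          mul_le_mul (abs_log_le ht) (decKer_div_sq_le hx le_rfl ht)
            (div_pos (decKer_pos x t) (by positivity)).le
            (by have := Real.rpow_pos_of_pos ht (-(1 / 2)); positivity)
      _ = _ := by ring

/-- The integral is the derivative at `1` of the Gamma integral, and `Γ'(1) = -γ`. -/
lemma integral_log_mul_exp_neg :
    ∫ t in Set.Ioi (0 : ℝ), Real.log t * Real.exp (-t) = -Real.eulerMascheroniConstant := by
  have h1 := Complex.hasDerivAt_GammaIntegral (s := 1) (by simp)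
  have h2 : Complex.GammaIntegral =ᶠ[𝓝 1] Complex.Gamma := by
    have : {s : ℂ | 0 < s.re} ∈ 𝓝 (1 : ℂ) :=
      (Complex.continuous_re.isOpen_preimage _ isOpen_Ioi).mem_nhds (by simp)
    filter_upwards [this] with s hs using (Complex.Gamma_eq_integral hs).symm
  have h3 := (h1.congr_of_eventuallyEq h2.symm).unique Complex.hasDerivAt_Gamma_one
  have h4 : ∫ t : ℝ in Set.Ioi 0, (t : ℂ) ^ ((1 : ℂ) - 1) * (Real.log t * Real.exp (-t) : ℂ) =
      ((∫ t in Set.Ioi (0 : ℝ), Real.log t * Real.exp (-t) : ℝ) : ℂ) := by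
    rw [← integral_complex_ofReal]
    congr 1; ext t; simp
  rw [h4] at h3
  exact_mod_cast h3

lemma tendsto_logMoment :
    Tendsto logMoment (𝓝[>] 0) (𝓝 (-Real.eulerMascheroniConstant)) := by
  rw [← integral_log_mul_exp_neg]
  refine tendsto_integral_filter_of_dominated_convergence logDom
    (.of_forall fun x => (measurable_log_mul_decKer x).aestronglyMeasurable) ?_
    integrableOn_logDom ?_
  · filter_upwards [self_mem_nhdsWithin] with x hx
    exact (ae_restrict_iff' measurableSet_Ioi).2
      (.of_forall fun t ht => abs_log_mul_decKer_le (le_of_lt hx) ht)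
  · refine .of_forall fun t => ?_
    have : Continuous fun x : ℝ => Real.log t * decKer x t := by unfold decKer; fun_prop
    have h := this.tendsto 0
    simp only [decKer, zero_div, sub_zero] at h
    exact h.mono_left nhdsWithin_le_nhds

/-- The substitution `t ↦ x/t` preserves the kernel, turns `x dt/t²` into `dt` and `log t` into `log
x - log t`. -/
lemma integral_log_mul_decKer_div_sq {x : ℝ} (hx : 0 < x) :
    x * ∫ t in Set.Ioi (0 : ℝ), Real.log t * (decKer x t / t ^ 2) =
      Real.log x * decSol x - logMoment x := by
  let g : ℝ → ℝ := fun u => Real.log (x / u) * decKer x u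
  have h1 := integral_comp_rpow_Ioi (fun v => x * g (x * v)) (p := -1) (by norm_num)
  have h2 := integral_comp_mul_left_Ioi g 0 hx
  rw [integral_const_mul, h2, mul_zero, smul_eq_mul, ← mul_assoc, mul_inv_cancel₀ hx.ne',
    one_mul] at h1
  have h3 : ∫ u in Set.Ioi 0, g u = Real.log x * decSol x - logMoment x := by
    rw [decSol, logMoment, ← integral_const_mul, ← integral_sub
      ((integrableOn_decKer hx.le).const_mul _) (integrableOn_log_mul_decKer hx.le)]
    refine setIntegral_congr_fun measurableSet_Ioi fun u hu => ?_
    simp only [g]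
    rw [Real.log_div hx.ne' (ne_of_gt hu)]; ring
  rw [← h3, ← h1, ← integral_const_mul]
  refine setIntegral_congr_fun measurableSet_Ioi fun t ht => ?_
  have ht' : t ≠ 0 := ne_of_gt ht
  have e1 : t ^ (-1 - 1 : ℝ) = (t ^ 2)⁻¹ := by
    rw [show (-1 - 1 : ℝ) = -(2 : ℕ) by norm_num, Real.rpow_neg (le_of_lt ht), Real.rpow_natCast]
  simp only [g, e1, Real.rpow_neg_one, smul_eq_mul, abs_neg, abs_one, one_mul]
  rw [show x / (x * t⁻¹) = t by field_simp]
  have e2 : decKer x (x * t⁻¹) = decKer x t := by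
    unfold decKer; congr 1; field_simp; ring
  rw [e2]; ring

lemma tendsto_log_mul_decKer_zero {x : ℝ} (hx : 0 < x) :
    Tendsto (fun t => Real.log t * decKer x t) (𝓝[>] 0) (𝓝 0) := by
  refine squeeze_zero_norm' (a := fun t => |Real.log t * t| * (1 / x)) ?_ ?_
  · filter_upwards [self_mem_nhdsWithin] with t ht
    have ht' := Set.mem_Ioi.1 ht
    have h := decKer_div_le hx le_rfl ht'
    rw [div_le_iff₀ ht'] at h
    have h1 : Real.exp (-t) ≤ 1 := Real.exp_le_one_iff.2 (by linarith)
    rw [Real.norm_eq_abs, abs_mul, abs_mul, abs_of_pos (decKer_pos x t), abs_of_pos ht', mul_assoc]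
    refine mul_le_mul_of_nonneg_left (h.trans ?_) (abs_nonneg _)
    rw [mul_comm t]
    have : 1 / x * Real.exp (-t) ≤ 1 / x * 1 := by gcongr
    rw [mul_one] at this
    gcongr
  · have h := (Real.continuous_mul_log.tendsto 0)
    have h2 := ((h.abs).mul_const (1 / x)).mono_left (nhdsWithin_le_nhds (s := Set.Ioi 0))
    simp only [zero_mul, abs_zero] at h2
    simpa only [mul_comm (Real.log _)] using h2

lemma tendsto_log_mul_decKer_atTop {x : ℝ} (hx : 0 ≤ x) :
    Tendsto (fun t => Real.log t * decKer x t) atTop (𝓝 0) := by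
  refine squeeze_zero_norm' (a := fun t => t ^ 1 * Real.exp (-t)) ?_
    (Real.tendsto_pow_mul_exp_neg_atTop_nhds_zero 1)
  filter_upwards [eventually_ge_atTop 1] with t ht
  have ht0 : 0 < t := by linarith
  rw [norm_mul, Real.norm_eq_abs, Real.norm_eq_abs, abs_of_pos (decKer_pos x t), pow_one,
    abs_of_nonneg (Real.log_nonneg ht)]
  exact mul_le_mul ((Real.log_le_sub_one_of_pos ht0).trans (by linarith)) (decKer_le hx ht0)
    (decKer_pos x t).le ht0.le

/-- Integrate by parts with `log t` against the `t`-derivative of the kernel; the inversion `t ↦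
x/t` doubles the logarithmic moment. This isolates the singular term `log x` of the derivative, and
the remaining moment tends to `-γ`. -/
lemma decSol'_eq {x : ℝ} (hx : 0 < x) :
    decSol' x = Real.log x * decSol x - 2 * logMoment x := by
  have hi1 := integrableOn_log_mul_decKer hx.le
  have hi2 := (integrableOn_log_mul_decKer_div_sq hx).const_mul x
  have h := integral_Ioi_mul_deriv_eq_deriv_mul (a := (0 : ℝ)) (u := Real.log)
    (u' := fun t => t⁻¹) (v := decKer x) (v' := fun t => (-1 + x / t ^ 2) * decKer x t)
    (a' := 0) (b' := 0)
    (fun t ht => Real.hasDerivAt_log (ne_of_gt ht))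
    (fun t ht => hasDerivAt_decKer_right x (ne_of_gt ht))
    (by
      refine (hi2.sub hi1).congr (.of_forall fun t => ?_)
      simp only [Pi.sub_apply, Pi.mul_apply]; ring)
    (by
      refine (integrableOn_decKer_div hx).congr (.of_forall fun t => ?_)
      simp only [Pi.mul_apply]; ring)
    (tendsto_log_mul_decKer_zero hx) (tendsto_log_mul_decKer_atTop hx.le)
  have h2 : ∫ t in Set.Ioi (0 : ℝ), Real.log t * ((-1 + x / t ^ 2) * decKer x t) =
      Real.log x * decSol x - 2 * logMoment x := by
    have h3 : ∫ t in Set.Ioi (0 : ℝ), Real.log t * ((-1 + x / t ^ 2) * decKer x t) =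
        x * (∫ t in Set.Ioi (0 : ℝ), Real.log t * (decKer x t / t ^ 2)) - logMoment x := by
      rw [logMoment, ← integral_const_mul, ← integral_sub hi2 hi1]
      congr 1; ext t; ring
    rw [h3, integral_log_mul_decKer_div_sq hx]; ring
  rw [← h2, h, decSol', integral_neg]
  simp only [sub_zero, zero_sub]
  congr 2
  ext t; ring

lemma one_sub_exp_neg_le_sqrt {y : ℝ} (hy : 0 ≤ y) : 1 - Real.exp (-y) ≤ √y := by
  rcases le_or_gt y 1 with h | h
  · have h1 := Real.add_one_le_exp (-y)
    have h2 : y ≤ √y := Real.le_sqrt_of_sq_le (by nlinarith)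
    linarith
  · have h2 : 1 ≤ √y := Real.one_le_sqrt.2 h.le
    linarith [Real.exp_pos (-y)]

/-- A crude rate, from `1 - exp(-y) ≤ √y` with `y = x/t`. It suffices to make `log x (1 - decSol x)`
tend to `0`; the sharp rate follows afterwards from the derivative. -/
lemma one_sub_decSol_le : ∃ C : ℝ, ∀ x : ℝ, 0 < x → 1 - decSol x ≤ C * √x := by
  refine ⟨∫ t in Set.Ioi (0 : ℝ), Real.exp (-t) * t ^ (-(1 / 2) : ℝ), fun x hx => ?_⟩
  have h0 : 1 - decSol x = ∫ t in Set.Ioi (0 : ℝ), (Real.exp (-t) - decKer x t) := by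
    rw [integral_sub integrableOn_exp_neg (integrableOn_decKer hx.le), integral_exp_neg_Ioi_zero,
      decSol]
  rw [h0, ← integral_mul_const]
  refine setIntegral_mono_on (integrableOn_exp_neg.sub (integrableOn_decKer hx.le))
    ((integrableOn_exp_mul_rpow (by norm_num)).mul_const _) measurableSet_Ioi fun t ht => ?_
  have ht' := Set.mem_Ioi.1 ht
  have h1 := one_sub_exp_neg_le_sqrt (show 0 ≤ x / t by positivity)
  rw [Real.sqrt_div hx.le] at h1
  rw [decKer, show -t - x / t = -t + -(x / t) by ring, Real.exp_add, Real.rpow_neg ht'.le,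
    ← Real.sqrt_eq_rpow]
  calc Real.exp (-t) - Real.exp (-t) * Real.exp (-(x / t))
      = Real.exp (-t) * (1 - Real.exp (-(x / t))) := by ring
    _ ≤ Real.exp (-t) * (√x / √t) := by gcongr
    _ = _ := by ring

lemma tendsto_decSol : Tendsto decSol (𝓝[>] 0) (𝓝 1) := by
  obtain ⟨C, hC⟩ := one_sub_decSol_le
  have h1 : Tendsto (fun x : ℝ => 1 - C * √x) (𝓝[>] 0) (𝓝 1) := by
    have : Continuous fun x : ℝ => 1 - C * √x := by fun_prop
    have h := this.tendsto 0
    simp only [Real.sqrt_zero, mul_zero, sub_zero] at h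
    exact h.mono_left nhdsWithin_le_nhds
  refine tendsto_of_tendsto_of_tendsto_of_le_of_le' h1 tendsto_const_nhds ?_ ?_
  · filter_upwards [self_mem_nhdsWithin] with x hx
    linarith [hC x hx]
  · filter_upwards [self_mem_nhdsWithin] with x hx using decSol_le_one (le_of_lt hx)

lemma tendsto_decSol'_sub_log :
    Tendsto (fun x => decSol' x - Real.log x - 2 * Real.eulerMascheroniConstant)
      (𝓝[>] 0) (𝓝 0) := by
  obtain ⟨C, hC⟩ := one_sub_decSol_le
  have h1 : Tendsto (fun x => Real.log x * (1 - decSol x)) (𝓝[>] 0) (𝓝 0) := by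
    refine squeeze_zero_norm' (a := fun x => |2 * C * (√x * Real.log √x)|) ?_ ?_
    · filter_upwards [self_mem_nhdsWithin] with x hx
      have hx' := Set.mem_Ioi.1 hx
      have h0 : 0 ≤ 1 - decSol x := by linarith [decSol_le_one hx'.le]
      have hs : 0 < √x := Real.sqrt_pos.2 hx'
      have hC0 : 0 ≤ C := by
        by_contra! h
        nlinarith [hC x hx']
      rw [Real.norm_eq_abs, abs_mul, abs_of_nonneg h0, Real.log_sqrt hx'.le, abs_mul, abs_mul,
        abs_mul, abs_div, abs_of_pos hs, abs_of_nonneg hC0, abs_of_pos (zero_lt_two' ℝ)]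
      calc |Real.log x| * (1 - decSol x) ≤ |Real.log x| * (C * √x) := by
            gcongr; exact hC x hx'
        _ = _ := by ring
    · have : Continuous fun x : ℝ => |2 * C * (√x * Real.log √x)| :=
        (continuous_const.mul (Real.continuous_mul_log.comp Real.continuous_sqrt)).abs
      have h := this.tendsto 0
      simp only [Real.sqrt_zero, zero_mul, mul_zero, abs_zero] at h
      exact h.mono_left nhdsWithin_le_nhds
  have h2 := (tendsto_logMoment.const_mul (-2)).sub h1
  have h3 := h2.sub_const (2 * Real.eulerMascheroniConstant)
  rw [show -2 * -Real.eulerMascheroniConstant - 0 - 2 * Real.eulerMascheroniConstant = 0 by ring]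
    at h3
  refine h3.congr' ?_
  filter_upwards [self_mem_nhdsWithin] with x hx
  rw [decSol'_eq hx]; ring

/-- The right side is the primitive of `-log x + C` that vanishes at `0`; subtracting `±f` from it
leaves a monotone function with limit `0` at the origin. -/
lemma abs_le_of_abs_deriv_le_log {f f' : ℝ → ℝ} {C δ : ℝ}
    (hf : ∀ x, 0 < x → x < δ → HasDerivAt f (f' x) x)
    (hf' : ∀ x, 0 < x → x < δ → |f' x| ≤ -Real.log x + C)
    (h0 : Tendsto f (𝓝[>] 0) (𝓝 0)) {x : ℝ} (hx : 0 < x) (hxδ : x < δ) :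
    |f x| ≤ x * (-Real.log x + (C + 1)) := by
  have key : ∀ g g' : ℝ → ℝ, (∀ x, 0 < x → x < δ → HasDerivAt g (g' x) x) →
      (∀ x, 0 < x → x < δ → |g' x| ≤ -Real.log x + C) → Tendsto g (𝓝[>] 0) (𝓝 0) →
      g x ≤ x * (-Real.log x + (C + 1)) := by
    intro g g' hg hg' hg0
    let M : ℝ → ℝ := fun y => -(y * Real.log y) + (C + 1) * y - g y
    have hM : ∀ y, 0 < y → y < δ → HasDerivAt M (-Real.log y + C - g' y) y := by
      intro y hy hyδ
      have := ((Real.hasDerivAt_mul_log hy.ne').neg.add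
        ((hasDerivAt_id y).const_mul (C + 1))).sub (hg y hy hyδ)
      refine this.congr_deriv ?_
      ring
    have hmono : MonotoneOn M (Set.Ioo 0 δ) := by
      refine monotoneOn_of_deriv_nonneg (convex_Ioo 0 δ)
        (fun y hy => (hM y hy.1 hy.2).continuousAt.continuousWithinAt) ?_ ?_
      · rw [interior_Ioo]
        exact fun y hy => (hM y hy.1 hy.2).differentiableAt.differentiableWithinAt
      · rw [interior_Ioo]
        intro y hy
        rw [(hM y hy.1 hy.2).deriv]
        linarith [(abs_le.1 (hg' y hy.1 hy.2)).2]
    have hM0 : Tendsto M (𝓝[>] 0) (𝓝 0) := by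
      have : Continuous fun y : ℝ => -(y * Real.log y) + (C + 1) * y :=
        Real.continuous_mul_log.neg.add (by fun_prop)
      have h := (this.tendsto 0).mono_left (nhdsWithin_le_nhds (s := Set.Ioi 0))
      simpa using h.sub hg0
    have : 0 ≤ M x := by
      refine le_of_tendsto hM0 ?_
      filter_upwards [Ioo_mem_nhdsGT hx] with y hy
      exact hmono ⟨hy.1, hy.2.trans hxδ⟩ ⟨hx, hxδ⟩ hy.2.le
    simp only [M] at this
    linarith
  rw [abs_le]
  refine ⟨?_, key f f' hf hf' h0⟩
  have := key (fun y => -f y) (fun y => -f' y) (fun y h1 h2 => (hf y h1 h2).neg)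
    (fun y h1 h2 => by rw [abs_neg]; exact hf' y h1 h2) (by simpa using h0.neg)
  linarith

/-- A bootstrap: `decSol' = log x + O(1)` integrates to the first bound, and then `(decSol' - log
x)' = (decSol - 1)/x = O(|log x| + 1)` integrates to the second. -/
lemma decSol_asymptotics : ∃ C δ : ℝ, 0 < δ ∧ ∀ x, 0 < x → x < δ →
    |decSol x - 1| ≤ x * (-Real.log x + C) ∧
    |decSol' x - Real.log x - 2 * Real.eulerMascheroniConstant| ≤ x * (-Real.log x + C) := by
  have h1 : ∀ᶠ x in 𝓝[>] (0 : ℝ),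
      |decSol' x - Real.log x - 2 * Real.eulerMascheroniConstant| < 1 := by
    have := tendsto_decSol'_sub_log.eventually (Metric.ball_mem_nhds 0 one_pos)
    simpa [Real.dist_eq] using this
  obtain ⟨δ, hδ, h2⟩ := mem_nhdsGT_iff_exists_Ioo_subset.1 h1
  have hδ0 : 0 < δ := hδ
  set D := 1 + |2 * Real.eulerMascheroniConstant|
  have hD : ∀ x, 0 < x → x < min δ 1 → |decSol x - 1| ≤ x * (-Real.log x + (D + 1)) := by
    intro x hx hxδ
    refine abs_le_of_abs_deriv_le_log (f := fun x => decSol x - 1) (f' := decSol')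
      (fun y hy _ => (hasDerivAt_decSol hy).sub_const 1) (fun y hy hyδ => ?_) ?_ hx hxδ
    · have h3 : |decSol' y - Real.log y - 2 * Real.eulerMascheroniConstant| < 1 :=
        h2 ⟨hy, hyδ.trans_le (min_le_left _ _)⟩
      have h4 : Real.log y ≤ 0 := Real.log_nonpos hy.le (hyδ.trans_le (min_le_right _ _)).le
      have h5 := abs_le.1 (le_refl |2 * Real.eulerMascheroniConstant|)
      rw [abs_lt] at h3
      rw [abs_le]
      constructor <;> linarith
    · simpa using tendsto_decSol.sub_const 1
  refine ⟨D + 2, min δ 1, by positivity, fun x hx hxδ => ⟨?_, ?_⟩⟩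
  · refine (hD x hx hxδ).trans ?_
    gcongr
    linarith
  · have := abs_le_of_abs_deriv_le_log (C := D + 1)
      (f := fun x => decSol' x - Real.log x - 2 * Real.eulerMascheroniConstant)
      (f' := fun x => decSol x / x - x⁻¹)
      (fun y hy _ => (((hasDerivAt_decSol' hy).sub (Real.hasDerivAt_log hy.ne')).sub_const _))
      (fun y hy hyδ => ?_) tendsto_decSol'_sub_log hx hxδ
    · rwa [show D + 2 = D + 1 + 1 by ring]
    · rw [show decSol y / y - y⁻¹ = (decSol y - 1) / y by ring, abs_div, abs_of_pos hy,
        div_le_iff₀ hy, mul_comm]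
      exact hD y hy hyδ

/-! ### Polar coordinates -/

/-- The point with polar coordinates `(r, θ)`. -/
def polarPt (r θ : ℝ) : ℂ := r * (Real.cos θ + Real.sin θ * Complex.I)

lemma polarPt_re (r θ : ℝ) : (polarPt r θ).re = r * Real.cos θ := by
  rw [polarPt, Complex.re_ofReal_mul, Complex.add_re, Complex.ofReal_re, Complex.re_ofReal_mul]
  simp

lemma polarPt_im (r θ : ℝ) : (polarPt r θ).im = r * Real.sin θ := by
  rw [polarPt, Complex.im_ofReal_mul, Complex.add_im, Complex.ofReal_im, Complex.im_ofReal_mul]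
  simp

lemma polarPt_sq (r θ : ℝ) : (polarPt r θ).re ^ 2 + (polarPt r θ).im ^ 2 = r ^ 2 := by
  rw [polarPt_re, polarPt_im]
  linear_combination r ^ 2 * Real.cos_sq_add_sin_sq θ

lemma integrableOn_polar {E : Type*} [NormedAddCommGroup E] [NormedSpace ℝ E] {f : ℂ → E}
    (hf : Integrable f) :
    Integrable (fun p : ℝ × ℝ => p.1 • f (polarPt p.1 p.2))
      ((volume.restrict (Set.Ioi (0 : ℝ))).prod (volume.restrict (Set.Ioo (-Real.pi) Real.pi))) := by
  have h := Complex.volume_preserving_equiv_real_prod.symm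
  have h1 : Integrable (f ∘ Complex.measurableEquivRealProd.symm) volume :=
    (h.integrable_comp_emb Complex.measurableEquivRealProd.symm.measurableEmbedding).2 hf
  have h2 := (integrableOn_image_iff_integrableOn_abs_det_fderiv_smul volume
    polarCoord.open_target.measurableSet
    (fun p _ ↦ (hasFDerivAt_polarCoord_symm p).hasFDerivWithinAt) polarCoord.symm.injOn
    (f ∘ Complex.measurableEquivRealProd.symm)).1 h1.integrableOn
  rw [Measure.prod_restrict]
  refine IntegrableOn.congr_fun h2 (fun p hp => ?_) polarCoord.open_target.measurableSet
  simp_rw [det_fderivPolarCoordSymm]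
  rw [abs_of_pos hp.1, Function.comp_apply,
    Complex.measurableEquivRealProd_symm_polarCoord_symm_apply]
  rw [Complex.polarCoord_symm_apply, polarPt]

lemma integral_polar {E : Type*} [NormedAddCommGroup E] [NormedSpace ℝ E] {f : ℂ → E}
    (hf : Integrable f) :
    ∫ z, f z = ∫ r in Set.Ioi (0 : ℝ), ∫ θ in Set.Ioo (-Real.pi) Real.pi, r • f (polarPt r θ) := by
  rw [← integral_prod _ (integrableOn_polar hf), Measure.prod_restrict,
    ← Complex.integral_comp_polarCoord_symm]
  refine setIntegral_congr_fun polarCoord.open_target.measurableSet fun p _ => ?_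
  simp only [Complex.polarCoord_symm_apply, polarPt]

/-- The density, in the variable `s = |z|²`, of the angular component of `u`. -/
def radialPart (σ : ℂ) (u : ℂ → ℂ) (s : ℝ) : ℂ :=
  1 / 2 * ∫ θ in Set.Ioo (-Real.pi) Real.pi, u (polarPt (√s) θ) * modeFun (-σ) 1 (polarPt (√s) θ)

lemma radialPart_of_nonpos (σ : ℂ) (u : ℂ → ℂ) {s : ℝ} (hs : s ≤ 0) : radialPart σ u s = 0 := by
  simp [radialPart, Real.sqrt_eq_zero_of_nonpos hs, modeFun, polarPt]

/-- The factor `1/2` in `radialPart` is the Jacobian in `r dr = ds/2`. The right side has the shape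
demanded by the change of variables `s = r²`, which turns plane integrals against modes into
integrals over `s`. -/
lemma radialPart_polar (σ : ℂ) (u : ℂ → ℂ) (h : ℝ → ℂ) {r : ℝ} (hr : 0 < r) :
    ∫ θ in Set.Ioo (-Real.pi) Real.pi, r • (u (polarPt r θ) * modeFun (-σ) h (polarPt r θ)) =
      (2 * r ^ ((2 : ℝ) - 1)) • (radialPart σ u (r ^ (2 : ℝ)) * h (r ^ (2 : ℝ))) := by
  have e : (2 : ℝ) - 1 = 1 := by norm_num
  rw [Real.rpow_two, radialPart, Real.sqrt_sq hr.le, e, Real.rpow_one, mul_assoc, mul_comm _ (h _),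
    ← integral_const_mul, ← integral_const_mul, ← integral_smul]
  congr 1
  ext θ
  simp only [modeFun, polarPt_sq, Pi.one_apply, Complex.real_smul]
  push_cast
  ring

lemma integrableOn_radialPart_mul {σ : ℂ} {u : ℂ → ℂ} {h : ℝ → ℂ}
    (hi : Integrable fun z => u z * modeFun (-σ) h z) :
    IntegrableOn (fun s => radialPart σ u s * h s) (Set.Ioi 0) := by
  rw [← integrableOn_Ioi_comp_rpow_iff _ (two_ne_zero' ℝ)]
  refine IntegrableOn.congr_fun (integrableOn_polar hi).integral_prod_left (fun r hr => ?_)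
    measurableSet_Ioi
  rw [radialPart_polar σ u h hr, abs_of_pos two_pos]

lemma integral_mul_modeFun {σ : ℂ} {u : ℂ → ℂ} {h : ℝ → ℂ}
    (hi : Integrable fun z => u z * modeFun (-σ) h z) :
    ∫ z, u z * modeFun (-σ) h z = ∫ s in Set.Ioi (0 : ℝ), radialPart σ u s * h s := by
  rw [integral_polar hi, ← integral_comp_rpow_Ioi_of_pos
    (g := fun s => radialPart σ u s * h s) (two_pos (α := ℝ))]
  exact setIntegral_congr_fun measurableSet_Ioi fun r hr => radialPart_polar σ u h hr

lemma integral_norm_radialPart_mul_le {σ : ℂ} {u : ℂ → ℂ} {h : ℝ → ℂ}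
    (hi : Integrable fun z => u z * modeFun (-σ) h z) :
    ∫ s in Set.Ioi (0 : ℝ), ‖radialPart σ u s * h s‖ ≤ ∫ z, ‖u z * modeFun (-σ) h z‖ := by
  rw [integral_polar hi.norm, ← integral_comp_rpow_Ioi_of_pos (two_pos (α := ℝ))]
  have hi2 := (integrableOn_radialPart_mul hi).norm
  rw [← IntegrableOn, ← integrableOn_Ioi_comp_rpow_iff _ (two_ne_zero' ℝ), abs_of_pos two_pos]
    at hi2
  refine setIntegral_mono_on hi2 (integrableOn_polar hi.norm).integral_prod_left measurableSet_Ioi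
    fun r hr => ?_
  have hr' := Set.mem_Ioi.1 hr
  have h1 := radialPart_polar σ u h hr
  have h2 : (2 * r ^ ((2 : ℝ) - 1)) • ‖radialPart σ u (r ^ (2 : ℝ)) * h (r ^ (2 : ℝ))‖ =
      ‖(2 * r ^ ((2 : ℝ) - 1)) • (radialPart σ u (r ^ (2 : ℝ)) * h (r ^ (2 : ℝ)))‖ := by
    rw [norm_smul, Real.norm_eq_abs, abs_of_pos (by positivity), smul_eq_mul]
  rw [h2, ← h1]
  refine (norm_integral_le_integral_norm _).trans (le_of_eq ?_)
  congr 1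
  ext θ
  rw [norm_smul, Real.norm_eq_abs, abs_of_pos hr', smul_eq_mul]

/-! ### Radial test functions -/

lemma norm_modeFun_le {σ : ℂ} (hσ : ‖σ‖ = 1) (h : ℝ → ℂ) (z : ℂ) :
    ‖modeFun σ h z‖ ≤ 2 * ‖z‖ * ‖h (z.re ^ 2 + z.im ^ 2)‖ := by
  rw [modeFun, norm_mul]
  gcongr
  refine (norm_add_le _ _).trans ?_
  rw [norm_mul, norm_mul, hσ, Complex.norm_I, Complex.norm_real, Complex.norm_real]
  have h1 := Complex.abs_re_le_norm z
  have h2 := Complex.abs_im_le_norm z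
  simp only [Real.norm_eq_abs]
  linarith

/-- Smoothness at the origin is free because `g` is a function of `x² + y²`. In particular `g` need
not vanish near `0`, which later excludes the singular radial solution. -/
lemma isTest_modeFun (σ : ℂ) {g : ℝ → ℂ} (hg : ContDiff ℝ ∞ g) {R : ℝ}
    (hR : ∀ s, R ≤ s → g s = 0) : IsTest (modeFun σ g) := by
  constructor
  · unfold modeFun
    have h1 : ContDiff ℝ ∞ (fun z : ℂ => z.re) := Complex.reCLM.contDiff
    have h2 : ContDiff ℝ ∞ (fun z : ℂ => z.im) := Complex.imCLM.contDiff
    have h3 : ContDiff ℝ ∞ (fun z : ℂ => (z.re : ℂ)) := Complex.ofRealCLM.contDiff.comp h1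
    have h4 : ContDiff ℝ ∞ (fun z : ℂ => (z.im : ℂ)) := Complex.ofRealCLM.contDiff.comp h2
    exact (h3.add ((contDiff_const.mul h4).mul contDiff_const)).mul
      (hg.comp ((h1.pow 2).add (h2.pow 2)))
  · refine HasCompactSupport.intro (isCompact_closedBall (0 : ℂ) (√R)) fun z hz => ?_
    rw [modeFun, ← sq_norm_eq, hR, mul_zero]
    simp only [Metric.mem_closedBall, dist_zero_right, not_le] at hz
    exact (Real.lt_sq_of_sqrt_lt hz).le

lemma laplacian_modeFun (σ : ℂ) {g g1 g2 : ℝ → ℂ} (hφ : IsTest (modeFun σ g))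
    (hg : ∀ s, HasDerivAt g (g1 s) s) (hg1 : ∀ s, HasDerivAt g1 (g2 s) s) (z : ℂ) :
    Laplacian.laplacian (modeFun σ g) z = modeFun σ (fun s => 8 * g1 s + 4 * s * g2 s) z := by
  have ex : (fun w : ℂ => fderiv ℝ (modeFun σ g) w 1) =
      fun w : ℂ => lineDeriv1 (σ * w.im * Complex.I) 1 (w.im ^ 2) g g1 w.re := by
    ext w
    have h1 := (hφ.differentiable w).hasFDerivAt.comp_hasDerivAt w.re (hasDerivAt_mk_re w.re w.im)
    refine h1.unique ((hasDerivAt_line (σ * w.im * Complex.I) 1 (w.im ^ 2)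
      (hg (w.re ^ 2 + w.im ^ 2))).congr_of_eventuallyEq (.of_forall fun t => ?_))
    simp only [modeFun, one_mul, add_comm (t : ℂ), Function.comp_apply]
  have ey : (fun w : ℂ => fderiv ℝ (modeFun σ g) w Complex.I) =
      fun w : ℂ => lineDeriv1 w.re (σ * Complex.I) (w.re ^ 2) g g1 w.im := by
    ext w
    have h1 := (hφ.differentiable w).hasFDerivAt.comp_hasDerivAt w.im (hasDerivAt_mk_im w.re w.im)
    refine h1.unique ((hasDerivAt_line w.re (σ * Complex.I) (w.re ^ 2)
      (hg (w.im ^ 2 + w.re ^ 2))).congr_of_eventuallyEq (.of_forall fun t => ?_))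
    simp only [modeFun, add_comm (w.re ^ 2), Function.comp_apply]
    ring
  have exx : fderiv ℝ (fun w => fderiv ℝ (modeFun σ g) w 1) z 1 =
      lineDeriv2 (σ * z.im * Complex.I) 1 (z.im ^ 2) g1 g2 z.re := by
    have h1 := ((hφ.fderiv_apply 1).differentiable z).hasFDerivAt.comp_hasDerivAt z.re
      (hasDerivAt_mk_re z.re z.im)
    refine h1.unique ((hasDerivAt_lineDeriv1 (σ * z.im * Complex.I) 1 (z.im ^ 2)
      (hg (z.re ^ 2 + z.im ^ 2)) (hg1 (z.re ^ 2 + z.im ^ 2))).congr_of_eventuallyEq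
      (.of_forall fun t => ?_))
    simp only [ex, Function.comp_apply]
  have eyy : fderiv ℝ (fun w => fderiv ℝ (modeFun σ g) w Complex.I) z Complex.I =
      lineDeriv2 z.re (σ * Complex.I) (z.re ^ 2) g1 g2 z.im := by
    have h1 := ((hφ.fderiv_apply Complex.I).differentiable z).hasFDerivAt.comp_hasDerivAt z.im
      (hasDerivAt_mk_im z.re z.im)
    refine h1.unique ((hasDerivAt_lineDeriv1 z.re (σ * Complex.I) (z.re ^ 2)
      (hg (z.im ^ 2 + z.re ^ 2)) (hg1 (z.im ^ 2 + z.re ^ 2))).congr_of_eventuallyEq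
      (.of_forall fun t => ?_))
    simp only [ey, Function.comp_apply]
  rw [hφ.laplacian_eq, exx, eyy]
  simp only [lineDeriv2, modeFun, add_comm (z.im ^ 2)]
  push_cast
  ring

/-- Fubini on the triangle `0 < s < t ≤ R`. It replaces integration by parts when `U` is merely
integrable. -/
lemma integral_triangle {U k : ℝ → ℂ} {R : ℝ} (hR : 0 ≤ R)
    (hU : IntervalIntegrable U volume 0 R) (hk : IntervalIntegrable k volume 0 R) :
    ∫ s in (0 : ℝ)..R, U s * ∫ t in s..R, k t = ∫ t in (0 : ℝ)..R, (∫ s in (0 : ℝ)..t, U s) * k t := by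
  rw [intervalIntegrable_iff_integrableOn_Ioc_of_le hR] at hU hk
  set μ := volume.restrict (Set.Ioc (0 : ℝ) R)
  have hT : MeasurableSet {p : ℝ × ℝ | p.1 < p.2} := measurableSet_lt measurable_fst measurable_snd
  have hint : Integrable (fun p : ℝ × ℝ => {p : ℝ × ℝ | p.1 < p.2}.indicator
      (fun p => U p.1 * k p.2) p) (μ.prod μ) :=
    (Integrable.mul_prod (μ := μ) (ν := μ) hU hk).indicator hT
  have h := integral_integral_swap (μ := μ) (ν := μ)
    (f := fun s t => {p : ℝ × ℝ | p.1 < p.2}.indicator (fun p => U p.1 * k p.2) (s, t)) hint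
  rw [intervalIntegral.integral_of_le hR, intervalIntegral.integral_of_le hR]
  convert h using 1
  · refine setIntegral_congr_fun measurableSet_Ioc fun s hs => ?_
    rw [intervalIntegral.integral_of_le hs.2, ← integral_const_mul]
    have : ∀ t, {p : ℝ × ℝ | p.1 < p.2}.indicator (fun p => U p.1 * k p.2) (s, t) =
        (Set.Ioi s).indicator (fun t => U s * k t) t := fun t => by
      simp [Set.indicator_apply]
    simp_rw [this]
    rw [integral_indicator measurableSet_Ioi, Measure.restrict_restrict measurableSet_Ioi]
    congr 2
    ext t
    simp only [Set.mem_Ioc, Set.mem_inter_iff, Set.mem_Ioi]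
    constructor
    · exact fun h => ⟨h.1, hs.1.trans h.1, h.2⟩
    · exact fun h => ⟨h.1, h.2.2⟩
  · refine setIntegral_congr_ae measurableSet_Ioc ?_
    have : ∀ t, ∀ s, {p : ℝ × ℝ | p.1 < p.2}.indicator (fun p => U p.1 * k p.2) (s, t) =
        (Set.Iio t).indicator (fun s => U s * k t) s := fun t s => by
      simp [Set.indicator_apply]
    simp_rw [this]
    refine .of_forall fun t ht => ?_
    rw [integral_indicator measurableSet_Iio, Measure.restrict_restrict measurableSet_Iio,
      integral_mul_const, intervalIntegral.integral_of_le ht.1.le, integral_Ioc_eq_integral_Ioo]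
    congr 3
    ext s
    simp only [Set.mem_Ioo, Set.mem_inter_iff, Set.mem_Iio, Set.mem_Ioc]
    constructor
    · exact fun h => ⟨h.2, h.1, h.2.le.trans ht.2⟩
    · exact fun h => ⟨h.2.1, h.1⟩

/-! ### The radial equation of an eigenfunction -/

lemma LocBdd.modeFun {h : ℝ → ℂ} (hh : LocBdd h) (σ : ℂ) : LocBdd (modeFun σ h) :=
  (Continuous.locBdd (by fun_prop)).mul hh.comp_radial

lemma LocBdd.integrable_memLp_mul {u F : ℂ → ℂ} (hu : MemLp u 2 volume) (hF : LocBdd F) {R : ℝ}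
    (hR : ∀ z, R < ‖z‖ → F z = 0) : Integrable fun z => u z * F z := by
  obtain ⟨C, hC⟩ := hF.2 R
  have : IsFiniteMeasure (volume.restrict (Metric.closedBall (0 : ℂ) R)) :=
    ⟨by rw [Measure.restrict_apply_univ]; exact (isCompact_closedBall (0 : ℂ) R).measure_lt_top⟩
  have h1 : Integrable u (volume.restrict (Metric.closedBall (0 : ℂ) R)) :=
    (hu.restrict _).integrable (by norm_num)
  have h2 : IntegrableOn (fun z => u z * F z) (Metric.closedBall (0 : ℂ) R) := by
    refine h1.mul_bdd (c := C) hF.1.aestronglyMeasurable ?_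
    exact (ae_restrict_iff' measurableSet_closedBall).2
      (.of_forall fun z hz => hC z (by simpa using hz))
  refine (integrableOn_iff_integrable_of_support_subset fun z hz => ?_).1 h2
  by_contra h
  exact hz (by simp only; rw [hR z (by simpa using h), mul_zero])

lemma integrable_mul_modeFun {u : ℂ → ℂ} (hu : MemLp u 2 volume) (σ : ℂ) {h : ℝ → ℂ}
    (hh : LocBdd h) {R : ℝ} (hR : ∀ s, R < s → h s = 0) :
    Integrable fun z => u z * modeFun σ h z := by
  refine (hh.modeFun σ).integrable_memLp_mul hu (R := √R) fun z hz => ?_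
  rw [modeFun, ← sq_norm_eq, hR _ (Real.lt_sq_of_sqrt_lt hz), mul_zero]

lemma locBdd_indicator_Iic (R : ℝ) : LocBdd ((Set.Iic R).indicator (1 : ℝ → ℂ)) := by
  refine ⟨measurable_one.indicator measurableSet_Iic, fun _ => ⟨1, fun x _ => ?_⟩⟩
  refine (norm_indicator_le_norm_self _ _).trans ?_
  simp

lemma integrable_mul_modeFun_indicator {u : ℂ → ℂ} (hu : MemLp u 2 volume) (σ : ℂ) (R : ℝ) :
    Integrable fun z => u z * modeFun σ ((Set.Iic R).indicator 1) z :=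
  integrable_mul_modeFun hu σ (locBdd_indicator_Iic R) (R := R) fun s hs => by
    rw [Set.indicator_of_notMem (by simpa using hs)]

lemma intervalIntegrable_radialPart {u : ℂ → ℂ} (hu : MemLp u 2 volume) (σ : ℂ) (a b : ℝ) :
    IntervalIntegrable (radialPart σ u) volume a b := by
  have key : ∀ R : ℝ, IntegrableOn (radialPart σ u) (Set.Iic R) := by
    intro R
    have h := integrableOn_radialPart_mul (integrable_mul_modeFun_indicator hu (-σ) R)
    have h1 : IntegrableOn (fun s => radialPart σ u s * (Set.Iic R).indicator 1 s) Set.univ := by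
      rw [← Set.Iic_union_Ioi (a := (0 : ℝ))]
      refine IntegrableOn.union ?_ h
      exact integrableOn_zero.congr_fun (fun s hs => by
        rw [radialPart_of_nonpos σ u hs, zero_mul]) measurableSet_Iic
    refine (h1.mono_set (Set.subset_univ _)).congr_fun (fun s hs => ?_) measurableSet_Iic
    simp [Set.indicator_of_mem hs]
  rw [intervalIntegrable_iff]
  exact (key (max a b)).mono_set fun x hx => hx.2

lemma locallyIntegrable_of_intervalIntegrable {F : ℝ → ℂ}
    (h : ∀ a b, IntervalIntegrable F volume a b) : LocallyIntegrable F := fun x =>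
  ⟨Set.Ioc (x - 1) (x + 1), Ioc_mem_nhds (by linarith) (by linarith),
    (intervalIntegrable_iff_integrableOn_Ioc_of_le (by linarith)).1 (h _ _)⟩

/-- On the disk of radius `√R` the test mode is at most `2√R`, and `2√R |u| ≤ R |u|² + 1`; the disk
has area `πR`. This linear bound is the only trace of square integrability used at infinity. -/
lemma integral_norm_radialPart_le {u : ℂ → ℂ} (hu : MemLp u 2 volume) {σ : ℂ} (hσ : ‖σ‖ = 1) :
    ∃ C : ℝ, ∀ R : ℝ, 1 ≤ R → ∫ s in (0 : ℝ)..R, ‖radialPart σ u s‖ ≤ C * R := by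
  refine ⟨(∫ z, ‖u z‖ ^ 2) + Real.pi, fun R hR => ?_⟩
  have hR0 : 0 < R := by linarith
  have hi := integrable_mul_modeFun_indicator hu (-σ) R
  have h1 : ∫ s in (0 : ℝ)..R, ‖radialPart σ u s‖ = ∫ s in Set.Ioi (0 : ℝ),
      ‖radialPart σ u s * (Set.Iic R).indicator 1 s‖ := by
    have : ∀ s, ‖radialPart σ u s * (Set.Iic R).indicator 1 s‖ =
        (Set.Iic R).indicator (fun s => ‖radialPart σ u s‖) s := fun s => by
      by_cases hs : s ∈ Set.Iic R
      · simp [Set.indicator_of_mem hs]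
      · simp [Set.indicator_of_notMem hs]
    simp_rw [this]
    rw [integral_indicator measurableSet_Iic, Measure.restrict_restrict measurableSet_Iic,
      intervalIntegral.integral_of_le hR0.le, Set.inter_comm, Set.Ioi_inter_Iic]
  rw [h1]
  refine (integral_norm_radialPart_mul_le hi).trans ?_
  have hu2 : Integrable fun z => ‖u z‖ ^ 2 := hu.integrable_norm_pow (by norm_num)
  have hb : Integrable ((Metric.closedBall (0 : ℂ) (√R)).indicator (fun _ => (1 : ℝ))) :=
    (integrable_indicator_iff measurableSet_closedBall).2
      (integrableOn_const (isCompact_closedBall (0 : ℂ) _).measure_lt_top.ne)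
  have hvol : ∫ z, (Metric.closedBall (0 : ℂ) (√R)).indicator (fun _ => (1 : ℝ)) z =
      Real.pi * R := by
    rw [integral_indicator measurableSet_closedBall, setIntegral_const, smul_eq_mul, mul_one,
      measureReal_def, Complex.volume_closedBall, ENNReal.toReal_mul, ENNReal.toReal_pow,
      ENNReal.toReal_ofReal (Real.sqrt_nonneg _), Real.sq_sqrt hR0.le, mul_comm]
    simp
  calc ∫ z, ‖u z * modeFun (-σ) ((Set.Iic R).indicator 1) z‖
      ≤ ∫ z, (R * ‖u z‖ ^ 2 +
          (Metric.closedBall (0 : ℂ) (√R)).indicator (fun _ => (1 : ℝ)) z) := by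
        refine integral_mono hi.norm ((hu2.const_mul R).add hb) fun z => ?_
        simp only
        by_cases hz : z ∈ Metric.closedBall (0 : ℂ) (√R)
        · rw [Set.indicator_of_mem hz]
          have hz' : ‖z‖ ≤ √R := by simpa using hz
          have h2 := norm_modeFun_le (σ := -σ) (by rwa [norm_neg]) ((Set.Iic R).indicator 1) z
          have h3 : ‖(Set.Iic R).indicator (1 : ℝ → ℂ) (z.re ^ 2 + z.im ^ 2)‖ ≤ 1 :=
            (norm_indicator_le_norm_self _ _).trans (by simp)
          have h4 : ‖modeFun (-σ) ((Set.Iic R).indicator 1) z‖ ≤ 2 * √R := by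
            refine h2.trans ?_
            calc _ ≤ 2 * √R * 1 := by gcongr
              _ = _ := mul_one _
          rw [norm_mul]
          have h5 : ‖u z‖ * ‖modeFun (-σ) ((Set.Iic R).indicator 1) z‖ ≤ ‖u z‖ * (2 * √R) := by
            gcongr
          have h6 := Real.sq_sqrt hR0.le
          nlinarith [sq_nonneg (√R * ‖u z‖ - 1)]
        · have hz' : √R < ‖z‖ := by simpa using hz
          rw [Set.indicator_of_notMem hz, modeFun, ← sq_norm_eq,
            Set.indicator_of_notMem (by simpa using Real.lt_sq_of_sqrt_lt hz')]
          simp only [mul_zero, norm_zero, add_zero]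
          positivity
    _ = R * (∫ z, ‖u z‖ ^ 2) + Real.pi * R := by
        rw [integral_add (hu2.const_mul R) hb, integral_const_mul, hvol]
    _ = _ := by ring

/-- The potential minus the energy, as a function of `s = |z|²`. -/
def radialPot (S A : ℝ) (E : ℂ) (s : ℝ) : ℂ := ((if s ≤ S then -A else 0 : ℝ) : ℂ) - E

lemma radialPot_eq_glue (S A : ℝ) (E : ℂ) :
    radialPot S A E = glue S (fun _ => -A - E) (fun _ => -E) := by
  ext s
  rcases le_or_gt s S with h | h
  · rw [glue_of_le _ _ h, radialPot, if_pos h]; push_cast; ring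
  · rw [glue_of_lt _ _ h, radialPot, if_neg h.not_ge]; push_cast; ring

lemma locBdd_radialPot (S A : ℝ) (E : ℂ) : LocBdd (radialPot S A E) := by
  rw [radialPot_eq_glue]
  exact locBdd_glue continuous_const continuousOn_const

lemma intervalIntegrable_radialPot_mul {S A : ℝ} {E : ℂ} {F : ℝ → ℂ} {a b : ℝ}
    (hF : IntervalIntegrable F volume a b) :
    IntervalIntegrable (fun s => radialPot S A E s * F s) volume a b := by
  have hl := locBdd_radialPot S A E
  obtain ⟨C, hC⟩ : ∃ C : ℝ, ∀ s, ‖radialPot S A E s‖ ≤ C := by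
    refine ⟨max ‖((-A : ℝ) : ℂ) - E‖ ‖((0 : ℝ) : ℂ) - E‖, fun s => ?_⟩
    rw [radialPot]
    split_ifs
    · exact le_max_left _ _
    · exact le_max_right _ _
  rw [intervalIntegrable_iff] at hF ⊢
  exact Integrable.bdd_mul (c := C) hF hl.1.aestronglyMeasurable (.of_forall hC)

/-- The radial equation integrated twice from the origin. The weak equation is tested with a profile
whose second derivative is an arbitrary bump `m` on `(0, ∞)`, and both integrations are transferred
to the solution. No integration constants appear because the profiles may be nonzero at the origin:
this is the regularity of the solution there. -/
lemma volterra_radialPart {ρ A : ℝ} (hρ : 0 < ρ) {E : ℂ} {u : ℂ → ℂ} (hu : MemLp u 2 volume)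
    (hs : IsSolution (well ρ A) E u) (σ : ℂ) :
    ∀ᵐ t : ℝ, t ∈ Set.Ioi (0 : ℝ) → 8 * (∫ s in (0 : ℝ)..t, radialPart σ u s) +
      (∫ r in (0 : ℝ)..t, ∫ s in (0 : ℝ)..r, radialPot (ρ ^ 2) A E s * radialPart σ u s) -
      4 * t * radialPart σ u t = 0 := by
  set U := radialPart σ u
  set w := radialPot (ρ ^ 2) A E
  have hU : ∀ a b, IntervalIntegrable U volume a b := intervalIntegrable_radialPart hu σ
  have hwU : ∀ a b, IntervalIntegrable (fun s => w s * U s) volume a b := fun a b =>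
    intervalIntegrable_radialPot_mul (hU a b)
  have hA : Continuous fun t => ∫ s in (0 : ℝ)..t, U s :=
    intervalIntegral.continuous_primitive hU 0
  have hP : Continuous fun t => ∫ s in (0 : ℝ)..t, w s * U s :=
    intervalIntegral.continuous_primitive hwU 0
  have hB : Continuous fun t => ∫ r in (0 : ℝ)..t, ∫ s in (0 : ℝ)..r, w s * U s :=
    intervalIntegral.continuous_primitive (fun a b => hP.intervalIntegrable a b) 0
  have htU : ∀ a b, IntervalIntegrable (fun t : ℝ => 4 * (t : ℂ) * U t) volume a b := fun a b =>
    (hU a b).continuousOn_mul (by fun_prop)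
  have hΦ : ∀ a b, IntervalIntegrable (fun t : ℝ => 8 * (∫ s in (0 : ℝ)..t, U s) +
      (∫ r in (0 : ℝ)..t, ∫ s in (0 : ℝ)..r, w s * U s) - 4 * t * U t) volume a b := fun a b =>
    (((continuous_const.mul hA).add hB).intervalIntegrable a b).sub (htU a b)
  refine isOpen_Ioi.ae_eq_zero_of_integral_contDiff_smul_eq_zero
    ((locallyIntegrable_of_intervalIntegrable hΦ).locallyIntegrableOn _) fun m hm hmc hmt => ?_
  obtain ⟨R, hR0, hR⟩ := hmc.isCompact.isBounded.subset_ball_lt 0 (0 : ℝ)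
  have hmR : ∀ s, R ≤ s → m s = 0 := fun s hs' => image_eq_zero_of_notMem_tsupport fun h => by
    have := hR h
    rw [Real.ball_eq_Ioo] at this
    linarith [this.2]
  have hm0 : ∀ s, s ≤ 0 → m s = 0 := fun s hs' => image_eq_zero_of_notMem_tsupport fun h =>
    absurd (hmt h) (by simpa using hs')
  let k : ℝ → ℂ := fun s => (m s : ℂ)
  have hk : ContDiff ℝ ∞ k := Complex.ofRealCLM.contDiff.comp hm
  have hprim : ∀ F : ℝ → ℂ, ContDiff ℝ ∞ F →
      (∀ s, HasDerivAt (fun s => ∫ t in R..s, F t) (F s) s) ∧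
      ContDiff ℝ ∞ (fun s => ∫ t in R..s, F t) := by
    intro F hF
    have h1 : ∀ s, HasDerivAt (fun s => ∫ t in R..s, F t) (F s) s := fun s =>
      hF.continuous.integral_hasStrictDerivAt R s |>.hasDerivAt
    refine ⟨h1, contDiff_infty_iff_deriv.2 ⟨fun s => (h1 s).differentiableAt, ?_⟩⟩
    rw [funext fun s => (h1 s).deriv]
    exact hF
  obtain ⟨hd1, hc1⟩ := hprim k hk
  obtain ⟨hd0, hc0⟩ := hprim _ hc1
  -- The primitives are based at `R`, beyond the support of `m`, so they vanish on `[R, ∞)`; near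
  -- `0` they are not cut off.
  set M1 : ℝ → ℂ := fun s => ∫ t in R..s, k t
  set M0 : ℝ → ℂ := fun s => ∫ t in R..s, M1 t
  have hM1R : ∀ s, R ≤ s → M1 s = 0 := fun s hs' => by
    refine (intervalIntegral.integral_congr (g := fun _ => 0) fun t ht => ?_).trans (by simp)
    rw [Set.uIcc_of_le hs'] at ht
    simp only [k, hmR t ht.1, Complex.ofReal_zero]
  have hM0R : ∀ s, R ≤ s → M0 s = 0 := fun s hs' => by
    refine (intervalIntegral.integral_congr (g := fun _ => 0) fun t ht => ?_).trans (by simp)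
    rw [Set.uIcc_of_le hs'] at ht
    exact hM1R t ht.1
  have hφ := isTest_modeFun (-σ) hc0 hM0R
  have hweak := hs.2 _ hφ
  let h : ℝ → ℂ := fun s => -(8 * M1 s + 4 * s * k s) + w s * M0 s
  have hh : LocBdd h := by
    have h1 := hc1.continuous
    have h2 := hk.continuous
    exact (Continuous.locBdd (by fun_prop)).add
      ((locBdd_radialPot _ _ _).mul (Continuous.locBdd hc0.continuous))
  have hhR : ∀ s, R ≤ s → h s = 0 := fun s hs' => by
    simp only [h, hM1R s hs', hM0R s hs', k, hmR s hs']; simp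
  have heq : ∀ z, u z * (-(Laplacian.laplacian (modeFun (-σ) M0) z) +
      ((well ρ A z : ℂ) - E) * modeFun (-σ) M0 z) = u z * modeFun (-σ) h z := fun z => by
    rw [laplacian_modeFun (-σ) hφ hd0 hd1]
    simp only [modeFun, h, w, radialPot, well, norm_le_iff hρ]
    push_cast
    ring
  simp_rw [heq] at hweak
  rw [integral_mul_modeFun (integrable_mul_modeFun hu (-σ) hh fun s hs' => hhR s hs'.le)] at hweak
  have htrunc : ∀ F : ℝ → ℂ, (∀ s, R ≤ s → F s = 0) →
      ∫ s in Set.Ioi (0 : ℝ), F s = ∫ s in (0 : ℝ)..R, F s := by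
    intro F hF
    rw [intervalIntegral.integral_of_le hR0.le]
    refine setIntegral_eq_of_subset_of_forall_sdiff_eq_zero measurableSet_Ioi
      (fun x hx => hx.1) fun x hx => hF x ?_
    by_contra hxR
    exact hx.2 ⟨hx.1, (not_le.1 hxR).le⟩
  rw [htrunc _ fun s hs' => by rw [hhR s hs', mul_zero]] at hweak
  have e1 : ∫ s in (0 : ℝ)..R, U s * M1 s = -∫ s in (0 : ℝ)..R, (∫ r in (0 : ℝ)..s, U r) * k s := by
    rw [← integral_triangle hR0.le (hU 0 R) (hk.continuous.intervalIntegrable _ _),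
      ← intervalIntegral.integral_neg]
    congr 1; ext s
    simp only [M1]
    rw [intervalIntegral.integral_symm s R]; ring
  have e2 : ∫ s in (0 : ℝ)..R, (w s * U s) * M0 s =
      ∫ s in (0 : ℝ)..R, (∫ r in (0 : ℝ)..s, ∫ t in (0 : ℝ)..r, w t * U t) * k s := by
    rw [← integral_triangle hR0.le (hP.intervalIntegrable 0 R)
      (hk.continuous.intervalIntegrable _ _)]
    have : ∫ s in (0 : ℝ)..R, (w s * U s) * M0 s =
        -∫ s in (0 : ℝ)..R, (w s * U s) * ∫ t in s..R, M1 t := by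
      rw [← intervalIntegral.integral_neg]
      congr 1; ext s
      simp only [M0]
      rw [intervalIntegral.integral_symm s R]; ring
    rw [this, integral_triangle hR0.le (hwU 0 R) (hc1.continuous.intervalIntegrable _ _),
      ← intervalIntegral.integral_neg]
    congr 1; ext s
    simp only [M1]
    rw [intervalIntegral.integral_symm s R]; ring
  have i1 : IntervalIntegrable (fun s => U s * M1 s) volume 0 R :=
    (hU 0 R).mul_continuousOn hc1.continuous.continuousOn
  have i2 : IntervalIntegrable (fun s => (w s * U s) * M0 s) volume 0 R :=
    (hwU 0 R).mul_continuousOn hc0.continuous.continuousOn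
  have i3 : IntervalIntegrable (fun s : ℝ => (4 * s * U s) * k s) volume 0 R :=
    (htU 0 R).mul_continuousOn hk.continuous.continuousOn
  have e3 : ∫ s in (0 : ℝ)..R, U s * h s = -8 * (∫ s in (0 : ℝ)..R, U s * M1 s) -
      (∫ s in (0 : ℝ)..R, (4 * s * U s) * k s) + ∫ s in (0 : ℝ)..R, (w s * U s) * M0 s := by
    rw [← intervalIntegral.integral_const_mul, ← intervalIntegral.integral_sub (i1.const_mul _) i3,
      ← intervalIntegral.integral_add ((i1.const_mul _).sub i3) i2]
    congr 1; ext s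
    simp only [h]; ring
  have i4 : IntervalIntegrable (fun s => (∫ r in (0 : ℝ)..s, U r) * k s) volume 0 R :=
    (hA.mul hk.continuous).intervalIntegrable _ _
  have i5 : IntervalIntegrable (fun s => (∫ r in (0 : ℝ)..s, ∫ t in (0 : ℝ)..r, w t * U t) * k s)
      volume 0 R := (hB.mul hk.continuous).intervalIntegrable _ _
  rw [← setIntegral_eq_integral_of_forall_compl_eq_zero (s := Set.Ioi 0)
    (fun s hs' => by rw [hm0 s (by simpa using hs'), zero_smul]),
    htrunc _ fun s hs' => by rw [hmR s hs', zero_smul], ← hweak, e3, e1, e2, neg_mul_neg,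
    ← intervalIntegral.integral_const_mul, ← intervalIntegral.integral_sub (i4.const_mul _) i3,
    ← intervalIntegral.integral_add ((i4.const_mul _).sub i3) i5]
  congr 1; ext s
  simp only [k, Complex.real_smul]; ring

/-- Classical solutions `Y`, with derivative `N`, of `4 s Y'' = w Y` on `(0, ∞)`, regular at the
origin and of moderate growth. -/
structure RadialSol (S : ℝ) (w Y N : ℝ → ℂ) : Prop where
  hasDerivAt : ∀ t, 0 < t → HasDerivAt Y (N t) t
  hasDerivAt' : ∀ t, 0 < t → t ≠ S → HasDerivAt N (w t / (4 * t) * Y t) t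
  continuousOn : ContinuousOn N (Set.Ioi 0)
  tendsto : Tendsto (fun t : ℝ => t * N t - Y t) (𝓝[>] 0) (𝓝 0)
  tendsto' : Tendsto (fun t : ℝ => t * Y t) (𝓝[>] 0) (𝓝 0)
  intervalIntegrable : ∀ a b, IntervalIntegrable Y volume a b
  growth : ∃ C : ℝ, ∀ R : ℝ, 1 ≤ R → ∫ s in (0 : ℝ)..R, ‖Y s‖ ≤ C * R

/-- The Volterra equation, divided by `4t`, defines a continuous representative `Y` on `(0, ∞)`;
feeding it back in gives differentiability. Differentiating `4tY` gives `tY' = Y + P/4`, with `P`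
the primitive of `wY`, whence `tY' - Y → 0` at the origin. -/
lemma exists_radialSol {ρ A : ℝ} (hρ : 0 < ρ) {E : ℂ} {u : ℂ → ℂ} (hu : MemLp u 2 volume)
    (hs : IsSolution (well ρ A) E u) {σ : ℂ} (hσ : ‖σ‖ = 1) :
    ∃ Y N : ℝ → ℂ, RadialSol (ρ ^ 2) (radialPot (ρ ^ 2) A E) Y N ∧
      radialPart σ u =ᵐ[volume] Y := by
  set U := radialPart σ u with hUdef
  set w := radialPot (ρ ^ 2) A E with hw
  have hU : ∀ a b, IntervalIntegrable U volume a b := intervalIntegrable_radialPart hu σ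
  have hwU : ∀ a b, IntervalIntegrable (fun s => w s * U s) volume a b := fun a b =>
    intervalIntegrable_radialPot_mul (hU a b)
  set A1 : ℝ → ℂ := fun t => ∫ s in (0 : ℝ)..t, U s with hA1
  set P : ℝ → ℂ := fun t => ∫ s in (0 : ℝ)..t, w s * U s with hP1
  set B : ℝ → ℂ := fun t => ∫ r in (0 : ℝ)..t, P r with hB1
  have hA : Continuous A1 := intervalIntegral.continuous_primitive hU 0
  have hP : Continuous P := intervalIntegral.continuous_primitive hwU 0
  have hB : Continuous B :=
    intervalIntegral.continuous_primitive (fun a b => hP.intervalIntegrable a b) 0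
  have hU0 : ∀ t, t ≤ 0 → U t = 0 := fun t ht => radialPart_of_nonpos σ u ht
  have hint0 : ∀ F : ℝ → ℂ, (∀ t, t ≤ 0 → F t = 0) → ∀ t, t ≤ 0 → ∫ s in (0 : ℝ)..t, F s = 0 :=
    fun F hF t ht => by
      refine (intervalIntegral.integral_congr (g := fun _ => 0) fun s hs' => ?_).trans (by simp)
      rw [Set.uIcc_of_ge ht] at hs'
      exact hF s hs'.2
  have hP0 : ∀ t, t ≤ 0 → P t = 0 := hint0 _ fun t ht => by rw [hU0 t ht, mul_zero]
  set Y : ℝ → ℂ := fun t => (8 * A1 t + B t) / (4 * t) with hY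
  have hUY : U =ᵐ[volume] Y := by
    filter_upwards [volterra_radialPart hρ hu hs σ] with t ht
    rcases le_or_gt t 0 with h | h
    · simp only [hY]
      rw [hU0 t h, hA1, hB1]
      simp only
      rw [hint0 U hU0 t h, hint0 P hP0 t h]
      simp
    · have h' : (t : ℂ) ≠ 0 := by exact_mod_cast h.ne'
      have h2 := ht h
      simp only [hY]
      rw [eq_div_iff (by simp [h'])]
      linear_combination -h2
  have hYi : ∀ a b, IntervalIntegrable Y volume a b := fun a b =>
    (hU a b).congr_ae (ae_restrict_of_ae hUY)
  have hwYi : ∀ a b, IntervalIntegrable (fun s => w s * Y s) volume a b := fun a b =>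
    intervalIntegrable_radialPot_mul (hYi a b)
  have hAY : A1 = fun t => ∫ s in (0 : ℝ)..t, Y s := by
    ext t
    exact intervalIntegral.integral_congr_ae (hUY.mono fun s hs' _ => hs')
  have hPY : P = fun t => ∫ s in (0 : ℝ)..t, w s * Y s := by
    ext t
    exact intervalIntegral.integral_congr_ae (hUY.mono fun s hs' _ => by rw [hs'])
  have hYc : ∀ t, 0 < t → ContinuousAt Y t := fun t ht => by
    have h' : (t : ℂ) ≠ 0 := by exact_mod_cast ht.ne'
    exact (by fun_prop : ContinuousAt (fun t : ℝ => 8 * A1 t + B t) t).div (by fun_prop)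
      (by simp [h'])
  have hwc : ∀ t, t ≠ ρ ^ 2 → ContinuousAt w t := fun t ht => by
    rw [hw, radialPot_eq_glue]
    exact (hasDerivAt_glue_of_ne (f' := fun _ => 0) (g' := fun _ => 0) ht
      (fun _ => hasDerivAt_const _ _) (fun _ => hasDerivAt_const _ _)).continuousAt
  have dA : ∀ t, 0 < t → HasDerivAt A1 (Y t) t := fun t ht => by
    rw [hAY]
    exact intervalIntegral.integral_hasDerivAt_right (hYi 0 t)
      (locallyIntegrable_of_intervalIntegrable hYi).aestronglyMeasurable.stronglyMeasurableAtFilter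
      (hYc t ht)
  have dP : ∀ t, 0 < t → t ≠ ρ ^ 2 → HasDerivAt P (w t * Y t) t := fun t ht ht' => by
    rw [hPY]
    exact intervalIntegral.integral_hasDerivAt_right (hwYi 0 t)
      (locallyIntegrable_of_intervalIntegrable hwYi).aestronglyMeasurable.stronglyMeasurableAtFilter
      ((hwc t ht').mul (hYc t ht))
  have dB : ∀ t, HasDerivAt B (P t) t := fun t =>
    (hP.integral_hasStrictDerivAt 0 t).hasDerivAt
  have dY : ∀ t, 0 < t → HasDerivAt Y ((Y t + P t / 4) / t) t := fun t ht => by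
    have h' : (t : ℂ) ≠ 0 := by exact_mod_cast ht.ne'
    have := (((dA t ht).const_mul 8).add (dB t)).div ((hasDerivAt_ofReal t).const_mul 4)
      (by simp [h'])
    refine this.congr_deriv ?_
    simp only [hY, Pi.add_apply]
    field_simp
    ring
  refine ⟨Y, fun t => (Y t + P t / 4) / t, ⟨dY, fun t ht ht' => ?_, fun t ht => ?_, ?_, ?_, hYi, ?_⟩,
    hUY⟩
  · have h' : (t : ℂ) ≠ 0 := by exact_mod_cast ht.ne'
    have := ((dY t ht).add ((dP t ht ht').div_const 4)).div (hasDerivAt_ofReal t) h'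
    refine this.congr_deriv ?_
    simp only [Pi.add_apply]
    field_simp
    ring
  · have h' : (t : ℂ) ≠ 0 := by exact_mod_cast (Set.mem_Ioi.1 ht).ne'
    have := hYc t ht
    exact (ContinuousAt.div (by fun_prop) (by fun_prop) h').continuousWithinAt
  · have h1 : Tendsto (fun t => P t / 4) (𝓝[>] 0) (𝓝 0) := by
      have h := (hP.tendsto 0).div_const 4
      rw [hP0 0 le_rfl, zero_div] at h
      exact h.mono_left nhdsWithin_le_nhds
    refine h1.congr' ?_
    filter_upwards [self_mem_nhdsWithin] with t ht
    have h' : (t : ℂ) ≠ 0 := by exact_mod_cast (Set.mem_Ioi.1 ht).ne'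
    field_simp
    ring
  · have h1 : Tendsto (fun t => (8 * A1 t + B t) / 4) (𝓝[>] 0) (𝓝 0) := by
      have hc : Continuous fun t => (8 * A1 t + B t) / 4 := by fun_prop
      have h := hc.tendsto 0
      have hA0 : A1 0 = 0 := hint0 U hU0 0 le_rfl
      have hB0 : B 0 = 0 := hint0 P hP0 0 le_rfl
      rw [hA0, hB0] at h
      simp only [mul_zero, add_zero, zero_div] at h
      exact h.mono_left nhdsWithin_le_nhds
    refine h1.congr' ?_
    filter_upwards [self_mem_nhdsWithin] with t ht
    have h' : (t : ℂ) ≠ 0 := by exact_mod_cast (Set.mem_Ioi.1 ht).ne'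
    simp only [hY]
    field_simp
  · obtain ⟨C, hC⟩ := integral_norm_radialPart_le hu hσ
    refine ⟨C, fun R hR => (le_of_eq ?_).trans (hC R hR)⟩
    exact intervalIntegral.integral_congr_ae (hUY.mono fun s hs' _ => by rw [← hs'])

/-! ### Analysis of the radial equation -/

/-- Backward Gronwall: `exp((1 + K)t) (|Y|² + |N|²)` is nondecreasing and vanishes at the right end.
-/
lemma zero_of_zero_data {Y N κ : ℝ → ℂ} {δ S K : ℝ}
    (hY : ∀ t ∈ Set.Ioo δ S, HasDerivAt Y (N t) t)
    (hN : ∀ t ∈ Set.Ioo δ S, HasDerivAt N (κ t * Y t) t)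
    (hYc : ContinuousOn Y (Set.Icc δ S)) (hNc : ContinuousOn N (Set.Icc δ S))
    (hκ : ∀ t ∈ Set.Ioo δ S, ‖κ t‖ ≤ K) (hY0 : Y S = 0) (hN0 : N S = 0) :
    ∀ t ∈ Set.Icc δ S, Y t = 0 ∧ N t = 0 := by
  intro t ht
  let M : ℝ → ℝ := fun t => Real.exp ((1 + K) * t) * (‖Y t‖ ^ 2 + ‖N t‖ ^ 2)
  have hd : ∀ t ∈ Set.Ioo δ S, HasDerivAt M (Real.exp ((1 + K) * t) * (1 + K) *
      (‖Y t‖ ^ 2 + ‖N t‖ ^ 2) + Real.exp ((1 + K) * t) *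
      (2 * inner ℝ (Y t) (N t) + 2 * inner ℝ (N t) (κ t * Y t))) t := fun t ht => by
    have h1 : HasDerivAt (fun t : ℝ => Real.exp ((1 + K) * t))
        (Real.exp ((1 + K) * t) * (1 + K)) t := by
      simpa using ((hasDerivAt_id t).const_mul (1 + K)).exp
    exact h1.mul ((hY t ht).norm_sq.add (hN t ht).norm_sq)
  have hmono : MonotoneOn M (Set.Icc δ S) := by
    refine monotoneOn_of_deriv_nonneg (convex_Icc δ S) ?_ ?_ ?_
    · have := hYc.norm
      have := hNc.norm
      fun_prop
    · rw [interior_Icc]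
      exact fun t ht => (hd t ht).differentiableAt.differentiableWithinAt
    · rw [interior_Icc]
      intro t ht
      rw [(hd t ht).deriv]
      have e1 := abs_le.1 (abs_real_inner_le_norm (Y t) (N t))
      have e2 := abs_le.1 (abs_real_inner_le_norm (N t) (κ t * Y t))
      rw [norm_mul] at e2
      have e3 : ‖N t‖ * (‖κ t‖ * ‖Y t‖) ≤ K * (‖N t‖ * ‖Y t‖) := by
        have := mul_le_mul_of_nonneg_right (hκ t ht) (show 0 ≤ ‖N t‖ * ‖Y t‖ by positivity)
        linarith
      have hK : 0 ≤ K := (norm_nonneg _).trans (hκ t ht)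
      have e4 : 0 ≤ (1 + K) * (‖Y t‖ ^ 2 + ‖N t‖ ^ 2) +
          (2 * inner ℝ (Y t) (N t) + 2 * inner ℝ (N t) (κ t * Y t)) := by
        nlinarith [mul_nonneg hK (sq_nonneg (‖Y t‖ - ‖N t‖)), sq_nonneg (‖Y t‖ - ‖N t‖)]
      have := mul_nonneg (Real.exp_pos ((1 + K) * t)).le e4
      linarith
  have h1 := hmono ht (Set.right_mem_Icc.2 (ht.1.trans ht.2)) ht.2
  simp only [M, hY0, hN0, norm_zero, ne_eq, OfNat.ofNat_ne_zero, not_false_eq_true, zero_pow,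
    add_zero, mul_zero] at h1
  have h2 : ‖Y t‖ ^ 2 + ‖N t‖ ^ 2 ≤ 0 := by
    by_contra! h
    exact absurd h1 (not_le.2 (mul_pos (Real.exp_pos _) h))
  have h3 : ‖Y t‖ ^ 2 = 0 := by nlinarith [sq_nonneg ‖Y t‖, sq_nonneg ‖N t‖]
  have h4 : ‖N t‖ ^ 2 = 0 := by nlinarith [sq_nonneg ‖Y t‖, sq_nonneg ‖N t‖]
  exact ⟨by simpa using h3, by simpa using h4⟩

/-- For `c > 0` the function `|y|²` is convex, with second derivative `2(c|y|²/t + |y'|²)`.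
Vanishing at `S`, it grows at least linearly once it is nonzero; then `|y|` is at least of order
`√t`, and its integral over `[R, 2R]` exceeds `C R` for large `R`. -/
lemma zero_of_moderate_growth {y n : ℝ → ℂ} {S c C : ℝ} (hS : 0 < S) (hc : 0 < c)
    (hy : ∀ t, S < t → HasDerivAt y (n t) t) (hn : ∀ t, S < t → HasDerivAt n (c / t * y t) t)
    (hyc : ContinuousOn y (Set.Ici S)) (hy0 : y S = 0)
    (hC : ∀ R, 1 ≤ R → S ≤ R → ∫ t in R..2 * R, ‖y t‖ ≤ C * R) : ∀ t, S ≤ t → y t = 0 := by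
  by_contra! h
  obtain ⟨t1, ht1, hne⟩ := h
  have hlt : S < t1 := lt_of_le_of_ne ht1 fun h => hne (h ▸ hy0)
  let m : ℝ → ℝ := fun t => ‖y t‖ ^ 2
  have hm : ∀ t, S < t → HasDerivAt m (2 * inner ℝ (y t) (n t)) t := fun t ht =>
    (hy t ht).norm_sq
  have hm2 : ∀ t, S < t → HasDerivAt (fun t => 2 * inner ℝ (y t) (n t))
      (2 * (inner ℝ (y t) (c / t * y t) + inner ℝ (n t) (n t))) t := fun t ht =>
    ((hy t ht).inner ℝ (hn t ht)).const_mul 2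
  have hconv : ConvexOn ℝ (Set.Ici S) m := by
    refine convexOn_of_hasDerivWithinAt2_nonneg (convex_Ici S) (hyc.norm.pow 2)
      (f' := fun t => 2 * inner ℝ (y t) (n t))
      (f'' := fun t => 2 * (inner ℝ (y t) (c / t * y t) + inner ℝ (n t) (n t))) ?_ ?_ ?_
    · rw [interior_Ici]; exact fun t ht => (hm t ht).hasDerivWithinAt
    · rw [interior_Ici]; exact fun t ht => (hm2 t ht).hasDerivWithinAt
    · rw [interior_Ici]
      intro t ht
      have ht0 : 0 < t := hS.trans ht
      have e1 : (c / t : ℂ) * y t = (c / t : ℝ) • y t := by rw [Complex.real_smul]; push_cast; rfl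
      rw [e1, inner_smul_right, real_inner_self_eq_norm_sq, real_inner_self_eq_norm_sq]
      positivity
  set μ := m t1 / (t1 - S) with hμ
  have hμ0 : 0 < μ := div_pos (by have := norm_pos_iff.2 hne; positivity) (by linarith)
  have hlow : ∀ t, t1 ≤ t → μ * (t - S) ≤ m t := by
    intro t ht
    rcases eq_or_lt_of_le ht with rfl | ht
    · rw [hμ, div_mul_cancel₀ _ (by linarith)]
    · have h1 := hconv.secant_mono (a := S) (x := t1) (y := t) (by simp) ht1 (ht1.trans ht.le)
        hlt.ne' (hlt.trans ht).ne' ht.le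
      have hm0 : m S = 0 := by simp [m, hy0]
      rw [hm0, sub_zero, sub_zero, ← hμ, le_div_iff₀ (by linarith)] at h1
      exact h1
  have hC0 : 0 ≤ C := by
    have h1 := hC (max 1 S) (le_max_left _ _) (le_max_right _ _)
    have h2 : (0 : ℝ) < max 1 S := by positivity
    have h3 : 0 ≤ ∫ t in (max 1 S)..2 * (max 1 S), ‖y t‖ :=
      intervalIntegral.integral_nonneg (by linarith) fun _ _ => norm_nonneg _
    by_contra! h
    nlinarith
  -- `R` is past `1`, `2S` and `t1`, and satisfies `C² < μR/2`, so that `|y| ≥ √(μR/2) > C` on `[R,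
  -- 2R]`.
  obtain ⟨R, hR⟩ : ∃ R, R = 1 + 2 * S + t1 + 2 * C ^ 2 / μ := ⟨_, rfl⟩
  have hq : 0 ≤ 2 * C ^ 2 / μ := by positivity
  have hR1 : 1 ≤ R := by linarith
  have hRS : 2 * S ≤ R := by linarith
  have hRt : t1 ≤ R := by linarith
  have hRC : C ^ 2 < μ * (R / 2) := by
    have : 2 * C ^ 2 / μ < R := by linarith
    rw [div_lt_iff₀ hμ0] at this
    linarith
  have hC' : C < √(μ * (R / 2)) := Real.lt_sqrt_of_sq_lt hRC
  have h1 : ∫ _ in R..2 * R, √(μ * (R / 2)) ≤ ∫ t in R..2 * R, ‖y t‖ := by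
    refine intervalIntegral.integral_mono_on (by linarith) (by simp) ?_ fun t ht => ?_
    · refine ContinuousOn.intervalIntegrable (hyc.norm.mono fun t ht => ?_)
      rw [Set.uIcc_of_le (by linarith)] at ht
      exact (show S ≤ R by linarith).trans ht.1
    · refine Real.sqrt_le_iff.2 ⟨norm_nonneg _, le_trans ?_ (hlow t (hRt.trans ht.1))⟩
      have : R / 2 ≤ t - S := by linarith [ht.1]
      gcongr
  rw [intervalIntegral.integral_const, smul_eq_mul] at h1
  have h2 := h1.trans (hC R hR1 (by linarith))
  nlinarith

/-- The Wronskian of `Y` and the regular solution `t bes1(bt)` is constant on `(0, S]`. By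
`mul_bes1'` it equals `(tN - Y) bes1(bt) - tY · b bes1'(bt)`, which tends to `0` at the origin. -/
lemma RadialSol.wronskian {S A : ℝ} {E : ℂ} {Y N : ℝ → ℂ} (hS : 0 < S)
    (h : RadialSol S (radialPot S A E) Y N) :
    N S * (S * bes1 (-(A + E) / 4 * S)) = Y S * bes0 (-(A + E) / 4 * S) := by
  set b : ℂ := -(A + E) / 4 with hb
  let W : ℝ → ℂ := fun t => N t * (t * bes1 (b * t)) - Y t * bes0 (b * t)
  have hYc : ContinuousOn Y (Set.Ioi 0) := fun t ht =>
    (h.hasDerivAt t ht).continuousAt.continuousWithinAt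
  have hWc : ContinuousOn W (Set.Ioi 0) := by
    have h1 := h.continuousOn
    have h2 := continuous_bes1
    have h3 := continuous_bes0
    fun_prop
  have hW : ∀ t, 0 < t → t < S → HasDerivAt W 0 t := by
    intro t ht htS
    have ht' : (t : ℂ) ≠ 0 := by exact_mod_cast ht.ne'
    have h1 := hasDerivAt_comp_mul_ofReal (hasDerivAt_bes1 (b * t))
    have h0 := hasDerivAt_comp_mul_ofReal (hasDerivAt_bes0 (b * t))
    have := ((h.hasDerivAt' t ht htS.ne).mul ((hasDerivAt_ofReal t).mul h1)).sub
      ((h.hasDerivAt t ht).mul h0)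
    refine this.congr_deriv ?_
    have h2 := mul_bes1' (b * t)
    have hw : radialPot S A E t = 4 * b := by
      rw [radialPot, if_pos htS.le, hb]; push_cast; ring
    rw [hw]
    simp only [Pi.mul_apply]
    field_simp
    linear_combination N t * h2
  have hconst : ∀ δ, 0 < δ → δ < S → W δ = W S := by
    intro δ hδ hδS
    refine (constant_of_has_deriv_right_zero (f := fun t => W t) (a := δ) (b := S)
      (hWc.mono fun t ht => hδ.trans_le ht.1)
      (fun t ht => (hW t (hδ.trans_le ht.1) ht.2).hasDerivWithinAt) S ⟨hδS.le, le_rfl⟩).symm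
  have hlim : Tendsto W (𝓝[>] 0) (𝓝 0) := by
    have c1 : Tendsto (fun t : ℝ => bes1 (b * t)) (𝓝[>] 0) (𝓝 (bes1 (b * (0 : ℝ)))) := by
      have : Continuous fun t : ℝ => bes1 (b * t) := by
        have := continuous_bes1; fun_prop
      exact (this.tendsto 0).mono_left nhdsWithin_le_nhds
    have c2 : Tendsto (fun t : ℝ => b * bes1' (b * t)) (𝓝[>] 0) (𝓝 (b * bes1' (b * (0 : ℝ)))) := by
      have : Continuous fun t : ℝ => b * bes1' (b * t) := by
        have := continuous_bes1'; fun_prop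
      exact (this.tendsto 0).mono_left nhdsWithin_le_nhds
    have := (h.tendsto.mul c1).sub (h.tendsto'.mul c2)
    simp only [zero_mul, sub_zero] at this
    refine this.congr fun t => ?_
    have h2 := mul_bes1' (b * t)
    simp only [W]
    linear_combination -Y t * h2
  have hWS : W S = 0 := by
    refine tendsto_nhds_unique (tendsto_const_nhds.congr' ?_) hlim
    filter_upwards [Ioo_mem_nhdsGT hS] with t ht using (hconst t ht.1 ht.2).symm
  exact sub_eq_zero.1 hWS

lemma hasDerivAt_decSol_scaled {c t : ℝ} (hc : 0 < c) (ht : 0 < t) :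
    HasDerivAt (fun t => (decSol (c * t) : ℂ)) (c * decSol' (c * t) : ℝ) t := by
  have h1 : HasDerivAt (fun t : ℝ => c * t) c t := by simpa using (hasDerivAt_id t).const_mul c
  have h2 := (hasDerivAt_decSol (mul_pos hc ht)).comp t h1
  rw [mul_comm] at h2
  exact h2.ofReal_comp

lemma hasDerivAt_decSol'_scaled {c t : ℝ} (hc : 0 < c) (ht : 0 < t) :
    HasDerivAt (fun t => ((c * decSol' (c * t) : ℝ) : ℂ)) (c / t * decSol (c * t)) t := by
  have h1 : HasDerivAt (fun t : ℝ => c * t) c t := by simpa using (hasDerivAt_id t).const_mul c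
  have h2 := (((hasDerivAt_decSol' (mul_pos hc ht)).comp t h1).const_mul c).ofReal_comp
  refine h2.congr_deriv ?_
  have ht' : (t : ℂ) ≠ 0 := by exact_mod_cast ht.ne'
  have hc' : (c : ℂ) ≠ 0 := by exact_mod_cast hc.ne'
  push_cast
  field_simp

lemma RadialSol.integral_le {S : ℝ} {w Y N : ℝ → ℂ} (h : RadialSol S w Y N) :
    ∃ C : ℝ, ∀ R, 1 ≤ R → ∫ t in R..2 * R, ‖Y t‖ ≤ C * R := by
  obtain ⟨C, hC⟩ := h.growth
  refine ⟨2 * C, fun R hR => ?_⟩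
  have h1 := hC (2 * R) (by linarith)
  rw [← intervalIntegral.integral_add_adjacent_intervals (h.intervalIntegrable 0 R).norm
    (h.intervalIntegrable R (2 * R)).norm] at h1
  have h2 : 0 ≤ ∫ t in (0 : ℝ)..R, ‖Y t‖ :=
    intervalIntegral.integral_nonneg (by linarith) fun _ _ => norm_nonneg _
  linarith

/-- `decSol` is bounded by `1`, so the combination inherits the moderate growth and solves the same
exterior equation; vanishing at `S`, it vanishes beyond. -/
lemma RadialSol.exterior {S A c : ℝ} {Y N : ℝ → ℂ} (hS : 0 < S) (hc : 0 < c)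
    (h : RadialSol S (radialPot S A (-4 * c)) Y N) (α β : ℂ)
    (h0 : α * Y S - β * decSol (c * S) = 0) :
    ∀ t, S < t → α * Y t - β * decSol (c * t) = 0 ∧
      α * N t - β * (c * decSol' (c * t) : ℝ) = 0 := by
  obtain ⟨C, hC⟩ := h.integral_le
  have dy : ∀ t, 0 < t → HasDerivAt (fun t => α * Y t - β * decSol (c * t))
      (α * N t - β * (c * decSol' (c * t) : ℝ)) t := fun t ht =>
    ((h.hasDerivAt t ht).const_mul α).sub ((hasDerivAt_decSol_scaled hc ht).const_mul β)
  have hyc : ContinuousOn (fun t => α * Y t - β * decSol (c * t)) (Set.Ici S) := fun t ht =>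
    (dy t (hS.trans_le ht)).continuousAt.continuousWithinAt
  have key := zero_of_moderate_growth (y := fun t => α * Y t - β * decSol (c * t))
    (n := fun t => α * N t - β * (c * decSol' (c * t) : ℝ)) (C := ‖α‖ * C + ‖β‖) hS hc
    (fun t ht => dy t (hS.trans ht)) (fun t ht => ?_) hyc h0 (fun R hR hRS => ?_)
  · intro t ht
    refine ⟨key t ht.le, ?_⟩
    have e : (fun t => α * Y t - β * decSol (c * t)) =ᶠ[𝓝 t] fun _ => 0 := by
      filter_upwards [Ioi_mem_nhds ht] with s hs using key s (le_of_lt hs)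
    exact (dy t (hS.trans ht)).unique ((hasDerivAt_const t 0).congr_of_eventuallyEq e)
  · have ht0 := hS.trans ht
    refine (((h.hasDerivAt' t ht0 ht.ne').const_mul α).sub
      ((hasDerivAt_decSol'_scaled hc ht0).const_mul β)).congr_deriv ?_
    rw [radialPot, if_neg ht.not_ge]
    have ht' : (t : ℂ) ≠ 0 := by exact_mod_cast ht0.ne'
    push_cast
    field_simp
    ring
  · have i1 : IntervalIntegrable (fun t => ‖Y t‖) volume R (2 * R) :=
      (h.intervalIntegrable _ _).norm
    have h1 : ∫ t in R..2 * R, ‖α * Y t - β * decSol (c * t)‖ ≤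
        ∫ t in R..2 * R, (‖α‖ * ‖Y t‖ + ‖β‖) := by
      refine intervalIntegral.integral_mono_on (by linarith) ?_
        ((i1.const_mul _).add (by simp)) fun t ht => ?_
      · refine ContinuousOn.intervalIntegrable (hyc.norm.mono fun t ht => ?_)
        rw [Set.uIcc_of_le (by linarith)] at ht
        exact hRS.trans ht.1
      · have ht0 : 0 < t := by linarith [ht.1]
        refine (norm_sub_le _ _).trans ?_
        rw [norm_mul, norm_mul, Complex.norm_real, Real.norm_eq_abs,
          abs_of_nonneg (decSol_nonneg _)]
        have := decSol_le_one (mul_pos hc ht0).le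
        have : ‖β‖ * decSol (c * t) ≤ ‖β‖ * 1 := by gcongr
        linarith
    refine h1.trans ?_
    rw [intervalIntegral.integral_add (i1.const_mul _) (by simp),
      intervalIntegral.integral_const_mul, intervalIntegral.integral_const, smul_eq_mul]
    have := mul_le_mul_of_nonneg_left (hC R hR) (norm_nonneg α)
    linarith

/-- Inside, the data `(Y, N)` at `S` are proportional to those of the regular solution; outside, to
those of the decaying one. They do not both vanish, since otherwise `Y` would vanish on both sides,
so the two pairs of data are proportional to each other. -/
theorem RadialSol.matching {S A c : ℝ} {Y N : ℝ → ℂ} (hS : 0 < S) (hc : 0 < c)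
    (h : RadialSol S (radialPot S A (-4 * c)) Y N) (hne : ∃ t, 0 < t ∧ Y t ≠ 0) :
    (decSol (c * S) : ℂ) * bes0 ((c - A / 4) * S) =
      S * (c * decSol' (c * S) : ℝ) * bes1 ((c - A / 4) * S) := by
  have hw := h.wronskian hS
  rw [show -((A : ℂ) + -4 * c) / 4 = c - A / 4 by ring] at hw
  have hYc : ContinuousOn Y (Set.Ioi 0) := fun t ht =>
    (h.hasDerivAt t ht).continuousAt.continuousWithinAt
  have hext : ∀ α β : ℂ, α * Y S - β * decSol (c * S) = 0 →
      α * N S - β * (c * decSol' (c * S) : ℝ) = 0 := by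
    intro α β h0
    have h1 := h.exterior hS hc α β h0
    have hcont : ContinuousWithinAt (fun t => α * N t - β * (c * decSol' (c * t) : ℝ))
        (Set.Ioi S) S := by
      have e1 : ContinuousAt N S := h.continuousOn.continuousAt (Ioi_mem_nhds hS)
      have e2 := (hasDerivAt_decSol'_scaled hc hS).continuousAt
      exact ((continuousAt_const.mul e1).sub (continuousAt_const.mul e2)).continuousWithinAt
    refine tendsto_nhds_unique hcont.tendsto (tendsto_const_nhds.congr' ?_)
    filter_upwards [self_mem_nhdsWithin] with t ht using (h1 t ht).2.symm
  have h1 := hext (decSol (c * S)) (Y S) (by ring)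
  by_cases h0 : Y S = 0 ∧ N S = 0
  · exfalso
    obtain ⟨t, ht, hYt⟩ := hne
    rcases le_or_gt t S with hle | hlt
    · refine hYt (zero_of_zero_data (K := ‖(-A + 4 * c : ℂ)‖ / (4 * t)) (κ := fun s =>
        radialPot S A (-4 * c) s / (4 * s))
        (fun s hs => h.hasDerivAt s (ht.trans hs.1))
        (fun s hs => h.hasDerivAt' s (ht.trans hs.1) hs.2.ne)
        (hYc.mono fun s hs => ht.trans_le hs.1) (h.continuousOn.mono fun s hs => ht.trans_le hs.1)
        (fun s hs => ?_) h0.1 h0.2 t ⟨le_rfl, hle⟩).1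
      have hs0 := ht.trans hs.1
      rw [radialPot, if_pos hs.2.le, norm_div, norm_mul, Complex.norm_real, Real.norm_eq_abs,
        abs_of_pos hs0, Complex.norm_ofNat]
      have e : (((-A : ℝ) : ℂ) - -4 * c) = -A + 4 * c := by push_cast; ring
      rw [e]
      have := hs.1.le
      gcongr
    · have := (h.exterior hS hc 1 0 (by rw [h0.1]; ring) t hlt).1
      exact hYt (by simpa using this)
  -- The defect of the matching condition is annihilated by both `Y S` and `N S`, one of which is
  -- nonzero.
  · have e1 : Y S * ((decSol (c * S) : ℂ) * bes0 ((c - A / 4) * S) -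
        S * (c * decSol' (c * S) : ℝ) * bes1 ((c - A / 4) * S)) = 0 := by
      linear_combination -(decSol (c * S) : ℂ) * hw + S * bes1 ((c - A / 4) * S) * h1
    have e2 : N S * ((decSol (c * S) : ℂ) * bes0 ((c - A / 4) * S) -
        S * (c * decSol' (c * S) : ℝ) * bes1 ((c - A / 4) * S)) = 0 := by
      linear_combination -((c * decSol' (c * S) : ℝ) : ℂ) * hw + bes0 ((c - A / 4) * S) * h1
    rcases not_and_or.1 h0 with h2 | h2
    · exact sub_eq_zero.1 ((mul_eq_zero.1 e1).resolve_left h2)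
    · exact sub_eq_zero.1 ((mul_eq_zero.1 e2).resolve_left h2)

/-! ### A mode with vanishing radial part vanishes -/

/-- Rotation by the angle `t`. -/
def rot (t : ℝ) : ℂ := Complex.exp (t * Complex.I)

lemma norm_rot (t : ℝ) : ‖rot t‖ = 1 := Complex.norm_exp_ofReal_mul_I t

lemma rot_ne_zero (t : ℝ) : rot t ≠ 0 := Complex.exp_ne_zero _

lemma rot_add (s t : ℝ) : rot (s + t) = rot s * rot t := by
  rw [rot, rot, rot, ← Complex.exp_add]; push_cast; ring_nf

lemma hasDerivAt_rot (t : ℝ) : HasDerivAt rot (rot t * Complex.I) t := by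
  have h := ((hasDerivAt_ofReal t).mul_const Complex.I).cexp
  rw [one_mul] at h
  exact h

lemma continuous_rot : Continuous rot :=
  continuous_iff_continuousAt.2 fun t => (hasDerivAt_rot t).continuousAt

lemma rot_two_pi : rot (2 * Real.pi) = 1 := by
  rw [rot]; push_cast; exact Complex.exp_two_pi_mul_I

lemma hasDerivAt_rot_zpow (l : ℤ) (t : ℝ) :
    HasDerivAt (fun t => rot t ^ l) (l * Complex.I * rot t ^ l) t := by
  have h := (hasDerivAt_zpow l (rot t) (Or.inl (rot_ne_zero t))).comp t (hasDerivAt_rot t)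
  refine h.congr_deriv ?_
  rw [zpow_sub_one₀ (rot_ne_zero t)]
  field_simp [rot_ne_zero t]

lemma IsTest.comp_rot {φ : ℂ → ℂ} (hφ : IsTest φ) (t : ℝ) : IsTest (fun z => φ (rot t * z)) :=
  ⟨hφ.1.comp (contDiff_const.mul contDiff_id),
    hφ.2.comp_homeomorph (Homeomorph.mulLeft₀ (rot t) (rot_ne_zero t))⟩

/-- The `t`-derivative of the left side is the weak mode equation tested with the rotated function,
hence zero; at `t = 0` the two sides agree. -/
lemma IsMode.integral_rot_const {l : ℤ} {u : ℂ → ℂ} (hu : MemLp u 2 volume) (hm : IsMode l u)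
    {φ : ℂ → ℂ} (hφ : IsTest φ) (t : ℝ) :
    ∫ z, u z * (φ (rot t * z) * rot t ^ l) = ∫ z, u z * φ z := by
  obtain ⟨R, hR0, hR⟩ := hφ.2.isCompact.isBounded.subset_ball_lt 0 (0 : ℂ)
  have hout : ∀ z, R < ‖z‖ → z ∉ tsupport φ := fun z hz h => by
    have := hR h; simp at this; linarith
  have hc1 : Continuous (fderiv ℝ φ) := (hφ.1.fderiv_right (m := ∞) (by simp)).continuous
  obtain ⟨C1, hC1⟩ := (hφ.2.fderiv (𝕜 := ℝ)).exists_bound_of_continuous hc1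
  obtain ⟨C0, hC0⟩ := hφ.2.exists_bound_of_continuous hφ.1.continuous
  have hC1' : 0 ≤ C1 := (norm_nonneg _).trans (hC1 0)
  have hC0' : 0 ≤ C0 := (norm_nonneg _).trans (hC0 0)
  set K : ℝ := C1 * R + C0 * ‖(l : ℂ)‖ with hK
  have hK0 : 0 ≤ K := by positivity
  let F' : ℝ → ℂ → ℂ := fun t z => fderiv ℝ φ (rot t * z) (rot t * Complex.I * z) * rot t ^ l +
    φ (rot t * z) * (l * Complex.I * rot t ^ l)
  have hind : LocBdd ((Metric.closedBall (0 : ℂ) R).indicator fun _ => (K : ℂ)) :=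
    ⟨measurable_const.indicator measurableSet_closedBall, fun _ => ⟨‖(K : ℂ)‖, fun x _ =>
      norm_indicator_le_norm_self _ _⟩⟩
  have hbound := (hind.integrable_memLp_mul hu (R := R) fun z hz =>
    Set.indicator_of_notMem (by simpa using hz) _).norm
  have hloc : ∀ t, LocBdd fun z => φ (rot t * z) * rot t ^ l := fun t =>
    Continuous.locBdd ((hφ.comp_rot t).1.continuous.mul continuous_const)
  have hd : ∀ t, HasDerivAt (fun t => ∫ z, u z * (φ (rot t * z) * rot t ^ l))
      (∫ z, u z * F' t z) t := by
    intro t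
    refine (hasDerivAt_integral_of_dominated_loc_of_deriv_le
      (F := fun t z => u z * (φ (rot t * z) * rot t ^ l)) (F' := fun t z => u z * F' t z)
      (bound := fun z => ‖u z * (Metric.closedBall (0 : ℂ) R).indicator (fun _ => (K : ℂ)) z‖)
      univ_mem (.of_forall fun t => hu.1.mul (hloc t).1.aestronglyMeasurable) ?_ ?_ ?_ hbound
      ?_).2
    · refine (hloc t).integrable_memLp_mul hu (R := R) fun z hz => ?_
      rw [image_eq_zero_of_notMem_tsupport (hout _ (by rwa [norm_mul, norm_rot, one_mul])),
        zero_mul]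
    · refine hu.1.mul (Continuous.aestronglyMeasurable ?_)
      have := hφ.1.continuous
      fun_prop
    · refine .of_forall fun z t _ => ?_
      rw [norm_mul, norm_mul]
      refine mul_le_mul_of_nonneg_left ?_ (norm_nonneg _)
      have hnz : ‖rot t * z‖ = ‖z‖ := by rw [norm_mul, norm_rot, one_mul]
      by_cases hz : z ∈ Metric.closedBall (0 : ℂ) R
      · rw [Set.indicator_of_mem hz, Complex.norm_real, Real.norm_eq_abs, abs_of_nonneg hK0, hK]
        have hz' : ‖z‖ ≤ R := by simpa using hz
        refine (norm_add_le _ _).trans (add_le_add ?_ ?_)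
        · rw [norm_mul, norm_zpow, norm_rot, one_zpow, mul_one]
          refine (ContinuousLinearMap.le_opNorm _ _).trans ?_
          have h1 := hC1 (rot t * z)
          have h2 : ‖rot t * Complex.I * z‖ ≤ R := by
            rw [norm_mul, norm_mul, norm_rot, Complex.norm_I]; simpa using hz'
          exact mul_le_mul h1 h2 (norm_nonneg _) hC1'
        · rw [norm_mul, norm_mul, norm_mul, norm_zpow, norm_rot, Complex.norm_I, one_zpow, mul_one,
            mul_one]
          exact mul_le_mul_of_nonneg_right (hC0 _) (norm_nonneg _)
      · have hz' : R < ‖rot t * z‖ := by rw [hnz]; simpa using hz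
        have h1 : φ (rot t * z) = 0 := image_eq_zero_of_notMem_tsupport (hout _ hz')
        have h2 : fderiv ℝ φ (rot t * z) = 0 := image_eq_zero_of_notMem_tsupport fun h =>
          hout _ hz' (tsupport_fderiv_subset ℝ h)
        simp [F', h1, h2]
    · refine .of_forall fun z t _ => ?_
      have h1 := (hφ.differentiable (rot t * z)).hasFDerivAt.comp_hasDerivAt t
        ((hasDerivAt_rot t).mul_const z)
      exact (h1.mul (hasDerivAt_rot_zpow l t)).const_mul (u z)
  have hzero : ∀ t, ∫ z, u z * F' t z = 0 := by
    intro t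
    have h1 := hm _ (hφ.comp_rot t)
    have hfd : ∀ z, fderiv ℝ (fun z => φ (rot t * z)) z (Complex.I * z) =
        fderiv ℝ φ (rot t * z) (rot t * Complex.I * z) := by
      intro z
      have h2 : HasFDerivAt (fun z : ℂ => rot t * z) (ContinuousLinearMap.mul ℝ ℂ (rot t)) z :=
        (ContinuousLinearMap.mul ℝ ℂ (rot t)).hasFDerivAt
      have h3 := (hφ.differentiable (rot t * z)).hasFDerivAt.comp z h2
      have h4 : fderiv ℝ (fun z => φ (rot t * z)) z = _ := h3.fderiv
      rw [h4]
      simp [mul_assoc]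
    have i1 : Integrable fun z => u z * fderiv ℝ φ (rot t * z) (rot t * Complex.I * z) := by
      have hc : Continuous fun z => fderiv ℝ φ (rot t * z) (rot t * Complex.I * z) := by fun_prop
      refine (Continuous.locBdd hc).integrable_memLp_mul hu (R := R) fun z hz => ?_
      have h2 : fderiv ℝ φ (rot t * z) = 0 := image_eq_zero_of_notMem_tsupport fun h =>
        hout (rot t * z) (by rwa [norm_mul, norm_rot, one_mul]) (tsupport_fderiv_subset ℝ h)
      simp [h2]
    have i2 : Integrable fun z => u z * φ (rot t * z) := by
      refine (Continuous.locBdd (hφ.comp_rot t).1.continuous).integrable_memLp_mul hu (R := R)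
        fun z hz => ?_
      exact image_eq_zero_of_notMem_tsupport (hout _ (by rwa [norm_mul, norm_rot, one_mul]))
    simp_rw [hfd] at h1
    have h2 : ∫ z, u z * F' t z = rot t ^ l *
        ((∫ z, u z * fderiv ℝ φ (rot t * z) (rot t * Complex.I * z)) +
          Complex.I * l * ∫ z, u z * φ (rot t * z)) := by
      rw [← integral_const_mul, ← integral_add i1 (i2.const_mul _), ← integral_const_mul]
      congr 1; ext z
      simp only [F']; ring
    rw [h2, h1]; ring
  have hconst := is_const_of_deriv_eq_zero (fun t => (hd t).differentiableAt)
    (fun t => by rw [(hd t).deriv, hzero t]) t 0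
  have h0 : rot 0 = 1 := by simp [rot]
  simpa [h0] using hconst

/-- The angular component of a test function. -/
def angular (l : ℤ) (φ : ℂ → ℂ) (z : ℂ) : ℂ :=
  ∫ t in (-Real.pi)..Real.pi, φ (rot t * z) * rot t ^ l

lemma angular_rot_mul {l : ℤ} (φ : ℂ → ℂ) (s : ℝ) (z : ℂ) :
    angular l φ (rot s * z) = (rot s ^ l)⁻¹ * angular l φ z := by
  let f : ℝ → ℂ := fun t => φ (rot t * z) * rot t ^ l
  have hper : Function.Periodic f (2 * Real.pi) := fun t => by
    simp only [f, rot_add, rot_two_pi, mul_one]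
  have h1 : angular l φ (rot s * z) = (rot s ^ l)⁻¹ * ∫ t in (-Real.pi)..Real.pi, f (t + s) := by
    rw [angular, ← intervalIntegral.integral_const_mul]
    congr 1; ext t
    simp only [f, rot_add, mul_zpow]
    have := zpow_ne_zero l (rot_ne_zero s)
    field_simp
  rw [h1, intervalIntegral.integral_comp_add_right]
  have h2 := hper.intervalIntegral_add_eq (-Real.pi + s) (-Real.pi)
  rw [show -Real.pi + s + 2 * Real.pi = Real.pi + s by ring,
    show -Real.pi + 2 * Real.pi = Real.pi by ring] at h2
  rw [h2, angular]

/-- The angular average is determined by its values on the positive axis, by equivariance under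
rotations; the remaining phase times `|z|` is `x ∓ i y`. -/
lemma angular_eq_modeFun {l : ℤ} (hl : l = 1 ∨ l = -1) (φ : ℂ → ℂ) {z : ℂ} (hz : z ≠ 0) :
    angular l φ z = modeFun (-(l : ℂ)) (fun s => angular l φ (√s : ℝ) / (√s : ℝ)) z := by
  have hn : (‖z‖ : ℂ) ≠ 0 := by exact_mod_cast norm_ne_zero_iff.2 hz
  have h1 : z = rot z.arg * ‖z‖ := by
    rw [rot, mul_comm]; exact (Complex.norm_mul_exp_arg_mul_I z).symm
  have h2 : angular l φ z = (rot z.arg ^ l)⁻¹ * angular l φ ‖z‖ := by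
    conv_lhs => rw [h1]
    exact angular_rot_mul φ _ _
  rw [modeFun, ← sq_norm_eq, Real.sqrt_sq (norm_nonneg z), h2]
  have h3 : (rot z.arg ^ l)⁻¹ * ‖z‖ = z.re + -(l : ℂ) * z.im * Complex.I := by
    have h4 : rot z.arg = z / ‖z‖ := by rw [eq_div_iff hn]; exact h1.symm
    rw [h4]
    rcases hl with rfl | rfl
    · have h5 : (‖z‖ : ℂ) ^ 2 = (z.re - z.im * Complex.I) * z := by
        have h6 : ((‖z‖ : ℂ)) ^ 2 = z.re ^ 2 + z.im ^ 2 := by exact_mod_cast sq_norm_eq z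
        rw [h6]
        linear_combination (z.im : ℂ) ^ 2 * Complex.I_sq +
          (z.re - z.im * Complex.I) * Complex.re_add_im z
      rw [zpow_one]
      push_cast
      field_simp
      linear_combination h5
    · rw [zpow_neg_one, inv_inv, div_mul_cancel₀ _ hn]
      push_cast
      linear_combination -Complex.re_add_im z
  rw [← h3]
  field_simp

/-- By rotation invariance, the pairing of `u` with a test function is, up to the factor `2π`, its
pairing with the angular average. The latter depends only on the radial part of `u`. -/
theorem IsMode.ae_eq_zero {l : ℤ} (hl : l = 1 ∨ l = -1) {u : ℂ → ℂ} (hu : MemLp u 2 volume)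
    (hm : IsMode l u) (h0 : radialPart (l : ℂ) u =ᵐ[volume] 0) : u =ᵐ[volume] 0 := by
  refine ae_eq_zero_of_integral_contDiff_smul_eq_zero
    (hu.locallyIntegrable (by norm_num)) fun g hg hgc => ?_
  let φ : ℂ → ℂ := fun z => (g z : ℂ)
  have hφ : IsTest φ := ⟨Complex.ofRealCLM.contDiff.comp hg, hgc.comp_left Complex.ofReal_zero⟩
  have hφc := hφ.1.continuous
  have hrot := continuous_rot
  obtain ⟨R, hR0, hR⟩ := hφ.2.isCompact.isBounded.subset_ball_lt 0 (0 : ℂ)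
  have hout : ∀ z, R < ‖z‖ → φ z = 0 := fun z hz => image_eq_zero_of_notMem_tsupport fun h => by
    have := hR h; simp at this; linarith
  have hzp : Continuous fun t => rot t ^ l :=
    continuous_iff_continuousAt.2 fun t => (hasDerivAt_rot_zpow l t).continuousAt
  obtain ⟨C0, hC0⟩ := hφ.2.exists_bound_of_continuous hφc
  have hpi : -Real.pi ≤ Real.pi := by linarith [Real.pi_pos]
  set μ := volume.restrict (Set.Ioc (-Real.pi) Real.pi) with hμ
  have hC0' : 0 ≤ C0 := (norm_nonneg _).trans (hC0 0)
  have hind : LocBdd ((Metric.closedBall (0 : ℂ) R).indicator fun _ => (C0 : ℂ)) :=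
    ⟨measurable_const.indicator measurableSet_closedBall, fun _ => ⟨‖(C0 : ℂ)‖, fun x _ =>
      norm_indicator_le_norm_self _ _⟩⟩
  have hbound := (hind.integrable_memLp_mul hu (R := R) fun z hz =>
    Set.indicator_of_notMem (by simpa using hz) _).norm
  have hint : Integrable (fun p : ℝ × ℂ => u p.2 * (φ (rot p.1 * p.2) * rot p.1 ^ l))
      (μ.prod volume) := by
    refine Integrable.mono' (g := fun p : ℝ × ℂ => 1 * ‖u p.2 *
      (Metric.closedBall (0 : ℂ) R).indicator (fun _ => (C0 : ℂ)) p.2‖)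
      ((integrable_const (1 : ℝ)).mul_prod hbound) ?_ (.of_forall fun p => ?_)
    · refine hu.1.comp_snd.mul (Continuous.aestronglyMeasurable ?_)
      have : Continuous fun p : ℝ × ℂ => rot p.1 ^ l := hzp.comp continuous_fst
      fun_prop
    · rw [one_mul, norm_mul, norm_mul, norm_mul, norm_zpow, norm_rot, one_zpow, mul_one]
      refine mul_le_mul_of_nonneg_left ?_ (norm_nonneg _)
      by_cases hz : p.2 ∈ Metric.closedBall (0 : ℂ) R
      · rw [Set.indicator_of_mem hz]
        refine (hC0 _).trans ?_
        rw [Complex.norm_real]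
        exact le_abs_self C0
      · rw [hout _ (by rw [norm_mul, norm_rot, one_mul]; simpa using hz), norm_zero]
        exact norm_nonneg _
  have hswap := integral_integral_swap (μ := μ) (ν := (volume : Measure ℂ))
    (f := fun t z => u z * (φ (rot t * z) * rot t ^ l)) hint
  have hang : ∀ z, ∫ t, u z * (φ (rot t * z) * rot t ^ l) ∂μ = u z * angular l φ z := fun z => by
    rw [integral_const_mul, angular, intervalIntegral.integral_of_le hpi]
  simp_rw [hm.integral_rot_const hu hφ, hang] at hswap
  have hi2 : Integrable fun z => u z * angular l φ z := by
    refine hint.integral_prod_right.congr (.of_forall hang)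
  have hae : (fun z => u z * angular l φ z) =ᵐ[volume] fun z => u z *
      modeFun (-(l : ℂ)) (fun s => angular l φ (√s : ℝ) / (√s : ℝ)) z := by
    have : ∀ᵐ z : ℂ, z ≠ 0 := by simp [ae_iff]
    filter_upwards [this] with z hz
    rw [angular_eq_modeFun hl φ hz]
  rw [integral_congr_ae hae, integral_mul_modeFun (hi2.congr hae)] at hswap
  have hz : ∫ s in Set.Ioi (0 : ℝ), radialPart (l : ℂ) u s *
      (angular l φ (√s : ℝ) / (√s : ℝ)) = 0 := by
    refine integral_eq_zero_of_ae (ae_restrict_of_ae ?_)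
    filter_upwards [h0] with s hs
    rw [hs]; simp
  rw [hz, integral_const, smul_eq_zero] at hswap
  have hμr : μ.real Set.univ ≠ 0 := by
    rw [hμ, measureReal_restrict_apply_univ, Real.volume_real_Ioc_of_le hpi]
    linarith [Real.pi_pos]
  have := hswap.resolve_left hμr
  rw [← this]
  congr 1; ext z
  simp only [φ, Complex.real_smul]; ring

/-! ### The matching condition of an eigenfunction -/

theorem IsEigenfunction.matching {ρ A E : ℝ} (hρ : 0 < ρ) (hE : E < 0) {l : ℤ}
    (hl : l = 1 ∨ l = -1) {ψ : ℂ → ℂ} (hψ : IsEigenfunction (well ρ A) (E : ℂ) ψ)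
    (hm : IsMode l ψ) {c : ℝ} (hc : E = -4 * c) :
    (decSol (c * ρ ^ 2) : ℂ) * bes0 ((c - A / 4) * (ρ ^ 2 : ℝ)) =
      (ρ ^ 2 : ℝ) * (c * decSol' (c * ρ ^ 2) : ℝ) * bes1 ((c - A / 4) * (ρ ^ 2 : ℝ)) := by
  obtain ⟨hu, hne, hs⟩ := hψ
  have hE' : (E : ℂ) = -4 * c := by rw [hc]; push_cast; ring
  rw [hE'] at hs
  have hσ : ‖(l : ℂ)‖ = 1 := by rcases hl with rfl | rfl <;> simp
  obtain ⟨Y, N, h, hUY⟩ := exists_radialSol hρ hu hs hσ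
  refine h.matching (by positivity) (by linarith) ?_
  by_contra! h0
  refine hne (hm.ae_eq_zero hl hu ?_)
  filter_upwards [hUY] with t ht
  rcases le_or_gt t 0 with h1 | h1
  · exact radialPart_of_nonpos _ _ h1
  · rw [ht, h0 t h1]; rfl

/-- If both vanished, `y(t) = t bes1(xt)`, which solves `y'' = (x/t) y` with `y' = bes0(xt)`, would
have zero Cauchy data at `t = 1`. Then `bes0(xt)` would vanish on `(0, 1]`, against `bes0 0 = 1`. -/
lemma bes1_ne_zero {x : ℝ} (h0 : bes0 x = 0) : bes1 x ≠ 0 := by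
  intro h1
  have hY : ∀ t : ℝ, 0 < t → HasDerivAt (fun t : ℝ => (t : ℂ) * bes1 ((x : ℂ) * t))
      (bes0 ((x : ℂ) * t)) t := fun t _ => by
    refine ((hasDerivAt_ofReal t).mul
      (hasDerivAt_comp_mul_ofReal (hasDerivAt_bes1 ((x : ℂ) * t)))).congr_deriv ?_
    linear_combination mul_bes1' ((x : ℂ) * t)
  have hN : ∀ t : ℝ, 0 < t → HasDerivAt (fun t : ℝ => bes0 ((x : ℂ) * t))
      ((x / t : ℂ) * (t * bes1 ((x : ℂ) * t))) t := fun t ht => by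
    refine (hasDerivAt_comp_mul_ofReal (hasDerivAt_bes0 ((x : ℂ) * t))).congr_deriv ?_
    have : (t : ℂ) ≠ 0 := by exact_mod_cast ht.ne'
    field_simp
  have key : ∀ t ∈ Set.Ioc (0 : ℝ) 1, bes0 ((x : ℂ) * t) = 0 := by
    intro t ht
    refine (zero_of_zero_data (S := 1) (K := |x| / t) (fun s hs => hY s (ht.1.trans hs.1))
      (fun s hs => hN s (ht.1.trans hs.1))
      (fun s hs => (hY s (ht.1.trans_le hs.1)).continuousAt.continuousWithinAt)
      (fun s hs => (hN s (ht.1.trans_le hs.1)).continuousAt.continuousWithinAt)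
      (fun s hs => ?_) (by simpa using h1) (by simpa using h0) t ⟨le_rfl, ht.2⟩).2
    rw [norm_div, Complex.norm_real, Complex.norm_real, Real.norm_eq_abs, Real.norm_eq_abs,
      abs_of_pos (ht.1.trans hs.1)]
    have := ht.1
    have := hs.1.le
    gcongr
  have hc : Continuous fun t : ℝ => bes0 ((x : ℂ) * t) := by
    have := continuous_bes0; fun_prop
  have h2 := (hc.tendsto 0).mono_left (nhdsWithin_le_nhds (s := Set.Ioi 0))
  simp only [Complex.ofReal_zero, mul_zero, bes0_zero] at h2
  have h3 : Tendsto (fun t : ℝ => bes0 ((x : ℂ) * t)) (𝓝[>] 0) (𝓝 0) := by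
    refine tendsto_const_nhds.congr' ?_
    filter_upwards [Ioc_mem_nhdsGT one_pos] with t ht using (key t ht).symm
  exact one_ne_zero (tendsto_nhds_unique h2 h3)

/-! ### The branch `W_{-1}` of the Lambert function near the origin -/

lemma exists_real_lambert {y : ℝ} (hy0 : 0 < y) (hy : y < Real.exp (-1)) :
    ∃ w : ℝ, w ≤ -1 ∧ w * Real.exp w = -y := by
  have h1 := Real.tendsto_pow_mul_exp_neg_atTop_nhds_zero 1
  obtain ⟨M, hM1, hM2⟩ := ((h1.eventually (gt_mem_nhds hy0)).and (eventually_ge_atTop 1)).exists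
  have hc : ContinuousOn (fun t : ℝ => t ^ 1 * Real.exp (-t)) (Set.Icc 1 M) := by fun_prop
  obtain ⟨t, ht, he⟩ := intermediate_value_Icc' hM2 hc (show y ∈ Set.Icc _ _ from
    ⟨hM1.le, by simpa using hy.le⟩)
  refine ⟨-t, by linarith [ht.1], ?_⟩
  simp only [pow_one] at he
  linarith

/-- On `(-1/e, 0)` only the real alternative of `IsLambertWm1` is possible, so the choice in
`lambertWm1` is harmless. With `arg w = φ - π`, the imaginary part reads `|w| sin φ = φ`; hence `|w|
> 1` and, as `φ < tan φ` on `(0, π/2)`, `|w| cos φ < 1`. The real part then exceeds `-1`, but it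
equals `log y < -1`. -/
lemma not_lambert_log_of_neg {y : ℝ} (hy0 : 0 < y) (hy : y < Real.exp (-1)) (w : ℂ) :
    w + Complex.log w ≠ Complex.log ((-y : ℝ) : ℂ) - 2 * (Real.pi : ℂ) * Complex.I := by
  intro h
  have hlog : Complex.log ((-y : ℝ) : ℂ) = Real.log y + Real.pi * Complex.I := by
    rw [Complex.log, Complex.norm_real, Real.norm_eq_abs, abs_neg, abs_of_pos hy0,
      Complex.arg_ofReal_of_neg (by linarith)]
  rw [hlog] at h
  have hre := congrArg Complex.re h
  have him := congrArg Complex.im h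
  simp [Complex.log_re, Complex.log_im] at hre him
  have harg1 := Complex.neg_pi_lt_arg w
  have hpi := Real.pi_pos
  have him0 : w.im < 0 := by
    by_contra! hc
    have := Complex.arg_nonneg_iff.2 hc
    linarith
  have harg2 : w.arg < 0 := Complex.arg_neg_iff.2 him0
  obtain ⟨φ, hφ⟩ : ∃ φ, φ = Real.pi + w.arg := ⟨_, rfl⟩
  have hφ0 : 0 < φ := by linarith
  have hφ1 : φ < Real.pi := by linarith
  have harg : w.arg = φ - Real.pi := by linarith
  have e1 : ‖w‖ * Real.cos w.arg = w.re := Complex.norm_mul_cos_arg w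
  have e2 : ‖w‖ * Real.sin w.arg = w.im := Complex.norm_mul_sin_arg w
  rw [harg, Real.cos_sub_pi] at e1
  rw [harg, Real.sin_sub_pi] at e2
  have e3 : ‖w‖ * Real.sin φ = φ := by linarith
  have hs0 : 0 < Real.sin φ := Real.sin_pos_of_pos_of_lt_pi hφ0 hφ1
  have hs1 := Real.sin_lt hφ0
  have hn : 1 < ‖w‖ := by
    by_contra! hc
    nlinarith
  have hlogn : 0 < Real.log ‖w‖ := Real.log_pos hn
  have hly : Real.log y < -1 := by rwa [Real.log_lt_iff_lt_exp hy0]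
  have hcos : ‖w‖ * Real.cos φ < 1 := by
    rcases le_or_gt (Real.pi / 2) φ with h2 | h2
    · have : Real.cos φ ≤ 0 := Real.cos_nonpos_of_pi_div_two_le_of_le h2 (by linarith)
      nlinarith
    · have hc0 : 0 < Real.cos φ := Real.cos_pos_of_mem_Ioo ⟨by linarith, h2⟩
      have h3 := Real.lt_tan hφ0 h2
      rw [Real.tan_eq_sin_div_cos, lt_div_iff₀ hc0] at h3
      by_contra! h4
      nlinarith
  linarith

/-- Write `w = q exp(i(φ - π))`. The imaginary part of the equation forces `q = (π + φ)/sin φ`, and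
the real part becomes `g φ = log x`, solved by the intermediate value theorem. -/
lemma exists_lambert_of_pos {x : ℝ} (hx : 0 < x) (hx1 : x < 1) :
    ∃ w : ℂ, w ≠ 0 ∧ w + Complex.log w = Complex.log x - 2 * (Real.pi : ℂ) * Complex.I := by
  have hpi := Real.pi_pos
  have hpi3 := Real.pi_gt_three
  have hpi4 := Real.pi_lt_d2
  let g : ℝ → ℝ := fun φ => -((Real.pi + φ) / Real.sin φ * Real.cos φ) +
    Real.log ((Real.pi + φ) / Real.sin φ)
  have hlx : Real.log x < 0 := Real.log_neg hx hx1
  -- Near `φ = 0` one has `q ≥ 3/φ`, so `g` is very negative; this endpoint is small enough for `g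
  -- φ0 ≤ log x`, with `cos φ0 ≥ 1/2`.
  set φ0 := 1 / (10 - Real.log x) with hφ0
  have hφ0p : 0 < φ0 := by rw [hφ0]; exact one_div_pos.2 (by linarith)
  have hφ0l : φ0 ≤ 1 / 10 := by
    rw [hφ0]; gcongr; linarith
  have hsin : ∀ φ ∈ Set.Icc φ0 (Real.pi / 2), 0 < Real.sin φ := fun φ hφ =>
    Real.sin_pos_of_pos_of_lt_pi (hφ0p.trans_le hφ.1) (by linarith [hφ.2])
  have hquot : ∀ φ ∈ Set.Icc φ0 (Real.pi / 2), 0 < (Real.pi + φ) / Real.sin φ := fun φ hφ =>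
    div_pos (by linarith [hφ.1]) (hsin φ hφ)
  have hc : ContinuousOn g (Set.Icc φ0 (Real.pi / 2)) := by
    have h1 : ContinuousOn (fun φ => (Real.pi + φ) / Real.sin φ) (Set.Icc φ0 (Real.pi / 2)) :=
      ContinuousOn.div (by fun_prop) (by fun_prop) fun φ hφ => (hsin φ hφ).ne'
    exact ((h1.mul (by fun_prop)).neg).add (h1.log fun φ hφ => (hquot φ hφ).ne')
  have hlow : g φ0 ≤ Real.log x := by
    have hs : 0 < Real.sin φ0 := hsin φ0 ⟨le_rfl, by linarith⟩
    have hs1 : Real.sin φ0 < φ0 := Real.sin_lt hφ0p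
    have hcos : 1 / 2 ≤ Real.cos φ0 := by
      have := Real.one_sub_sq_div_two_le_cos (x := φ0)
      nlinarith
    set q := (Real.pi + φ0) / Real.sin φ0 with hq
    have hq0 : 0 < q := hquot φ0 ⟨le_rfl, by linarith⟩
    have hq3 : 3 / φ0 ≤ q := by
      rw [hq]
      gcongr
      linarith
    have h1 : Real.log q ≤ q / 9 + 7 := by
      have h2 := Real.log_le_sub_one_of_pos (show 0 < q / 9 by positivity)
      have h3 := Real.log_le_sub_one_of_pos (show (0 : ℝ) < 9 by norm_num)
      rw [Real.log_div hq0.ne' (by norm_num)] at h2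
      linarith
    have h2 : q * (1 / 2) ≤ q * Real.cos φ0 := by gcongr
    have h3 : 3 / φ0 = 3 * (10 - Real.log x) := by rw [hφ0]; field_simp
    rw [h3] at hq3
    change -(q * Real.cos φ0) + Real.log q ≤ _
    linarith
  have hhigh : Real.log x ≤ g (Real.pi / 2) := by
    simp only [g, Real.sin_pi_div_two, Real.cos_pi_div_two, mul_zero, neg_zero, zero_add, div_one]
    exact hlx.le.trans (Real.log_nonneg (by linarith))
  obtain ⟨φ, hφ, he⟩ := intermediate_value_Icc (by linarith) hc ⟨hlow, hhigh⟩
  have hs := hsin φ hφ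
  have hq := hquot φ hφ
  have hφp : 0 < φ := hφ0p.trans_le hφ.1
  set q := (Real.pi + φ) / Real.sin φ with hqd
  have hqs : q * Real.sin φ = Real.pi + φ := div_mul_cancel₀ _ hs.ne'
  obtain ⟨w, hw⟩ : ∃ w : ℂ, w = q * (Real.cos (φ - Real.pi) + Real.sin (φ - Real.pi) * Complex.I) :=
    ⟨_, rfl⟩
  have hnorm : ‖w‖ = q := by
    rw [hw, norm_mul, Complex.norm_real, Real.norm_eq_abs, abs_of_pos hq, Complex.ofReal_cos,
      Complex.ofReal_sin, Complex.norm_cos_add_sin_mul_I, mul_one]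
  have harg : w.arg = φ - Real.pi := by
    rw [hw, Complex.ofReal_cos, Complex.ofReal_sin]
    exact Complex.arg_mul_cos_add_sin_mul_I hq ⟨by linarith, by linarith [hφ.2]⟩
  refine ⟨w, norm_pos_iff.1 (hnorm ▸ hq), ?_⟩
  rw [Complex.log, hnorm, harg, ← Complex.ofReal_log hx.le, ← he, hw, Real.cos_sub_pi,
    Real.sin_sub_pi]
  have hqs' : (q : ℂ) * Real.sin φ = Real.pi + φ := by exact_mod_cast hqs
  simp only [g]
  rw [← hqd]
  push_cast at hqs' ⊢
  linear_combination -Complex.I * hqs'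

lemma lambert_of_add_log {x w : ℂ} (hx : x ≠ 0) (hw : w ≠ 0)
    (h : w + Complex.log w = Complex.log x - 2 * (Real.pi : ℂ) * Complex.I) :
    w * Complex.exp w = x := by
  have h1 := congrArg Complex.exp h
  rw [Complex.exp_add, Complex.exp_log hw, Complex.exp_sub, Complex.exp_log hx,
    Complex.exp_two_pi_mul_I, div_one] at h1
  rw [mul_comm]; exact h1

/-- The behaviour of `W_{-1}` near the origin of the real axis. -/
theorem lambertWm1_spec {x : ℝ} (hx0 : x ≠ 0) (hx : |x| < Real.exp (-1)) :
    lambertWm1 x * Complex.exp (lambertWm1 x) = x ∧ (lambertWm1 x).re ≤ Real.log |x| ∧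
      -(3 * Real.pi / 2) ≤ (lambertWm1 x).im ∧ (lambertWm1 x).im ≤ 0 ∧
      (x < 0 → (lambertWm1 x).im = 0) := by
  have hpi := Real.pi_pos
  have hpi3 := Real.pi_gt_three
  have hxc : (x : ℂ) ≠ 0 := by exact_mod_cast hx0
  have he1 : Real.exp (-1) < 1 := Real.exp_lt_one_iff.2 (by norm_num)
  rcases lt_or_gt_of_ne hx0 with h | h
  · have hax : |x| = -x := abs_of_neg h
    rw [hax] at hx
    obtain ⟨v, hv1, hv2⟩ := exists_real_lambert (neg_pos.2 h) hx
    have hv : IsLambertWm1 x v := ⟨by rw [← Complex.ofReal_exp]; exact_mod_cast by linarith,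
      Or.inr ⟨by simp, by simpa using hv1⟩⟩
    obtain ⟨h1, h2⟩ : IsLambertWm1 x (lambertWm1 x) := Classical.epsilon_spec ⟨_, hv⟩
    set w := lambertWm1 x
    have h3 : w.im = 0 ∧ w.re ≤ -1 := by
      refine h2.resolve_left ?_
      have := not_lambert_log_of_neg (neg_pos.2 h) hx w
      rwa [neg_neg] at this
    refine ⟨h1, ?_, by rw [h3.1]; linarith, h3.1.le, fun _ => h3.1⟩
    have h4 : w = (w.re : ℂ) := by apply Complex.ext <;> simp [h3.1]
    rw [h4, ← Complex.ofReal_exp] at h1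
    have h5 : w.re * Real.exp w.re = x := by exact_mod_cast h1
    rw [hax, Real.le_log_iff_exp_le (neg_pos.2 h), ← h5]
    nlinarith [Real.exp_pos w.re]
  · have hax : |x| = x := abs_of_pos h
    rw [hax] at hx ⊢
    obtain ⟨v, hv0, hv⟩ := exists_lambert_of_pos h (hx.trans he1)
    obtain ⟨h1, h2⟩ : IsLambertWm1 x (lambertWm1 x) :=
      Classical.epsilon_spec ⟨_, lambert_of_add_log hxc hv0 hv, Or.inl hv⟩
    set w := lambertWm1 x
    have h3 : w + Complex.log w = Complex.log x - 2 * (Real.pi : ℂ) * Complex.I := by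
      refine h2.resolve_right fun h3 => ?_
      have h4 : w = (w.re : ℂ) := by apply Complex.ext <;> simp [h3.1]
      rw [h4, ← Complex.ofReal_exp] at h1
      have h5 : w.re * Real.exp w.re = x := by exact_mod_cast h1
      nlinarith [Real.exp_pos w.re, h3.2]
    rw [← Complex.ofReal_log h.le] at h3
    have hre := congrArg Complex.re h3
    have him := congrArg Complex.im h3
    simp [Complex.log_re, Complex.log_im] at hre him
    have harg1 := Complex.neg_pi_lt_arg w
    have harg2 := Complex.arg_le_pi w
    have hn : 1 < ‖w‖ := by
      have := (abs_le.1 (Complex.abs_im_le_norm w)).1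
      linarith
    have hln := Real.log_pos hn
    have hre1 : w.re ≤ Real.log x := by linarith
    have hlx : Real.log x < 0 := Real.log_neg h (hx.trans he1)
    refine ⟨h1, hre1, ?_, by linarith, fun h4 => absurd h4 (by linarith)⟩
    -- `w` lies in the open third quadrant, so `arg w < -π/2`; together with `Im w + arg w = -2π`
    -- this gives `Im w ≥ -3π/2`.
    have h5 : ¬ (-(Real.pi / 2) ≤ w.arg) := by
      rw [Complex.neg_pi_div_two_le_arg_iff]
      push Not
      exact ⟨by linarith, by linarith⟩
    linarith

/-! ### The matching function near a zero of `bes0` -/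

lemma exists_lipschitz_closedBall {f f' : ℂ → ℂ} (hf : ∀ z, HasDerivAt f (f' z) z)
    (hf' : Continuous f') (z₀ : ℂ) (R : ℝ) :
    ∃ K, 0 ≤ K ∧ ∀ x ∈ Metric.closedBall z₀ R, ∀ y ∈ Metric.closedBall z₀ R,
      ‖f x - f y‖ ≤ K * ‖x - y‖ := by
  obtain ⟨K, hK⟩ := (isCompact_closedBall z₀ R).exists_bound_of_continuousOn hf'.continuousOn
  refine ⟨max K 0, le_max_right _ _, fun x hx y hy => ?_⟩
  exact (convex_closedBall z₀ R).norm_image_sub_le_of_norm_hasDerivWithin_le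
    (fun z _ => (hf z).hasDerivWithinAt) (fun z hz => (hK z hz).trans (le_max_left _ _)) hy hx

lemma exists_norm_sub_le {f f' : ℂ → ℂ} (hf : ∀ z, HasDerivAt f (f' z) z)
    (hf' : Continuous f') (z₀ : ℂ) :
    ∃ K, 0 ≤ K ∧ ∀ h : ℂ, ‖h‖ ≤ 1 → ‖f (z₀ + h) - f z₀‖ ≤ K * ‖h‖ := by
  obtain ⟨K, hK0, hK⟩ := exists_lipschitz_closedBall hf hf' z₀ 1
  refine ⟨K, hK0, fun h hh => ?_⟩
  simpa using hK (z₀ + h) (by simpa using hh) z₀ (by simp)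

lemma exists_norm_sub_sub_le {f f' f'' : ℂ → ℂ} (hf : ∀ z, HasDerivAt f (f' z) z)
    (hf' : ∀ z, HasDerivAt f' (f'' z) z) (hf'' : Continuous f'') (z₀ : ℂ) :
    ∃ K, 0 ≤ K ∧ ∀ h : ℂ, ‖h‖ ≤ 1 → ‖f (z₀ + h) - f z₀ - f' z₀ * h‖ ≤ K * ‖h‖ ^ 2 := by
  obtain ⟨K, hK0, hK⟩ := exists_norm_sub_le hf' hf'' z₀
  refine ⟨K, hK0, fun h hh => ?_⟩
  have hg : ∀ z, HasDerivAt (fun z => f z - f' z₀ * z) (f' z - f' z₀) z := fun z => by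
    exact ((hf z).sub ((hasDerivAt_id z).const_mul (f' z₀))).congr_deriv (by simp)
  have hb : ∀ z ∈ Metric.closedBall z₀ ‖h‖, ‖f' z - f' z₀‖ ≤ K * ‖h‖ := fun z hz => by
    have hz' : ‖z - z₀‖ ≤ ‖h‖ := by simpa [dist_eq_norm] using hz
    have := hK (z - z₀) (hz'.trans hh)
    rw [add_sub_cancel] at this
    exact this.trans (by gcongr)
  have := (convex_closedBall z₀ ‖h‖).norm_image_sub_le_of_norm_hasDerivWithin_le
    (fun z _ => (hg z).hasDerivWithinAt) hb (Metric.mem_closedBall_self (norm_nonneg h))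
    (show z₀ + h ∈ _ by simp)
  calc _ = ‖f (z₀ + h) - f' z₀ * (z₀ + h) - (f z₀ - f' z₀ * z₀)‖ := by ring_nf
    _ ≤ K * ‖h‖ * ‖z₀ + h - z₀‖ := this
    _ = K * ‖h‖ ^ 2 := by rw [add_sub_cancel_left]; ring

/-- Perturbation of the matching condition around a zero `β` of `bes0`. -/
theorem matching_error {β : ℂ} (hβ : bes0 β = 0) {K₁ : ℝ} (hK₁ : 0 ≤ K₁) :
    ∃ K, 0 ≤ K ∧ ∀ (e X Λ H H₁ : ℂ) (L : ℝ), 1 ≤ L → ‖Λ‖ ≤ L → ‖X‖ * L ≤ 1 / 2 → ‖e‖ ≤ 1 / 2 →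
      ‖H - 1‖ ≤ K₁ * (‖X‖ * L) → ‖H₁ - X * Λ‖ ≤ K₁ * (‖X‖ * (‖X‖ * L)) →
      ‖H * bes0 (β + (e + X)) - H₁ * bes1 (β + (e + X)) - bes1 β * (e + X - X * Λ)‖
        ≤ K * (‖e‖ + ‖X‖ * L) ^ 2 := by
  obtain ⟨Ka, hKa0, hKa⟩ := exists_norm_sub_le hasDerivAt_bes0 continuous_bes1 β
  obtain ⟨Kb, hKb0, hKb⟩ := exists_norm_sub_sub_le hasDerivAt_bes0 hasDerivAt_bes1
    continuous_bes1' β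
  obtain ⟨Kc, hKc0, hKc⟩ := exists_norm_sub_le hasDerivAt_bes1 continuous_bes1' β
  refine ⟨K₁ * Ka + Kb + K₁ * (‖bes1 β‖ + Kc) + Kc, by positivity, ?_⟩
  intro e X Λ H H₁ L hL hΛ hX he hH hH₁
  -- `N` bounds each of `e + X`, `XΛ`, `H - 1` and `bes0(β + (e + X))` up to constants, so every
  -- product discarded below is `O(N²)`.
  set N := ‖e‖ + ‖X‖ * L with hN
  have hX1 : ‖X‖ ≤ ‖X‖ * L := le_mul_of_one_le_right (norm_nonneg X) hL
  have hN1 : N ≤ 1 := by linarith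
  have hXN : ‖X‖ * L ≤ N := by linarith [norm_nonneg e]
  have hN0 : 0 ≤ N := by positivity
  have hb : ‖e + X‖ ≤ N := (norm_add_le _ _).trans (by linarith)
  have hb1 := hb.trans hN1
  have h1 : ‖bes0 (β + (e + X))‖ ≤ Ka * N := by
    have := hKa _ hb1
    rw [hβ, sub_zero] at this
    exact this.trans (by gcongr)
  have h2 : ‖bes0 (β + (e + X)) - bes1 β * (e + X)‖ ≤ Kb * N ^ 2 := by
    have := hKb _ hb1
    rw [hβ, sub_zero] at this
    exact this.trans (by gcongr)
  have h3 : ‖bes1 (β + (e + X)) - bes1 β‖ ≤ Kc * N := (hKc _ hb1).trans (by gcongr)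
  have h4 : ‖bes1 (β + (e + X))‖ ≤ ‖bes1 β‖ + Kc := by
    have := norm_le_norm_add_norm_sub' (bes1 (β + (e + X))) (bes1 β)
    nlinarith
  have h5 : ‖H - 1‖ ≤ K₁ * N := hH.trans (by gcongr)
  have h6 : ‖H₁ - X * Λ‖ ≤ K₁ * (N * N) := hH₁.trans (by gcongr; linarith)
  have h7 : ‖X * Λ‖ ≤ N := by
    rw [norm_mul]
    exact (by gcongr : ‖X‖ * ‖Λ‖ ≤ ‖X‖ * L).trans hXN
  have key : H * bes0 (β + (e + X)) - H₁ * bes1 (β + (e + X)) - bes1 β * (e + X - X * Λ) =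
      (H - 1) * bes0 (β + (e + X)) + (bes0 (β + (e + X)) - bes1 β * (e + X))
        - (H₁ - X * Λ) * bes1 (β + (e + X)) - X * Λ * (bes1 (β + (e + X)) - bes1 β) := by ring
  rw [key]
  calc _ ≤ ‖(H - 1) * bes0 (β + (e + X))‖ + ‖bes0 (β + (e + X)) - bes1 β * (e + X)‖
        + ‖(H₁ - X * Λ) * bes1 (β + (e + X))‖ + ‖X * Λ * (bes1 (β + (e + X)) - bes1 β)‖ :=
        (norm_sub_le _ _).trans (add_le_add ((norm_sub_le _ _).trans
          (add_le_add (norm_add_le _ _) le_rfl)) le_rfl)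
    _ ≤ K₁ * N * (Ka * N) + Kb * N ^ 2 + K₁ * (N * N) * (‖bes1 β‖ + Kc) + N * (Kc * N) := by
        rw [norm_mul, norm_mul, norm_mul (X * Λ)]
        gcongr
    _ = _ := by ring

/-- The outgoing radial solution in terms of `X = τ² s` and `Λ = log X`. -/
def outVal (X Λ : ℂ) : ℂ := 1 + X * bes1 X * Λ - regPart X

/-- The logarithmic derivative `X ∂_X` of `outVal` along `∂_X Λ = 1 / X`. -/
def outDer (X Λ : ℂ) : ℂ := X * (bes0 X * Λ + bes1 X - regPart' X)

/-- First-order expansion of the power series at `0`; the constant `2γ` arises from `bes1 0 -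
regPart' 0`. `Λ` is an independent variable here, so no branch of the logarithm is involved. -/
lemma outVal_outDer_bounds : ∃ K, 0 ≤ K ∧ ∀ (X Λ : ℂ) (L : ℝ), 1 ≤ L → ‖Λ‖ ≤ L → ‖X‖ ≤ 1 →
    ‖outVal X Λ - 1‖ ≤ K * (‖X‖ * L) ∧
      ‖outDer X Λ - X * (Λ + 2 * Real.eulerMascheroniConstant)‖ ≤ K * (‖X‖ * (‖X‖ * L)) := by
  have hc' : Continuous regPart' :=
    continuous_iff_continuousAt.2 fun z => (hasDerivAt_regPart' z).continuousAt
  have hc'' : Continuous regPart'' := entireCoeff_regCoeff.derivCoeff.derivCoeff.continuous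
  obtain ⟨Ka, hKa0, hKa⟩ := exists_norm_sub_le hasDerivAt_bes0 continuous_bes1 0
  obtain ⟨Kb, hKb0, hKb⟩ := exists_norm_sub_le hasDerivAt_bes1 continuous_bes1' 0
  obtain ⟨Kc, hKc0, hKc⟩ := exists_norm_sub_le hasDerivAt_regPart hc' 0
  obtain ⟨Kd, hKd0, hKd⟩ := exists_norm_sub_le hasDerivAt_regPart' hc'' 0
  simp only [zero_add, bes0_zero, bes1_zero, regPart_zero, regPart'_zero, sub_zero]
    at hKa hKb hKc hKd
  refine ⟨1 + Ka + Kb + Kc + Kd, by positivity, fun X Λ L hL hΛ hX => ⟨?_, ?_⟩⟩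
  · have h1 : ‖bes1 X‖ ≤ 1 + Kb := by
      have := norm_le_norm_add_norm_sub' (bes1 X) 1
      rw [norm_one] at this
      nlinarith [hKb X hX]
    have h2 : ‖regPart X‖ ≤ Kc * (‖X‖ * L) := (hKc X hX).trans (by
      gcongr; exact le_mul_of_one_le_right (norm_nonneg X) hL)
    calc ‖outVal X Λ - 1‖ = ‖X * bes1 X * Λ - regPart X‖ := by rw [outVal]; ring_nf
      _ ≤ ‖X‖ * ‖bes1 X‖ * ‖Λ‖ + ‖regPart X‖ := by
          rw [← norm_mul, ← norm_mul]; exact norm_sub_le _ _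
      _ ≤ ‖X‖ * (1 + Kb) * L + Kc * (‖X‖ * L) := by gcongr
      _ = (1 + Kb + Kc) * (‖X‖ * L) := by ring
      _ ≤ _ := mul_le_mul_of_nonneg_right (by linarith) (by positivity)
  · have h1 := hKa X hX
    have h2 := hKb X hX
    have h3 := hKd X hX
    have h0 : ‖X‖ ≤ ‖X‖ * L := le_mul_of_one_le_right (norm_nonneg X) hL
    calc ‖outDer X Λ - X * (Λ + 2 * Real.eulerMascheroniConstant)‖
        = ‖X * ((bes0 X - 1) * Λ + (bes1 X - 1)
            - (regPart' X - (1 - 2 * Real.eulerMascheroniConstant)))‖ := by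
          rw [outDer]; ring_nf
      _ ≤ ‖X‖ * (‖bes0 X - 1‖ * ‖Λ‖ + ‖bes1 X - 1‖
            + ‖regPart' X - (1 - 2 * Real.eulerMascheroniConstant)‖) := by
          rw [norm_mul, ← norm_mul (bes0 X - 1)]
          refine mul_le_mul_of_nonneg_left ?_ (norm_nonneg X)
          exact (norm_sub_le _ _).trans (add_le_add (norm_add_le _ _) le_rfl)
      _ ≤ ‖X‖ * (Ka * ‖X‖ * L + Kb * (‖X‖ * L) + Kd * (‖X‖ * L)) := by
          gcongr
          · exact h2.trans (by gcongr)
          · exact h3.trans (by gcongr)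
      _ = (Ka + Kb + Kd) * (‖X‖ * (‖X‖ * L)) := by ring
      _ ≤ _ := mul_le_mul_of_nonneg_right (by linarith) (by positivity)

/-- The difference of the two sides of the matching condition. -/
def mismatch (β e X Λ : ℂ) : ℂ :=
  outVal X Λ * bes0 (β + (e + X)) - outDer X Λ * bes1 (β + (e + X))

/-- The shift `Λ = w + 1 - 2γ` is the one for which the linear part `e + X - X(Λ + 2γ)` collapses to
`e - X w`. -/
lemma mismatch_bounds {β : ℂ} (hβ : bes0 β = 0) :
    ∃ K, 0 ≤ K ∧ ∀ e X w : ℂ, 3 ≤ ‖w‖ → ‖X‖ * ‖w‖ ≤ 1 / 4 → ‖e‖ ≤ 1 / 2 →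
      ‖outVal X (w + 1 - 2 * Real.eulerMascheroniConstant) - 1‖ ≤ K * (‖X‖ * ‖w‖) ∧
      ‖mismatch β e X (w + 1 - 2 * Real.eulerMascheroniConstant) - bes1 β * (e - X * w)‖
        ≤ K * (‖e‖ + ‖X‖ * ‖w‖) ^ 2 := by
  obtain ⟨K₁, hK₁0, hK₁⟩ := outVal_outDer_bounds
  obtain ⟨K, hK0, hK⟩ := matching_error hβ hK₁0
  refine ⟨2 * K₁ + 4 * K, by positivity, fun e X w hw hX he => ?_⟩
  have hγ1 := Real.one_half_lt_eulerMascheroniConstant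
  have hγ2 := Real.eulerMascheroniConstant_lt_two_thirds
  set g := Real.eulerMascheroniConstant
  have hX' : ‖X‖ * (2 * ‖w‖) = 2 * (‖X‖ * ‖w‖) := by ring
  have hΛ : ‖w + 1 - 2 * g‖ ≤ 2 * ‖w‖ := by
    have h1 : ‖(1 - 2 * g : ℂ)‖ ≤ 1 := by
      rw [show (1 - 2 * g : ℂ) = ((1 - 2 * g : ℝ) : ℂ) by push_cast; ring, Complex.norm_real,
        Real.norm_eq_abs, abs_le]
      constructor <;> linarith
    have h2 := norm_add_le w (1 - 2 * g : ℂ)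
    rw [← add_sub_assoc] at h2
    linarith
  have hΛ' : ‖w + 1‖ ≤ 2 * ‖w‖ := by
    have h2 := norm_add_le w (1 : ℂ)
    rw [norm_one] at h2
    linarith
  have hX1 : ‖X‖ ≤ 1 := by nlinarith [norm_nonneg X]
  obtain ⟨h1, h2⟩ := hK₁ X _ (2 * ‖w‖) (by linarith) hΛ hX1
  rw [sub_add_cancel] at h2
  have hn : 0 ≤ ‖X‖ * ‖w‖ := by positivity
  constructor
  · rw [hX'] at h1
    exact h1.trans (by nlinarith)
  · have h3 := hK e X (w + 1) _ _ (2 * ‖w‖) (by linarith) hΛ' (by linarith) he h1 h2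
    have h4 : e + X - X * (w + 1) = e - X * w := by ring
    rw [h4, hX'] at h3
    refine h3.trans ?_
    calc K * (‖e‖ + 2 * (‖X‖ * ‖w‖)) ^ 2 ≤ K * (2 * (‖e‖ + ‖X‖ * ‖w‖)) ^ 2 := by
          gcongr; linarith [norm_nonneg e]
      _ = 4 * K * (‖e‖ + ‖X‖ * ‖w‖) ^ 2 := by ring
      _ ≤ _ := by gcongr; linarith

/-! ### Solving the perturbed equation `(1 + d / W) e^d = 1` -/

/-- For large `W` the function is `d` plus an error of at most `(1/4 + 1/8)|d|`. -/
lemma norm_lambert_sub_bounds {W d : ℂ} (hW : 16 ≤ ‖W‖) (hd : ‖d‖ ≤ 1 / 4) :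
    ‖d‖ / 2 ≤ ‖(1 + d / W) * Complex.exp d - 1‖ ∧ ‖(1 + d / W) * Complex.exp d‖ ≤ 2 := by
  have h1 := Complex.norm_exp_sub_one_sub_id_le (x := d) (by linarith)
  have h2 := Complex.norm_exp_sub_one_le (x := d) (by linarith)
  have h3 : ‖Complex.exp d‖ ≤ 2 := by
    have := norm_le_norm_add_norm_sub' (Complex.exp d) 1
    rw [norm_one] at this
    linarith
  have h4 : ‖d / W * Complex.exp d‖ ≤ ‖d‖ / 8 := by
    rw [norm_mul, norm_div]
    calc ‖d‖ / ‖W‖ * ‖Complex.exp d‖ ≤ ‖d‖ / 16 * 2 := by gcongr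
      _ = ‖d‖ / 8 := by ring
  have h5 : ‖Complex.exp d - 1 - d‖ ≤ ‖d‖ / 4 := by nlinarith [norm_nonneg d]
  have key : (1 + d / W) * Complex.exp d - 1 =
      d + ((Complex.exp d - 1 - d) + d / W * Complex.exp d) := by ring
  have h6 := norm_add_le (Complex.exp d - 1 - d) (d / W * Complex.exp d)
  have h7 : ‖(1 + d / W) * Complex.exp d - 1‖ ≤ ‖d‖ + (‖d‖ / 4 + ‖d‖ / 8) := by
    rw [key]
    exact (norm_add_le _ _).trans (by linarith)
  constructor
  · rw [key]
    have := norm_nonneg d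
    have := norm_sub_le_norm_add d ((Complex.exp d - 1 - d) + d / W * Complex.exp d)
    linarith
  · have := norm_le_norm_add_norm_sub' ((1 + d / W) * Complex.exp d) 1
    rw [norm_one] at this
    linarith

/-- Quantitative open mapping: on the circle of radius `10η` the model is at least `5η`, so `|F - F
0| ≥ 3η` there. The image of the disk thus contains the ball of radius `3η/2` about `F 0`, and `|F
0| ≤ η`. -/
lemma exists_zero_near {W : ℂ} (hW : 16 ≤ ‖W‖) {F : ℂ → ℂ} (hF : Differentiable ℂ F) {η : ℝ}
    (hη0 : 0 < η) (hη : η ≤ 1 / 40)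
    (hFη : ∀ d, ‖d‖ ≤ 1 / 4 → ‖F d - ((1 + d / W) * Complex.exp d - 1)‖ ≤ η) :
    ∃ d, ‖d‖ ≤ 10 * η ∧ F d = 0 := by
  have hF0 : ‖F 0‖ ≤ η := by simpa using hFη 0 (by norm_num)
  have hsph : ∀ z ∈ Metric.sphere (0 : ℂ) (10 * η), 3 * η ≤ ‖F z - F 0‖ := fun z hz => by
    have hz' : ‖z‖ = 10 * η := by simpa using hz
    have hz4 : ‖z‖ ≤ 1 / 4 := by linarith
    have h1 := (norm_lambert_sub_bounds hW hz4).1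
    have h2 := hFη z hz4
    have h3 := norm_le_norm_add_norm_sub ((1 + z / W) * Complex.exp z - 1) (F z)
    have h3' := norm_le_norm_add_norm_sub' ((1 + z / W) * Complex.exp z - 1) (F z)
    have h4 := norm_sub_norm_le (F z) (F 0)
    rw [norm_sub_rev] at h2
    linarith
  have hfreq : ∃ᶠ z in 𝓝 (0 : ℂ), F z ≠ F 0 := by
    intro hcon
    have hcon' : F =ᶠ[𝓝 0] fun _ => F 0 := hcon.mono fun z hz => not_not.1 hz
    have heq := AnalyticOnNhd.eq_of_eventuallyEq
      (hF.differentiableOn.analyticOnNhd isOpen_univ) analyticOnNhd_const hcon'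
    have := hsph ((10 * η : ℝ) : ℂ) (by simp [abs_of_pos hη0])
    rw [heq] at this
    simp at this
    linarith
  have himg := DiffContOnCl.ball_subset_image_closedBall (z₀ := (0 : ℂ)) hF.diffContOnCl
    (by positivity) hsph hfreq
  obtain ⟨d, hd, hd0⟩ := himg (show (0 : ℂ) ∈ Metric.ball (F 0) (3 * η / 2) by
    rw [Metric.mem_ball, dist_zero_left]; linarith)
  exact ⟨d, by simpa using hd, hd0⟩

/-- In the logarithmic coordinate `d`, `X` is an exponential and `Λ` is affine, so the multivalued
dependence on `X` becomes entire. -/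
lemma differentiable_mismatch_lambert (β e c W g : ℂ) :
    Differentiable ℂ fun d : ℂ => mismatch β e (c * Complex.exp (W + d)) (W + d + 1 - g) := by
  have h0 : Differentiable ℂ bes0 := fun z => (hasDerivAt_bes0 z).differentiableAt
  have h1 : Differentiable ℂ bes1 := fun z => (hasDerivAt_bes1 z).differentiableAt
  have h2 : Differentiable ℂ regPart := fun z => (hasDerivAt_regPart z).differentiableAt
  have h3 : Differentiable ℂ regPart' := fun z => (hasDerivAt_regPart' z).differentiableAt
  unfold mismatch outVal outDer
  fun_prop

/-- A zero of the mismatch near the solution `W` of `c W e^W = e`. -/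
theorem exists_mismatch_zero {β : ℂ} (hβ : bes0 β = 0) (hβ1 : bes1 β ≠ 0) :
    ∃ K δ, 0 < K ∧ 0 < δ ∧ ∀ e c W : ℂ, e ≠ 0 → ‖e‖ < δ → 17 ≤ ‖W‖ →
      c * (W * Complex.exp W) = e → ∃ d : ℂ, ‖d‖ ≤ K * ‖e‖ ∧ ‖d‖ ≤ 1 / 4 ∧
        outVal (c * Complex.exp (W + d)) (W + d + 1 - 2 * Real.eulerMascheroniConstant) ≠ 0 ∧
        mismatch β e (c * Complex.exp (W + d))
          (W + d + 1 - 2 * Real.eulerMascheroniConstant) = 0 := by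
  obtain ⟨K, hK0, hK⟩ := mismatch_bounds hβ
  have hj : 0 < ‖bes1 β‖ := norm_pos_iff.2 hβ1
  -- Since `|X w| ≤ 2|e|`, the quadratic error is at most `K(3|e|)²`; division by `|bes1 β| |e|`
  -- leaves `K₂|e|`. The `1` only ensures positivity.
  set K₂ := (9 * K + 1) / ‖bes1 β‖ with hK₂
  have hK₂0 : 0 < K₂ := by positivity
  -- The three bounds on `|e|` give, in order: `|X w| ≤ 1/4`, the condition `η ≤ 1/40` for
  -- `exists_zero_near`, and `2K|e| < 1`, which keeps `outVal` away from `0`.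
  refine ⟨10 * K₂, min (1 / 8) (min (1 / (40 * K₂)) (1 / (4 * K + 4))), by positivity,
    by positivity, ?_⟩
  intro e c W he hes hW hcW
  have hen : 0 < ‖e‖ := norm_pos_iff.2 he
  obtain ⟨hes1, hes2, hes3⟩ : ‖e‖ < 1 / 8 ∧ ‖e‖ < 1 / (40 * K₂) ∧ ‖e‖ < 1 / (4 * K + 4) := by
    simpa using hes
  rw [lt_div_iff₀ (by positivity)] at hes2 hes3
  have hW0 : W ≠ 0 := norm_pos_iff.1 (by linarith)
  have hid : ∀ d : ℂ, c * Complex.exp (W + d) * (W + d) =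
      e * ((1 + d / W) * Complex.exp d) := fun d => by
    rw [← hcW, Complex.exp_add]; field_simp
  have hb : ∀ d : ℂ, ‖d‖ ≤ 1 / 4 → 3 ≤ ‖W + d‖ ∧
      ‖c * Complex.exp (W + d)‖ * ‖W + d‖ ≤ 2 * ‖e‖ := fun d hd => by
    constructor
    · have := norm_sub_le_norm_add W d
      linarith
    · rw [← norm_mul, hid, norm_mul, mul_comm]
      gcongr
      exact (norm_lambert_sub_bounds (by linarith) hd).2
  set F : ℂ → ℂ := fun d => -(mismatch β e (c * Complex.exp (W + d))
    (W + d + 1 - 2 * Real.eulerMascheroniConstant)) / (bes1 β * e) with hFd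
  have hF : Differentiable ℂ F :=
    (differentiable_mismatch_lambert β e c W _).neg.div_const _
  have hje : bes1 β * e ≠ 0 := mul_ne_zero hβ1 he
  obtain ⟨d, hd, hFd0⟩ := exists_zero_near (W := W) (by linarith) hF (η := K₂ * ‖e‖)
    (by positivity) (by linarith) (fun d hd => by
      obtain ⟨h3, h4⟩ := hb d hd
      have h5 := (hK e (c * Complex.exp (W + d)) (W + d) h3 (by linarith) (by linarith)).2
      have h6 : F d - ((1 + d / W) * Complex.exp d - 1) =
          -(mismatch β e (c * Complex.exp (W + d))
            (W + d + 1 - 2 * Real.eulerMascheroniConstant)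
            - bes1 β * (e - c * Complex.exp (W + d) * (W + d))) / (bes1 β * e) := by
        rw [hid]; simp only [hFd]; field_simp; ring
      rw [h6, norm_div, norm_neg, norm_mul, div_le_iff₀ (by positivity)]
      refine h5.trans ?_
      calc K * (‖e‖ + ‖c * Complex.exp (W + d)‖ * ‖W + d‖) ^ 2
          ≤ K * (‖e‖ + 2 * ‖e‖) ^ 2 := by gcongr
        _ = 9 * K * ‖e‖ ^ 2 := by ring
        _ ≤ (9 * K + 1) * ‖e‖ ^ 2 := by gcongr; linarith
        _ = K₂ * ‖e‖ * (‖bes1 β‖ * ‖e‖) := by rw [hK₂]; field_simp)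
  have hd4 : ‖d‖ ≤ 1 / 4 := by linarith
  refine ⟨d, by linarith, hd4, fun h0 => ?_, ?_⟩
  · obtain ⟨h3, h4⟩ := hb d hd4
    have h5 := (hK e (c * Complex.exp (W + d)) (W + d) h3 (by linarith) (by linarith)).1
    rw [h0, zero_sub, norm_neg, norm_one] at h5
    nlinarith
  · simp only [hFd, div_eq_zero_iff, neg_eq_zero, hje, or_false] at hFd0
    exact hFd0

/-- A zero of the mismatch in the admissible strip gives a resonance. -/
theorem isResonance_of_mismatch {ρ A : ℝ} (hρ : 0 < ρ) {l : ℤ} (hl : l = 1 ∨ l = -1) {β e w : ℂ}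
    (hA : β + e = -((A : ℂ) / 4) * (ρ ^ 2 : ℝ)) (hw1 : -(2 * Real.pi) < w.im)
    (hw2 : w.im < 2 * Real.pi)
    (h0 : outVal (Complex.exp (1 - 2 * Real.eulerMascheroniConstant) * Complex.exp w)
      (w + 1 - 2 * Real.eulerMascheroniConstant) ≠ 0)
    (hm : mismatch β e (Complex.exp (1 - 2 * Real.eulerMascheroniConstant) * Complex.exp w)
      (w + 1 - 2 * Real.eulerMascheroniConstant) = 0) :
    IsResonance ρ (well ρ A) (2 * Complex.I / (ρ : ℂ) *
      Complex.exp (1 / 2 - Real.eulerMascheroniConstant + w / 2)) := by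
  have hρc : (ρ : ℂ) ≠ 0 := by exact_mod_cast hρ.ne'
  set g := Real.eulerMascheroniConstant
  obtain ⟨τ, hτ⟩ : ∃ τ, τ = Complex.exp (1 / 2 - g + w / 2 - Real.log ρ) := ⟨_, rfl⟩
  have him : (1 / 2 - (g : ℂ) + w / 2 - Real.log ρ).im = w.im / 2 := by
    simp
  -- The strip `|Im w| < 2π` is used here: half of it lies in `(-π, π)`, so the principal logarithm
  -- inverts the exponential and `τ` avoids the negative real axis.
  have hlog : Complex.log τ = 1 / 2 - g + w / 2 - Real.log ρ := by
    rw [hτ, Complex.log_exp] <;> rw [him] <;> linarith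
  have hτ' : τ = Complex.exp (1 / 2 - g + w / 2) / ρ := by
    rw [hτ, Complex.exp_sub, ← Complex.ofReal_exp (Real.log ρ), Real.exp_log hρ]
  have hsl : τ ∈ Complex.slitPlane := by
    rw [Complex.mem_slitPlane_iff_arg, ← Complex.log_im, hlog, him]
    exact ⟨by linarith, by rw [hτ]; exact Complex.exp_ne_zero _⟩
  have hX : τ ^ 2 * ((ρ ^ 2 : ℝ) : ℂ) = Complex.exp (1 - 2 * g) * Complex.exp w := by
    rw [hτ', ← Complex.exp_add, div_pow, ← Complex.exp_nat_mul]
    push_cast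
    rw [div_mul_cancel₀ _ (pow_ne_zero 2 hρc)]
    congr 1
    ring
  have hΛ : 2 * Complex.log τ + Real.log (ρ ^ 2) = w + 1 - 2 * g := by
    rw [hlog, Real.log_pow]; push_cast; ring
  have hval : outSol τ (ρ ^ 2) = outVal (Complex.exp (1 - 2 * g) * Complex.exp w)
      (w + 1 - 2 * g) := by
    rw [outSol, outVal, hX, hΛ]
  have hder : ((ρ ^ 2 : ℝ) : ℂ) * outSol' τ (ρ ^ 2) =
      outDer (Complex.exp (1 - 2 * g) * Complex.exp w) (w + 1 - 2 * g) := by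
    rw [outSol', outDer, ← hX, hΛ]; ring
  have harg : (τ ^ 2 - (A : ℂ) / 4) * (ρ ^ 2 : ℝ) =
      β + (e + Complex.exp (1 - 2 * g) * Complex.exp w) := by
    rw [← add_assoc, hA, ← hX]; ring
  have := isResonance_of_matching hρ (A := A) hl hsl (hval ▸ h0) (by
    rw [hval, hder, harg]
    exact sub_eq_zero.1 hm)
  rw [hτ'] at this
  convert this using 1
  ring

/-! ### Expansions of the resonance and of the eigenvalue -/

/-- `W_{-1}(ε ρ² e^{-1+2γ} / 4)` for small `ε ≠ 0`. -/
lemma wTerm_spec {ρ : ℝ} (hρ : 0 < ρ) (M : ℝ) :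
    ∀ᶠ ε : ℝ in 𝓝[≠] 0,
      Complex.exp (1 - 2 * Real.eulerMascheroniConstant) *
          (wTerm ρ ε * Complex.exp (wTerm ρ ε)) = ((ρ ^ 2 * ε / 4 : ℝ) : ℂ) ∧
        (wTerm ρ ε).re ≤ -M ∧ -(3 * Real.pi / 2) ≤ (wTerm ρ ε).im ∧ (wTerm ρ ε).im ≤ 0 ∧
        (ε < 0 → (wTerm ρ ε).im = 0) := by
  set g := Real.eulerMascheroniConstant with hg
  have hk : 0 < ρ ^ 2 * Real.exp (-1 + 2 * g) / 4 := by positivity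
  have hcont : Tendsto (fun ε : ℝ => |ε * ρ ^ 2 * Real.exp (-1 + 2 * g) / 4|) (𝓝[≠] 0) (𝓝 0) := by
    have : Continuous fun ε : ℝ => |ε * ρ ^ 2 * Real.exp (-1 + 2 * g) / 4| := by fun_prop
    simpa using (this.tendsto 0).mono_left nhdsWithin_le_nhds
  filter_upwards [self_mem_nhdsWithin, hcont.eventually (gt_mem_nhds (Real.exp_pos (-1))),
    hcont.eventually (gt_mem_nhds (Real.exp_pos (-M)))] with ε hε h1 h2
  have hε0 : ε ≠ 0 := hε
  have hx0 : ε * ρ ^ 2 * Real.exp (-1 + 2 * g) / 4 ≠ 0 := by positivity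
  obtain ⟨h3, h4, h5, h6, h7⟩ := lambertWm1_spec hx0 h1
  refine ⟨?_, h4.trans ?_, h5, h6, fun hneg => h7 ?_⟩
  · rw [wTerm, h3]
    push_cast
    have : Complex.exp (1 - 2 * g) * Complex.exp (-1 + 2 * g) = 1 := by
      rw [← Complex.exp_add, show (1 - 2 * g + (-1 + 2 * g) : ℂ) = 0 by ring, Complex.exp_zero]
    linear_combination (ρ : ℂ) ^ 2 * ε / 4 * this
  · rw [Real.log_le_iff_le_exp (abs_pos.2 hx0)]
    exact h2.le
  · have : ε * (ρ ^ 2 * Real.exp (-1 + 2 * g) / 4) < 0 := mul_neg_of_neg_of_pos hneg hk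
    linarith

lemma norm_wTerm_ge {w : ℂ} {M : ℝ} (h : w.re ≤ -M) : M ≤ ‖w‖ := by
  have := (abs_le.1 (Complex.abs_re_le_norm w)).1
  linarith

/-- `|W exp W|` is a constant times `|ε|`, while `|W| → ∞`. -/
lemma isLittleO_exp_wTerm {ρ : ℝ} (hρ : 0 < ρ) :
    (fun ε : ℝ => Complex.exp (wTerm ρ ε)) =o[𝓝[≠] 0] fun ε : ℝ => ε := by
  rw [isLittleO_iff]
  intro η hη
  set k := Complex.exp (1 - 2 * Real.eulerMascheroniConstant) with hk
  have hk0 : 0 < ‖k‖ := norm_pos_iff.2 (Complex.exp_ne_zero _)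
  filter_upwards [wTerm_spec hρ (ρ ^ 2 / (4 * ‖k‖ * η))] with ε hε
  have h1 := congrArg norm hε.1
  have h2 := norm_wTerm_ge hε.2.1
  rw [norm_mul, norm_mul, Complex.norm_real, Real.norm_eq_abs, abs_div, abs_mul,
    abs_of_pos (by positivity : 0 < ρ ^ 2), abs_of_pos (by norm_num : (0 : ℝ) < 4)] at h1
  rw [Real.norm_eq_abs]
  have h3 : ρ ^ 2 / 4 ≤ ‖k‖ * ‖wTerm ρ ε‖ * η := by
    rw [div_le_iff₀ (by positivity)] at h2
    linarith
  have h4 : ‖k‖ * ‖wTerm ρ ε‖ * ‖Complex.exp (wTerm ρ ε)‖ ≤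
      ‖k‖ * ‖wTerm ρ ε‖ * (η * |ε|) := by
    calc _ = ρ ^ 2 / 4 * |ε| := by linarith
      _ ≤ ‖k‖ * ‖wTerm ρ ε‖ * η * |ε| := by gcongr
      _ = _ := by ring
  refine le_of_mul_le_mul_left h4 (mul_pos hk0 ?_)
  by_contra! h0
  nlinarith [norm_nonneg (wTerm ρ ε), sq_pos_of_pos hρ, mul_pos hk0 hη]

lemma isLittleO_exp_wTerm_half {ρ : ℝ} (hρ : 0 < ρ) :
    (fun ε : ℝ => Complex.exp (wTerm ρ ε / 2)) =o[𝓝[≠] 0] fun ε : ℝ => |ε| ^ (1 / 2 : ℝ) := by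
  rw [isLittleO_iff]
  intro η hη
  filter_upwards [isLittleO_iff.1 (isLittleO_exp_wTerm hρ) (sq_pos_of_pos hη)] with ε hε
  have h1 : ‖Complex.exp (wTerm ρ ε / 2)‖ ^ 2 = ‖Complex.exp (wTerm ρ ε)‖ := by
    rw [← norm_pow, ← Complex.exp_nat_mul]
    congr 2
    push_cast
    ring
  rw [← Real.sqrt_eq_rpow, Real.norm_eq_abs, abs_of_nonneg (Real.sqrt_nonneg _)]
  refine (sq_le_sq₀ (norm_nonneg _) (by positivity)).1 ?_
  rw [h1, mul_pow, Real.sq_sqrt (abs_nonneg ε)]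
  exact hε

/-- The correction `d` is at most `1/4` in norm and `-3π/2 ≤ Im W ≤ 0`, so `W + d` stays in the
strip `|Im| < 2π` where a zero of the mismatch is a genuine resonance. -/
theorem exists_isResonance {ρ a₀ : ℝ} (hρ : 0 < ρ) {l : ℤ} (hl : l = 1 ∨ l = -1)
    (h0 : bes0 ((-(a₀ ^ 2 * ρ ^ 2 / 4) : ℝ) : ℂ) = 0) :
    ∃ K, ∀ᶠ ε : ℝ in 𝓝[≠] 0, ∃ d : ℂ, ‖d‖ ≤ K * |ε| ∧ ‖d‖ ≤ 1 / 4 ∧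
      IsResonance ρ (well ρ (a₀ ^ 2 - ε)) (2 * Complex.I / (ρ : ℂ) *
        Complex.exp (1 / 2 - Real.eulerMascheroniConstant + (wTerm ρ ε + d) / 2)) := by
  obtain ⟨K, δ, hK, hδ, H⟩ := exists_mismatch_zero h0 (bes1_ne_zero h0)
  refine ⟨K * (ρ ^ 2 / 4), ?_⟩
  have hcont : Tendsto (fun ε : ℝ => ‖((ρ ^ 2 * ε / 4 : ℝ) : ℂ)‖) (𝓝[≠] 0) (𝓝 0) := by
    have : Continuous fun ε : ℝ => ‖((ρ ^ 2 * ε / 4 : ℝ) : ℂ)‖ := by fun_prop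
    simpa using (this.tendsto 0).mono_left nhdsWithin_le_nhds
  filter_upwards [self_mem_nhdsWithin, hcont.eventually (gt_mem_nhds hδ), wTerm_spec hρ 17]
    with ε hε h1 h2
  have hε0 : ε ≠ 0 := hε
  obtain ⟨h3, h4, h5, h6, -⟩ := h2
  have hne : ((ρ ^ 2 * ε / 4 : ℝ) : ℂ) ≠ 0 := by
    have : ρ ^ 2 * ε / 4 ≠ 0 := by positivity
    exact_mod_cast this
  obtain ⟨d, hd1, hd2, hd3, hd4⟩ := H _ _ _ hne h1 (norm_wTerm_ge h4) h3
  refine ⟨d, hd1.trans_eq ?_, hd2, ?_⟩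
  · rw [Complex.norm_real, Real.norm_eq_abs, abs_div, abs_mul,
      abs_of_pos (by positivity : 0 < ρ ^ 2), abs_of_pos (by norm_num : (0 : ℝ) < 4)]
    ring
  · have hpi := Real.pi_gt_three
    have hdi := abs_le.1 ((Complex.abs_im_le_norm d).trans hd2)
    refine isResonance_of_mismatch hρ hl ?_ ?_ ?_ hd3 hd4
    · push_cast; ring
    · rw [Complex.add_im]; linarith [hdi.1]
    · rw [Complex.add_im]; linarith [hdi.2]

/-- The error is a constant times `exp(W/2) (exp(d/2) - 1)`, that is `o(|ε|^{1/2})` times `O(ε)`. -/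
theorem exists_resonance_expansion {ρ a₀ : ℝ} (hρ : 0 < ρ) {l : ℤ} (hl : l = 1 ∨ l = -1)
    (h0 : bes0 ((-(a₀ ^ 2 * ρ ^ 2 / 4) : ℝ) : ℂ) = 0) :
    ∃ ε₀ : ℝ, 0 < ε₀ ∧ ∃ lam : ℝ → ℂ,
      (∀ ε : ℝ, 0 < |ε| → |ε| < ε₀ → IsResonance ρ (well ρ (a₀ ^ 2 - ε)) (lam ε)) ∧
      (fun ε : ℝ => lam ε - 2 * Complex.I / (ρ : ℂ) *
          Complex.exp (1 / 2 - (Real.eulerMascheroniConstant : ℂ) + wTerm ρ ε / 2))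
        =o[𝓝[≠] 0] (fun ε : ℝ => |ε| ^ (3 / 2 : ℝ)) := by
  obtain ⟨K, hK⟩ := exists_isResonance hρ hl h0
  have hK' := hK
  rw [eventually_nhdsWithin_iff, Metric.eventually_nhds_iff] at hK
  obtain ⟨ε₀, hε₀, H⟩ := hK
  have H' : ∀ ε : ℝ, ∃ d : ℂ, 0 < |ε| → |ε| < ε₀ → ‖d‖ ≤ K * |ε| ∧ ‖d‖ ≤ 1 / 4 ∧
      IsResonance ρ (well ρ (a₀ ^ 2 - ε)) (2 * Complex.I / (ρ : ℂ) *
        Complex.exp (1 / 2 - Real.eulerMascheroniConstant + (wTerm ρ ε + d) / 2)) := fun ε => by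
    by_cases h : 0 < |ε| ∧ |ε| < ε₀
    · obtain ⟨d, hd⟩ := H (y := ε) (by simpa using h.2) (abs_pos.1 h.1)
      exact ⟨d, fun _ _ => hd⟩
    -- Outside the punctured interval the value of `d` is immaterial.
    · exact ⟨0, fun h1 h2 => absurd ⟨h1, h2⟩ h⟩
  choose d hd using H'
  refine ⟨ε₀, hε₀, fun ε => 2 * Complex.I / (ρ : ℂ) *
    Complex.exp (1 / 2 - Real.eulerMascheroniConstant + (wTerm ρ ε + d ε) / 2),
    fun ε h1 h2 => (hd ε h1 h2).2.2, ?_⟩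
  obtain ⟨c, hc⟩ : ∃ c, c = 2 * Complex.I / (ρ : ℂ) *
    Complex.exp (1 / 2 - Real.eulerMascheroniConstant) := ⟨_, rfl⟩
  have hO : (fun ε : ℝ => 2 * Complex.I / (ρ : ℂ) *
        Complex.exp (1 / 2 - Real.eulerMascheroniConstant + (wTerm ρ ε + d ε) / 2) -
      2 * Complex.I / (ρ : ℂ) *
        Complex.exp (1 / 2 - (Real.eulerMascheroniConstant : ℂ) + wTerm ρ ε / 2))
      =O[𝓝[≠] 0] fun ε : ℝ => (ε : ℂ) * Complex.exp (wTerm ρ ε / 2) := by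
    refine IsBigO.of_bound (‖c‖ * K) ?_
    have hball : ∀ᶠ ε : ℝ in 𝓝[≠] 0, |ε| < ε₀ := by
      have := (Metric.ball_mem_nhds (0 : ℝ) hε₀)
      filter_upwards [nhdsWithin_le_nhds this] with ε h using by simpa using h
    filter_upwards [self_mem_nhdsWithin, hball] with ε h1 h2
    obtain ⟨h3, h4, -⟩ := hd ε (abs_pos.2 h1) h2
    have h5 : 2 * Complex.I / (ρ : ℂ) *
        Complex.exp (1 / 2 - Real.eulerMascheroniConstant + (wTerm ρ ε + d ε) / 2) -
      2 * Complex.I / (ρ : ℂ) *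
        Complex.exp (1 / 2 - (Real.eulerMascheroniConstant : ℂ) + wTerm ρ ε / 2) =
        c * Complex.exp (wTerm ρ ε / 2) * (Complex.exp (d ε / 2) - 1) := by
      rw [add_div, ← add_assoc, Complex.exp_add, Complex.exp_add, hc]; ring
    have h6 : ‖d ε / 2‖ = ‖d ε‖ / 2 := by simp
    have h7 := Complex.norm_exp_sub_one_le (x := d ε / 2) (by rw [h6]; linarith)
    rw [h6] at h7
    rw [h5, norm_mul, norm_mul, norm_mul, Complex.norm_real, Real.norm_eq_abs]
    calc _ ≤ ‖c‖ * ‖Complex.exp (wTerm ρ ε / 2)‖ * (K * |ε|) := by gcongr; linarith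
      _ = _ := by ring
  have hid : (fun ε : ℝ => (ε : ℂ)) =O[𝓝[≠] 0] fun ε : ℝ => |ε| :=
    IsBigO.of_bound 1 (Eventually.of_forall fun ε => by simp)
  refine (hO.trans_isLittleO (hid.mul_isLittleO (isLittleO_exp_wTerm_half hρ))).congr_right ?_
  intro ε
  rcases eq_or_ne ε 0 with rfl | h
  · norm_num
  · rw [← Real.rpow_one_add' (abs_nonneg ε) (by norm_num)]
    norm_num

/-- The map `t ↦ t e^t` is expanding in the relative sense on `(-∞, -2]`. -/
lemma neg_mul_exp_growth {s t : ℝ} (hst : s ≤ t) (ht : t ≤ -2) :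
    -s * Real.exp s * (1 + (t - s) / 2) ≤ -t * Real.exp t := by
  obtain ⟨d, hd⟩ : ∃ d, d = t - s := ⟨_, rfl⟩
  have hd0 : 0 ≤ d := by linarith
  have h1 := Real.quadratic_le_exp_of_nonneg hd0
  have h2 : Real.exp t = Real.exp s * Real.exp d := by rw [← Real.exp_add, hd]; ring_nf
  have h3 : -s * (1 + d / 2) ≤ -t * Real.exp d := by
    have h4 : -t * (1 + d + d ^ 2 / 2) ≤ -t * Real.exp d :=
      mul_le_mul_of_nonneg_left h1 (by linarith)
    have h5 : s = t - d := by linarith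
    rw [h5]
    nlinarith [mul_nonneg hd0 (by linarith : 0 ≤ -t - 2),
      mul_nonneg (sq_nonneg d) (by linarith : 0 ≤ -t - 2)]
  rw [← hd, h2]
  nlinarith [Real.exp_pos s]

/-- Stability of the real Lambert equation: relative expansion of `t ↦ t exp t` converts the error
`μ` into `|w - v| ≤ 4μ/q`, whether `w` lies above or below `v`; exponentiating costs a factor `2`.
-/
lemma exp_sub_exp_le_of_lambert {w v q μ : ℝ} (hw : w ≤ -2) (hv : v ≤ -2)
    (hq : -v * Real.exp v = q) (hμ : |w * Real.exp w - v * Real.exp v| ≤ μ) (hμq : 4 * μ ≤ q) :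
    |Real.exp w - Real.exp v| ≤ 8 * (μ / q) * Real.exp v := by
  have hev := Real.exp_pos v
  have hq0 : 0 < q := by rw [← hq]; exact mul_pos (by linarith) hev
  have hμ' := abs_le.1 hμ
  have hμ0 : 0 ≤ μ := (abs_nonneg _).trans hμ
  have hd : |w - v| ≤ 4 * (μ / q) := by
    rw [← mul_div_assoc, le_div_iff₀ hq0]
    rcases le_total w v with h | h
    · have h1 := neg_mul_exp_growth h hv
      rw [abs_of_nonpos (by linarith)]
      have h2 : q / 2 ≤ -w * Real.exp w := by nlinarith
      have h3 : q / 2 * (v - w) ≤ -w * Real.exp w * (v - w) := by gcongr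
      nlinarith
    · have h1 := neg_mul_exp_growth h hw
      rw [abs_of_nonneg (by linarith)]
      rw [hq] at h1
      nlinarith
  have hd1 : |w - v| ≤ 1 := hd.trans (by
    rw [← mul_div_assoc, div_le_one hq0]; exact hμq)
  have h1 : Real.exp w - Real.exp v = Real.exp v * (Real.exp (w - v) - 1) := by
    rw [mul_sub, ← Real.exp_add]; ring_nf
  have h2 : |Real.exp (w - v) - 1| ≤ 2 * |w - v| := Real.abs_exp_sub_one_le hd1
  rw [h1, abs_mul, abs_of_pos hev]
  calc _ ≤ Real.exp v * (2 * (4 * (μ / q))) := by gcongr; linarith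
    _ = _ := by ring

lemma tendsto_mul_log_nhdsGT_zero : Tendsto (fun x : ℝ => x * Real.log x) (𝓝[>] 0) (𝓝 0) := by
  simpa using (Real.continuous_mul_log.tendsto 0).mono_left nhdsWithin_le_nhds

lemma tendsto_mul_decSol' : Tendsto (fun x : ℝ => x * decSol' x) (𝓝[>] 0) (𝓝 0) := by
  have hid : Tendsto (fun x : ℝ => x) (𝓝[>] 0) (𝓝 0) := nhdsWithin_le_nhds
  have h := ((hid.mul tendsto_decSol'_sub_log).add tendsto_mul_log_nhdsGT_zero).add
    (hid.mul_const (2 * Real.eulerMascheroniConstant))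
  simp only [zero_mul, add_zero, mul_zero] at h
  exact h.congr fun x => by ring

/-- The threshold condition is forced by the eigenvalues: as `X → 0+`, `decSol X → 1` and `X decSol'
X → 0`, so the matching condition degenerates to `bes0 β = 0`. -/
lemma bes0_eq_zero_of_matching {β : ℂ} {F : Filter ℝ} [F.NeBot] {X e : ℝ → ℝ}
    (hX : Tendsto X F (𝓝[>] 0)) (he : Tendsto e F (𝓝 0))
    (hm : ∀ᶠ ε in F, (decSol (X ε) : ℂ) * bes0 (β + (e ε + X ε)) =
      ((X ε * decSol' (X ε) : ℝ) : ℂ) * bes1 (β + (e ε + X ε))) : bes0 β = 0 := by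
  have h1 := (Complex.continuous_ofReal.tendsto 1).comp (tendsto_decSol.comp hX)
  have h2 := (Complex.continuous_ofReal.tendsto 0).comp (tendsto_mul_decSol'.comp hX)
  have h3 := (Complex.continuous_ofReal.tendsto 0).comp (hX.mono_right nhdsWithin_le_nhds)
  have h4 := (Complex.continuous_ofReal.tendsto 0).comp he
  have h5 : Tendsto (fun ε => β + ((e ε : ℂ) + X ε)) F (𝓝 β) := by
    simpa using (h4.add h3).const_add β
  have h6 := h1.mul ((continuous_bes0.tendsto β).comp h5)
  have h7 := h2.mul ((continuous_bes1.tendsto β).comp h5)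
  simp only [Complex.ofReal_one, Complex.ofReal_zero, one_mul, zero_mul] at h6 h7
  exact tendsto_nhds_unique (h6.congr' hm) h7

/-- The matching condition for negative energies determines the energy up to second order. -/
theorem decaying_matching_expansion {β : ℂ} (hβ : bes0 β = 0) (hβ1 : bes1 β ≠ 0) :
    ∃ K δ, 0 ≤ K ∧ 0 < δ ∧ ∀ᶠ X : ℝ in 𝓝[>] 0, ∀ e : ℝ, e < 0 → -e < δ →
      (decSol X : ℂ) * bes0 (β + (e + X)) = ((X * decSol' X : ℝ) : ℂ) * bes1 (β + (e + X)) →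
      |X * (Real.log X + 2 * Real.eulerMascheroniConstant - 1) - e| ≤ K * e ^ 2 := by
  obtain ⟨C, δ₀, hδ₀, hC⟩ := decSol_asymptotics
  obtain ⟨K, hK0, hK⟩ := matching_error hβ (K₁ := 2) (by norm_num)
  have hj : 0 < ‖bes1 β‖ := norm_pos_iff.2 hβ1
  obtain ⟨K', hK'⟩ : ∃ K', K' = K / ‖bes1 β‖ := ⟨_, rfl⟩
  have hK'0 : 0 ≤ K' := by rw [hK']; positivity
  have hγ1 := Real.one_half_lt_eulerMascheroniConstant
  have hγ2 := Real.eulerMascheroniConstant_lt_two_thirds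
  set g := Real.eulerMascheroniConstant
  -- `κ` will bound both `-e` and `y = X(-w)`: `1/4` meets the smallness conditions of
  -- `matching_error`, and `1/32` gives `K'(-e + 2y) ≤ 1/8` below.
  obtain ⟨κ, hκ0, hκ1, hκ2⟩ : ∃ κ : ℝ, 0 < κ ∧ κ ≤ 1 / 4 ∧ K' * κ ≤ 1 / 32 := by
    refine ⟨1 / (32 * (K' + 1)), by positivity, ?_, ?_⟩
    · rw [div_le_div_iff₀ (by positivity) (by norm_num)]; linarith
    · rw [mul_one_div, div_le_div_iff₀ (by positivity) (by norm_num)]; linarith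
  refine ⟨16 * K', κ, by positivity, hκ0, ?_⟩
  filter_upwards [self_mem_nhdsWithin, nhdsWithin_le_nhds (gt_mem_nhds hδ₀),
    Real.tendsto_log_nhdsGT_zero.eventually (eventually_le_atBot (-(|C| + 10))),
    tendsto_mul_log_nhdsGT_zero.eventually (lt_mem_nhds (neg_lt_zero.2 hκ0))]
    with X hX0 hXδ hlog hXlog e he hes hm
  have hX0 : 0 < X := hX0
  obtain ⟨h1, h2⟩ := hC X hX0 hXδ
  have hC' := le_abs_self C
  have hC0 := abs_nonneg C
  obtain ⟨w, hw⟩ : ∃ w, w = Real.log X + 2 * g - 1 := ⟨_, rfl⟩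
  rw [← hw]
  have hw9 : w ≤ -9 := by linarith
  have hy0 : 0 < X * -w := mul_pos hX0 (by linarith)
  have hyκ : X * -w ≤ κ := by nlinarith
  have hnX : ‖(X : ℂ)‖ = X := by rw [Complex.norm_real, Real.norm_eq_abs, abs_of_pos hX0]
  have hne : ‖(e : ℂ)‖ = -e := by rw [Complex.norm_real, Real.norm_eq_abs, abs_of_neg he]
  have h3 : X * (-Real.log X + C) ≤ 2 * (X * (2 * -w)) := by
    have : -Real.log X + C ≤ 4 * -w := by linarith
    nlinarith
  have h4 := hK e X ((w + 1 : ℝ) : ℂ) (decSol X) ((X * decSol' X : ℝ) : ℂ) (2 * -w)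
    (by linarith)
    (by rw [Complex.norm_real, Real.norm_eq_abs, abs_of_neg (by linarith)]; linarith)
    (by rw [hnX]; linarith) (by rw [hne]; linarith)
    (by
      rw [hnX, ← Complex.ofReal_one, ← Complex.ofReal_sub, Complex.norm_real, Real.norm_eq_abs]
      exact h1.trans h3)
    (by
      rw [hnX, ← Complex.ofReal_mul, ← Complex.ofReal_sub, Complex.norm_real, Real.norm_eq_abs,
        ← mul_sub, abs_mul, abs_of_pos hX0]
      have h5 : decSol' X - (w + 1) = decSol' X - Real.log X - 2 * g := by rw [hw]; ring
      rw [h5]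
      calc X * _ ≤ X * (2 * (X * (2 * -w))) := by gcongr; exact h2.trans h3
        _ = _ := by ring)
  rw [hm, sub_self, zero_sub, norm_neg, norm_mul, hnX, hne] at h4
  have h6 : ‖(e : ℂ) + X - X * ((w + 1 : ℝ) : ℂ)‖ = |X * w - e| := by
    rw [← Complex.ofReal_mul, ← Complex.ofReal_add, ← Complex.ofReal_sub, Complex.norm_real,
      Real.norm_eq_abs, ← abs_neg]
    congr 1
    ring
  rw [h6] at h4
  obtain ⟨y, hy⟩ : ∃ y, y = X * -w := ⟨_, rfl⟩
  rw [show X * (2 * -w) = 2 * y by rw [hy]; ring, show X * w = -y by rw [hy]; ring] at h4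
  rw [show X * w = -y by rw [hy]; ring]
  rw [← hy] at hy0 hyκ
  have h7 : |-y - e| ≤ K' * (-e + 2 * y) ^ 2 := by
    rw [hK', div_mul_eq_mul_div, le_div_iff₀ hj]; linarith
  have h8 : K' * (-e + 2 * y) ≤ 1 / 8 := by nlinarith
  have h9 : K' * (-e + 2 * y) ^ 2 ≤ 1 / 8 * (-e + 2 * y) := by
    have : 0 ≤ -e + 2 * y := by linarith
    nlinarith
  -- A priori the quadratic error involves the unknown `y`. Being at most `(-e + 2y)/8`, it can be
  -- absorbed, and then `-e + 2y ≤ 4(-e)`.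
  have h10 : y ≤ 3 / 2 * -e := by
    have := (abs_le.1 (h7.trans h9)).1
    linarith
  calc _ ≤ K' * (-e + 2 * y) ^ 2 := h7
    _ ≤ K' * (4 * -e) ^ 2 :=
        mul_le_mul_of_nonneg_left (pow_le_pow_left₀ (by linarith) (by linarith) 2) hK'0
    _ = _ := by ring

/-- For `X = -Eρ²/4` and `w = log X + 2γ - 1`, `w` solves the Lambert equation with error `O(e²)`,
while `W` is real and solves it exactly. The relative error of `X` is thus `O(ε)`, and `exp W =
o(ε)` gives `o(ε²)`. -/
theorem eigenvalue_expansion {ρ : ℝ} (hρ : 0 < ρ) {E : ℝ → ℝ} {β : ℂ} (hβ : bes0 β = 0)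
    (hβ1 : bes1 β ≠ 0) (hX : Tendsto (fun ε => -E ε / 4 * ρ ^ 2) (𝓝[<] 0) (𝓝[>] 0))
    (hm : ∀ᶠ ε in 𝓝[<] 0, (decSol (-E ε / 4 * ρ ^ 2) : ℂ) *
        bes0 (β + ((ρ ^ 2 * ε / 4 : ℝ) + (-E ε / 4 * ρ ^ 2 : ℝ))) =
      ((-E ε / 4 * ρ ^ 2 * decSol' (-E ε / 4 * ρ ^ 2) : ℝ) : ℂ) *
        bes1 (β + ((ρ ^ 2 * ε / 4 : ℝ) + (-E ε / 4 * ρ ^ 2 : ℝ)))) :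
    (fun ε : ℝ => (E ε : ℂ) - -(4 / (ρ : ℂ) ^ 2 *
          Complex.exp (1 - 2 * (Real.eulerMascheroniConstant : ℂ) + wTerm ρ ε)))
        =o[𝓝[<] 0] (fun ε : ℝ => ε ^ 2) := by
  obtain ⟨K, δ, hK0, hδ, H⟩ := decaying_matching_expansion hβ hβ1
  set g := Real.eulerMascheroniConstant with hg
  have hle : 𝓝[<] (0 : ℝ) ≤ 𝓝[≠] 0 := nhdsWithin_mono _ fun x hx => ne_of_lt hx
  have hlim : Tendsto (fun ε : ℝ => -(ρ ^ 2 * ε / 4)) (𝓝[<] 0) (𝓝 0) := by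
    have : Continuous fun ε : ℝ => -(ρ ^ 2 * ε / 4) := by fun_prop
    simpa using (this.tendsto 0).mono_left nhdsWithin_le_nhds
  have hlim2 : Tendsto (fun ε : ℝ => 4 * K * -(ρ ^ 2 * ε / 4)) (𝓝[<] 0) (𝓝 0) := by
    simpa using hlim.const_mul (4 * K)
  have hO : (fun ε : ℝ => (E ε : ℂ) - -(4 / (ρ : ℂ) ^ 2 *
          Complex.exp (1 - 2 * (g : ℂ) + wTerm ρ ε)))
      =O[𝓝[<] 0] fun ε : ℝ => (ε : ℂ) * Complex.exp (wTerm ρ ε) := by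
    refine IsBigO.of_bound (8 * K * Real.exp (1 - 2 * g)) ?_
    filter_upwards [self_mem_nhdsWithin, hm, hX.eventually H, hX.eventually self_mem_nhdsWithin,
      hX.eventually (Real.tendsto_log_nhdsGT_zero.eventually (eventually_le_atBot (-3))),
      hlim.eventually (gt_mem_nhds hδ), hlim2.eventually (ge_mem_nhds one_pos),
      hle (wTerm_spec hρ 2)] with ε hε0 hmε hHε hXε hlogε hδε hKε hWε
    have hε0 : ε < 0 := hε0
    obtain ⟨h1, h2, -, -, h3⟩ := hWε
    have hE4 : E ε = -(4 / ρ ^ 2 * (-E ε / 4 * ρ ^ 2)) := by field_simp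
    obtain ⟨X, hXd⟩ : ∃ X, X = -E ε / 4 * ρ ^ 2 := ⟨_, rfl⟩
    obtain ⟨e, hed⟩ : ∃ e, e = ρ ^ 2 * ε / 4 := ⟨_, rfl⟩
    rw [← hXd] at hmε hHε hXε hlogε hE4
    rw [← hed] at hmε h1 hδε hKε
    have hX0 : 0 < X := hXε
    have he0 : e < 0 := by rw [hed]; nlinarith [sq_pos_of_pos hρ]
    have h4 := hHε e he0 hδε hmε
    have hWr : wTerm ρ ε = ((wTerm ρ ε).re : ℂ) := by
      apply Complex.ext <;> simp [h3 hε0]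
    obtain ⟨v, hv⟩ : ∃ v, v = (wTerm ρ ε).re := ⟨_, rfl⟩
    rw [← hv] at hWr h2
    obtain ⟨w, hw⟩ : ∃ w, w = Real.log X + 2 * g - 1 := ⟨_, rfl⟩
    rw [← hw] at h4
    obtain ⟨c, hc⟩ : ∃ c, c = Real.exp (1 - 2 * g) := ⟨_, rfl⟩
    have hc0 : 0 < c := hc ▸ Real.exp_pos _
    have hcw : c * Real.exp w = X := by
      rw [hc, hw, ← Real.exp_add, show 1 - 2 * g + (Real.log X + 2 * g - 1) = Real.log X by ring,
        Real.exp_log hX0]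
    have hcc : Complex.exp (1 - 2 * (g : ℂ)) = (c : ℂ) := by rw [hc]; push_cast; rfl
    have hcv : c * (v * Real.exp v) = e := by
      rw [hWr, hcc, ← Complex.ofReal_exp] at h1
      exact_mod_cast h1
    -- Here `c exp w = X` and `c v exp v = e`, so dividing the error bound for `X w - e` by `c`
    -- gives the hypothesis; the ratio `μ/q` is `K(-e)`.
    have h5 := exp_sub_exp_le_of_lambert (w := w) (v := v) (q := -e / c) (μ := K * e ^ 2 / c)
      (by linarith [Real.eulerMascheroniConstant_lt_two_thirds]) h2
      (by rw [← hcv]; field_simp)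
      (by
        rw [le_div_iff₀ hc0]
        refine le_of_eq_of_le ?_ h4
        rw [show |w * Real.exp w - v * Real.exp v| * c =
          |w * Real.exp w - v * Real.exp v| * |c| by rw [abs_of_pos hc0], ← abs_mul]
        congr 1
        rw [← hcw]
        linear_combination -hcv)
      (by
        rw [← mul_div_assoc]
        gcongr
        nlinarith)
    have h6 : K * e ^ 2 / c / (-e / c) = K * -e := by
      have := he0.ne
      field_simp
    rw [h6] at h5
    have h7 : (E ε : ℂ) - -(4 / (ρ : ℂ) ^ 2 * Complex.exp (1 - 2 * (g : ℂ) + wTerm ρ ε)) =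
        ((-(4 / ρ ^ 2 * c * (Real.exp w - Real.exp v)) : ℝ) : ℂ) := by
      rw [Complex.exp_add, hcc, hWr, hE4, ← hcw]
      push_cast
      ring
    rw [h7, hWr, norm_mul, ← Complex.ofReal_exp, Complex.norm_real, Complex.norm_real,
      Complex.norm_real, Real.norm_eq_abs, Real.norm_eq_abs, Real.norm_eq_abs, abs_neg, abs_mul,
      abs_of_pos (Real.exp_pos v), abs_of_neg hε0, abs_of_pos (by positivity : 0 < 4 / ρ ^ 2 * c),
      ← hc]
    calc 4 / ρ ^ 2 * c * _ ≤ 4 / ρ ^ 2 * c * (8 * (K * -e) * Real.exp v) := by gcongr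
      _ = _ := by rw [hed]; field_simp
  have hlo : (fun ε : ℝ => Complex.exp (wTerm ρ ε)) =o[𝓝[<] 0] fun ε : ℝ => ε :=
    (isLittleO_exp_wTerm hρ).mono hle
  refine hO.trans_isLittleO ?_
  have hid : (fun ε : ℝ => (ε : ℂ)) =O[𝓝[<] 0] fun ε : ℝ => ε :=
    IsBigO.of_bound 1 (Eventually.of_forall fun ε => by simp)
  exact (hid.mul_isLittleO hlo).congr_right fun ε => (sq ε).symm

end CircularWell

end

/-! ### Conclusion: threshold condition, resonance and eigenvalue. -/

theorem lemmal (ρ a₀ ε₁ : ℝ) (hρ : 0 < ρ) (ha₀ : 0 < a₀) (hε₁ : 0 < ε₁)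
    (l : ℤ) (hl : l = 1 ∨ l = -1)
    (E : ℝ → ℝ) (ψ : ℝ → ℂ → ℂ)
    (hψ : ∀ ε ∈ Set.Ioo (-ε₁) 0,
      CircularWell.IsEigenfunction (CircularWell.well ρ (a₀ ^ 2 - ε)) (E ε : ℂ) (ψ ε) ∧
        CircularWell.IsMode l (ψ ε))
    (hE : Tendsto E (𝓝[<] 0) (𝓝[<] 0)) :
    (∃ ε₀ : ℝ, 0 < ε₀ ∧ ∃ lam : ℝ → ℂ,
      (∀ ε : ℝ, 0 < |ε| → |ε| < ε₀ →
        CircularWell.IsResonance ρ (CircularWell.well ρ (a₀ ^ 2 - ε)) (lam ε)) ∧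
      (fun ε : ℝ => lam ε - 2 * Complex.I / (ρ : ℂ) *
          Complex.exp (1 / 2 - (Real.eulerMascheroniConstant : ℂ)
            + CircularWell.wTerm ρ ε / 2))
        =o[𝓝[≠] 0] (fun ε : ℝ => |ε| ^ (3 / 2 : ℝ))) ∧
    ((fun ε : ℝ => (E ε : ℂ) - -(4 / (ρ : ℂ) ^ 2 *
          Complex.exp (1 - 2 * (Real.eulerMascheroniConstant : ℂ) + CircularWell.wTerm ρ ε)))
        =o[𝓝[<] 0] (fun ε : ℝ => ε ^ 2)) ∧
    ((fun ε : ℝ => (E ε : ℂ) - -((ε : ℂ) / CircularWell.wTerm ρ ε))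
        =o[𝓝[<] 0] (fun ε : ℝ => ε ^ 2)) := by
  have hm : ∀ᶠ ε in 𝓝[<] 0, (CircularWell.decSol (-E ε / 4 * ρ ^ 2) : ℂ) *
        CircularWell.bes0 (((-(a₀ ^ 2 * ρ ^ 2 / 4) : ℝ) : ℂ) +
          ((ρ ^ 2 * ε / 4 : ℝ) + (-E ε / 4 * ρ ^ 2 : ℝ))) =
      ((-E ε / 4 * ρ ^ 2 * CircularWell.decSol' (-E ε / 4 * ρ ^ 2) : ℝ) : ℂ) *
        CircularWell.bes1 (((-(a₀ ^ 2 * ρ ^ 2 / 4) : ℝ) : ℂ) +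
          ((ρ ^ 2 * ε / 4 : ℝ) + (-E ε / 4 * ρ ^ 2 : ℝ))) := by
    filter_upwards [Ioo_mem_nhdsLT (neg_lt_zero.2 hε₁), hE.eventually self_mem_nhdsWithin]
      with ε hε hneg
    have h := (hψ ε hε).1.matching hρ hneg hl (hψ ε hε).2 (c := -E ε / 4) (by ring)
    have harg : ((((-E ε / 4 : ℝ) : ℂ) - ((a₀ ^ 2 - ε : ℝ) : ℂ) / 4) * (ρ ^ 2 : ℝ)) =
        ((-(a₀ ^ 2 * ρ ^ 2 / 4) : ℝ) : ℂ) +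
          ((ρ ^ 2 * ε / 4 : ℝ) + (-E ε / 4 * ρ ^ 2 : ℝ)) := by
      push_cast; ring
    rw [harg] at h
    rw [h, ← Complex.ofReal_mul]
    congr 2
    ring
  have hX : Tendsto (fun ε => -E ε / 4 * ρ ^ 2) (𝓝[<] 0) (𝓝[>] 0) := by
    rw [tendsto_nhdsWithin_iff] at hE ⊢
    refine ⟨by simpa using (hE.1.neg.div_const 4).mul_const (ρ ^ 2), ?_⟩
    filter_upwards [hE.2] with ε h
    have h : E ε < 0 := h
    exact mul_pos (show 0 < -E ε / 4 by linarith) (sq_pos_of_pos hρ)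
  have hlim : Tendsto (fun ε : ℝ => ρ ^ 2 * ε / 4) (𝓝[<] 0) (𝓝 0) := by
    have : Continuous fun ε : ℝ => ρ ^ 2 * ε / 4 := by fun_prop
    simpa using (this.tendsto 0).mono_left nhdsWithin_le_nhds
  have h0 := CircularWell.bes0_eq_zero_of_matching hX hlim hm
  have hexp := CircularWell.eigenvalue_expansion hρ h0 (CircularWell.bes1_ne_zero h0) hX hm
  -- The last two expansions have the same main term: `exp(1 - 2γ) W exp W = ρ²ε/4` means `(4/ρ²)
  -- exp(1 - 2γ + W) = ε/W`.
  refine ⟨CircularWell.exists_resonance_expansion hρ hl h0, hexp, hexp.congr' ?_ EventuallyEq.rfl⟩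
  have hle : 𝓝[<] (0 : ℝ) ≤ 𝓝[≠] 0 := nhdsWithin_mono _ fun x hx => ne_of_lt hx
  filter_upwards [hle (CircularWell.wTerm_spec hρ 1)] with ε hε
  have hW : CircularWell.wTerm ρ ε ≠ 0 :=
    norm_pos_iff.1 (one_pos.trans_le (CircularWell.norm_wTerm_ge hε.2.1))
  have hρc : (ρ : ℂ) ≠ 0 := by exact_mod_cast hρ.ne'
  have h1 := hε.1
  push_cast at h1
  rw [Complex.exp_add]
  congr 2
  field_simp
  linear_combination 4 * h1
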